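/- Let $\Omega=(0,1)^2$, and let $b=(b_1,b_2)\in C^1(\bar\Omega)^2$, $c\in C(\bar\Omega)$ satisfy, on $\bar\Omega$, $b_1\ge\beta_1>0$, $b_2\ge\beta_2>0$, $c\ge 0$ and $c-\frac12\nabla\cdot b\ge\mu_0>0$ with constants $\beta_1,\beta_2,\mu_0$. For $\varepsilon>0$ and $f\in C(\bar\Omega)$ let $u$ be the solution of $$-\varepsilon\Delta u+b\cdot\nabla u+cu=f\ \text{ in }\Omega,\qquad u=0\ \text{ on }\partial\Omega .$$ *Layer decomposition with constant $A>0$.* On $\bar\Omega$ one has $u=S+E_1+E_2+E_{12}$ with $S\in C^2(\bar\Omega)$, $E_1,E_2,E_{12}\in C^3(\bar\Omega)$, such that for all $(x,y)\in\bar\Omega$: $|\partial_x^i\partial_y^jS|\le A$ for $0\le i+j\le2$, and for $0\le i+j\le 3$ $$|\partial_x^i\partial_y^jE_1|\le A\varepsilon^{-i}e^{-\beta_1(1-x)/\varepsilon},\quad |\partial_x^i\partial_y^jE_2|\le A\varepsilon^{-j}e^{-\beta_2(1-y)/\varepsilon},\quad |\partial_x^i\partial_y^jE_{12}|\le A\varepsilon^{-(i+j)}e^{-(\beta_1(1-x)+\beta_2(1-y))/\varepsilon}.$$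 *Mesh.* Let $N\ge4$ be an even integer, $0<\varepsilon\le N^{-1}$, $\rho=2.5$, $\lambda_x=\min\{\frac12,\rho\frac{\varepsilon}{\beta_1}\ln N\}$, $\lambda_y=\min\{\frac12,\rho\frac{\varepsilon}{\beta_2}\ln N\}$, and assume $\lambda_x=\rho\varepsilon\beta_1^{-1}\ln N$, $\lambda_y=\rho\varepsilon\beta_2^{-1}\ln N$. The points $0=x_0<\dots<x_N=1$ divide each of $[0,1-\lambda_x]$ and $[1-\lambda_x,1]$ into $N/2$ equal intervals, and $0=y_0<\dots<y_N=1$ do the same with $\lambda_y$. The triangulation $\mathcal T_N$ consists, for $0\le i,j<N$, of the triangle with vertices $(x_i,y_j),(x_{i+1},y_j),(x_i,y_{j+1})$ and the triangle with vertices $(x_i,y_{j+1}),(x_{i+1},y_j),(x_{i+1},y_{j+1})$. Let $V^N$ be the space of continuous functions on $\bar\Omega$ that are affine on every $K\in\mathcal T_N$ and vanish on $\partial\Omega$, and let $u^I$ be the continuous function, affine on every $K\in\mathcal T_N$, that agrees with $u$ at all the nodes $(x_i,y_j)$. *Method.* Let $\Omega_s=[0,1-\lambda_x]\times[0,1-\lambda_y]$.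 For a constant $C^*>0$ put $\delta_K=C^*N^{-1}$ if $K\subset\Omega_s$ and $\delta_K=0$ otherwise, and, with $(\cdot,\cdot)_D$ and $\|\cdot\|_D$ the inner product and the norm of $L^2(D)$ (the index being dropped for $D=\Omega$), $$a_{SD}(w,v)=\varepsilon(\nabla w,\nabla v)+(b\cdot\nabla w+cw,v)+\sum_{K\in\mathcal T_N}(-\varepsilon\Delta w+b\cdot\nabla w+cw,\ \delta_K\,b\cdot\nabla v)_K .$$ The SDFEM solution is $u^N\in V^N$ with $a_{SD}(u^N,v)=(f,v)+\sum_{K}(f,\delta_K\,b\cdot\nabla v)_K$ for all $v\in V^N$. Put $$\|v\|_\varepsilon^2=\varepsilon\|\nabla v\|^2+\mu_0\|v\|^2,\qquad \|v\|_{SD}^2=\|v\|_\varepsilon^2+\sum_{K}\delta_K\|b\cdot\nabla v\|_K^2 .$$ The constant $C^*$ is required to be such that the coercivity $a_{SD}(v,v)\ge\frac12\|v\|_{SD}^2$ holds for all $v\in V^N$. **Theorem.** There is $C_0>0$, depending only on $b,c,\mu_0,\beta_1,\beta_2$, such that every $C^*\in(0,C_0]$ meets this requirement for all $\varepsilon$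 and $N$ as above. For all $C^*>0$ and $A>0$ there is a constant $C$, depending only on $b,c,\beta_1,\beta_2,\mu_0,C^*,A$ (and so not on $\varepsilon$ and $N$), such that, for all $\varepsilon$ and $N$ as above for which $C^*$ meets the requirement and all $f$ for which the solution $u$ admits a layer decomposition with constant $A$, $$\|u^I-u^N\|_\varepsilon\le\|u^I-u^N\|_{SD}\le C\left(\varepsilon^{1/2}N^{-1}+N^{-3/2}\right)\ln^{3/2}N .$$ -/

import Mathlib

open MeasureTheory Set

noncomputable section

namespace SDFEM

/-- The open unit square `Ω = (0,1)²`. -/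
def Omega : Set (ℝ × ℝ) := Ioo 0 1 ×ˢ Ioo 0 1

/-- The closed unit square. -/
def OmegaBar : Set (ℝ × ℝ) := Icc 0 1 ×ˢ Icc 0 1

/-- Partial derivative in `x` on the closed unit square: the ordinary partial derivative at points
with `0 < x < 1` and the one-sided one at `x = 0` and `x = 1`.  For a continuous piecewise linear
function it agrees almost everywhere with the weak derivative. -/
def pdx (g : ℝ × ℝ → ℝ) (p : ℝ × ℝ) : ℝ :=
  derivWithin (fun t => g (t, p.2)) (Icc 0 1) p.1

/-- Partial derivative in `y` on the closed unit square. -/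
def pdy (g : ℝ × ℝ → ℝ) (p : ℝ × ℝ) : ℝ :=
  derivWithin (fun t => g (p.1, t)) (Icc 0 1) p.2

/-- The Laplacian. -/
def lap (g : ℝ × ℝ → ℝ) (p : ℝ × ℝ) : ℝ := pdx (pdx g) p + pdy (pdy g) p

/-- The coefficients `b = (b₁, b₂)`, `c` of the boundary value problem and the constants
`β₁, β₂, μ₀` of the standing assumptions. -/
structure Coeffs where
  b₁ : ℝ × ℝ → ℝ
  b₂ : ℝ × ℝ → ℝ
  c : ℝ × ℝ → ℝ
  β₁ : ℝ
  β₂ : ℝ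
  μ₀ : ℝ

/-- The standing assumptions on the coefficients. -/
structure Coeffs.Admissible (P : Coeffs) : Prop where
  smooth_b₁ : ContDiffOn ℝ 1 P.b₁ OmegaBar
  smooth_b₂ : ContDiffOn ℝ 1 P.b₂ OmegaBar
  cont_c : ContinuousOn P.c OmegaBar
  β₁_pos : 0 < P.β₁
  β₂_pos : 0 < P.β₂
  μ₀_pos : 0 < P.μ₀
  b₁_ge : ∀ p ∈ OmegaBar, P.β₁ ≤ P.b₁ p
  b₂_ge : ∀ p ∈ OmegaBar, P.β₂ ≤ P.b₂ p
  c_nonneg : ∀ p ∈ OmegaBar, 0 ≤ P.c p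
  c_sub_div_ge : ∀ p ∈ OmegaBar, P.μ₀ ≤ P.c p - (1 / 2) * (pdx P.b₁ p + pdy P.b₂ p)

/-- The convective derivative `b · ∇v`. -/
def Coeffs.conv (P : Coeffs) (v : ℝ × ℝ → ℝ) (p : ℝ × ℝ) : ℝ :=
  P.b₁ p * pdx v p + P.b₂ p * pdy v p

/-- `u` solves `-ε Δu + b · ∇u + c u = f` in `Ω`, `u = 0` on `∂Ω`. -/
structure IsSolution (P : Coeffs) (ε : ℝ) (f u : ℝ × ℝ → ℝ) : Prop where
  contDiffOn : ContDiffOn ℝ 2 u Omega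
  continuousOn : ContinuousOn u OmegaBar
  eqn : ∀ p ∈ Omega, -ε * lap u p + P.conv u p + P.c p * u p = f p
  boundary : ∀ p ∈ frontier Omega, u p = 0

/-- The layer decomposition `u = S + E₁ + E₂ + E₁₂` on the closed square, with all the derivative
bounds holding with the constant `A`. -/
structure IsLayerDecomposition (P : Coeffs) (ε A : ℝ) (u S E₁ E₂ E₁₂ : ℝ × ℝ → ℝ) : Prop where
  smooth_S : ContDiffOn ℝ 2 S OmegaBar
  smooth_E₁ : ContDiffOn ℝ 3 E₁ OmegaBar
  smooth_E₂ : ContDiffOn ℝ 3 E₂ OmegaBar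
  smooth_E₁₂ : ContDiffOn ℝ 3 E₁₂ OmegaBar
  decomp : ∀ p ∈ OmegaBar, u p = S p + E₁ p + E₂ p + E₁₂ p
  bound_S : ∀ i j : ℕ, i + j ≤ 2 → ∀ p ∈ OmegaBar, |(pdx^[i] (pdy^[j] S)) p| ≤ A
  bound_E₁ : ∀ i j : ℕ, i + j ≤ 3 → ∀ p ∈ OmegaBar,
    |(pdx^[i] (pdy^[j] E₁)) p| ≤ A * (ε ^ i)⁻¹ * Real.exp (-(P.β₁ * (1 - p.1)) / ε)
  bound_E₂ : ∀ i j : ℕ, i + j ≤ 3 → ∀ p ∈ OmegaBar,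
    |(pdx^[i] (pdy^[j] E₂)) p| ≤ A * (ε ^ j)⁻¹ * Real.exp (-(P.β₂ * (1 - p.2)) / ε)
  bound_E₁₂ : ∀ i j : ℕ, i + j ≤ 3 → ∀ p ∈ OmegaBar,
    |(pdx^[i] (pdy^[j] E₁₂)) p| ≤ A * (ε ^ (i + j))⁻¹ *
      Real.exp (-(P.β₁ * (1 - p.1) + P.β₂ * (1 - p.2)) / ε)

/-- The solution admits a layer decomposition with constant `A`. -/
def HasLayerDecomposition (P : Coeffs) (ε A : ℝ) (u : ℝ × ℝ → ℝ) : Prop :=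
  ∃ S E₁ E₂ E₁₂ : ℝ × ℝ → ℝ, IsLayerDecomposition P ε A u S E₁ E₂ E₁₂

/-- The mesh transition parameter `min {1/2, ρ (ε/β) ln N}` with `ρ = 5/2`. -/
def transition (β ε : ℝ) (N : ℕ) : ℝ := min (1 / 2) (5 / 2 * (ε / β) * Real.log N)

/-- The standing assumptions on `ε` and `N`. -/
structure MeshAssumption (P : Coeffs) (ε : ℝ) (N : ℕ) : Prop where
  four_le : 4 ≤ N
  even : Even N
  ε_pos : 0 < ε
  ε_le : ε ≤ (N : ℝ)⁻¹
  transition_x : transition P.β₁ ε N = 5 / 2 * (ε / P.β₁) * Real.log N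
  transition_y : transition P.β₂ ε N = 5 / 2 * (ε / P.β₂) * Real.log N

/-- The `i`-th one-dimensional mesh point: `[0, 1 - lam]` and `[1 - lam, 1]` are each divided
into `N / 2` equal parts. -/
def node (lam : ℝ) (N i : ℕ) : ℝ :=
  if i ≤ N / 2 then (i : ℝ) * ((1 - lam) / ((N : ℝ) / 2))
  else 1 - lam + ((i : ℝ) - (N : ℝ) / 2) * (lam / ((N : ℝ) / 2))

/-- The mesh point `(x_i, y_j)`. -/
def meshPoint (P : Coeffs) (ε : ℝ) (N i j : ℕ) : ℝ × ℝ :=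
  (node (transition P.β₁ ε N) N i, node (transition P.β₂ ε N) N j)

/-- The closed mesh triangles: `(i, j, false)` is the index of `K¹_{i,j}`, and `(i, j, true)` that
of `K²_{i,j}`. -/
def tri (P : Coeffs) (ε : ℝ) (N : ℕ) : ℕ × ℕ × Bool → Set (ℝ × ℝ)
  | (i, j, false) => convexHull ℝ
      {meshPoint P ε N i j, meshPoint P ε N (i + 1) j, meshPoint P ε N i (j + 1)}
  | (i, j, true) => convexHull ℝ
      {meshPoint P ε N i (j + 1), meshPoint P ε N (i + 1) j, meshPoint P ε N (i + 1) (j + 1)}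

/-- The indices of the `2 N²` mesh triangles. -/
def triIndex (N : ℕ) : Finset (ℕ × ℕ × Bool) :=
  Finset.range N ×ˢ (Finset.range N ×ˢ Finset.univ)

/-- The subdomain `Ω_s` away from the layers. -/
def OmegaS (P : Coeffs) (ε : ℝ) (N : ℕ) : Set (ℝ × ℝ) :=
  Icc 0 (1 - transition P.β₁ ε N) ×ˢ Icc 0 (1 - transition P.β₂ ε N)

/-- `v` is continuous on the closed square and affine on every mesh triangle. -/
structure IsPiecewiseLinear (P : Coeffs) (ε : ℝ) (N : ℕ) (v : ℝ × ℝ → ℝ) : Prop where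
  continuousOn : ContinuousOn v OmegaBar
  affine : ∀ k ∈ triIndex N, ∃ a₀ a₁ a₂ : ℝ, ∀ p ∈ tri P ε N k, v p = a₀ + a₁ * p.1 + a₂ * p.2

/-- Membership in the finite element space `V^N ⊂ H¹₀(Ω)`.  Only the values on the closed square
matter. -/
structure MemVN (P : Coeffs) (ε : ℝ) (N : ℕ) (v : ℝ × ℝ → ℝ) : Prop
    extends IsPiecewiseLinear P ε N v where
  boundary : ∀ p ∈ frontier Omega, v p = 0

/-- `wI` is the nodal piecewise linear interpolant of `w` (unique on the closed square). -/
structure IsNodalInterpolant (P : Coeffs) (ε : ℝ) (N : ℕ) (w wI : ℝ × ℝ → ℝ) : Prop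
    extends IsPiecewiseLinear P ε N wI where
  interp : ∀ i j : ℕ, i ≤ N → j ≤ N → wI (meshPoint P ε N i j) = w (meshPoint P ε N i j)

open Classical in
/-- The stabilization parameter: `C* N⁻¹` if `K ⊂ Ω_s`, and `0` otherwise. -/
def delta (P : Coeffs) (ε : ℝ) (N : ℕ) (Cstar : ℝ) (k : ℕ × ℕ × Bool) : ℝ :=
  if tri P ε N k ⊆ OmegaS P ε N then Cstar * (N : ℝ)⁻¹ else 0

/-- The Galerkin bilinear form. -/
def aGal (P : Coeffs) (ε : ℝ) (u v : ℝ × ℝ → ℝ) : ℝ :=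
  ε * (∫ p in Omega, (pdx u p * pdx v p + pdy u p * pdy v p))
    + ∫ p in Omega, (P.conv u p + P.c p * u p) * v p

/-- The stabilization form. -/
def aStab (P : Coeffs) (ε : ℝ) (N : ℕ) (Cstar : ℝ) (u v : ℝ × ℝ → ℝ) : ℝ :=
  ∑ k ∈ triIndex N, ∫ p in tri P ε N k,
    (-ε * lap u p + P.conv u p + P.c p * u p) * (delta P ε N Cstar k * P.conv v p)

/-- The bilinear form of the streamline diffusion method. -/
def aSD (P : Coeffs) (ε : ℝ) (N : ℕ) (Cstar : ℝ) (u v : ℝ × ℝ → ℝ) : ℝ :=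
  aGal P ε u v + aStab P ε N Cstar u v

/-- `uN` is the solution of the streamline diffusion finite element method. -/
structure IsSDFEMSolution (P : Coeffs) (ε : ℝ) (N : ℕ) (Cstar : ℝ) (f uN : ℝ × ℝ → ℝ) :
    Prop where
  mem : MemVN P ε N uN
  eqn : ∀ v, MemVN P ε N v → aSD P ε N Cstar uN v =
    (∫ p in Omega, f p * v p)
      + ∑ k ∈ triIndex N, ∫ p in tri P ε N k, f p * (delta P ε N Cstar k * P.conv v p)

/-- The square of the energy norm, `ε |v|₁² + μ₀ ‖v‖²`. -/
def energySq (P : Coeffs) (ε : ℝ) (v : ℝ × ℝ → ℝ) : ℝ :=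
  ε * (∫ p in Omega, (pdx v p ^ 2 + pdy v p ^ 2)) + P.μ₀ * ∫ p in Omega, v p ^ 2

/-- The square of the streamline diffusion norm. -/
def sdSq (P : Coeffs) (ε : ℝ) (N : ℕ) (Cstar : ℝ) (v : ℝ × ℝ → ℝ) : ℝ :=
  energySq P ε v
    + ∑ k ∈ triIndex N, delta P ε N Cstar k * ∫ p in tri P ε N k, P.conv v p ^ 2

/-- The energy norm `‖v‖_ε`. -/
def energyNorm (P : Coeffs) (ε : ℝ) (v : ℝ × ℝ → ℝ) : ℝ := Real.sqrt (energySq P ε v)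

/-- The streamline diffusion norm `‖v‖_SD`. -/
def sdNorm (P : Coeffs) (ε : ℝ) (N : ℕ) (Cstar : ℝ) (v : ℝ × ℝ → ℝ) : ℝ :=
  Real.sqrt (sdSq P ε N Cstar v)

/-- The requirement that selects `C*`: coercivity of the bilinear form on `V^N` in the streamline
diffusion norm, with constant `1/2`. -/
def Coercive (P : Coeffs) (ε : ℝ) (N : ℕ) (Cstar : ℝ) : Prop :=
  ∀ v, MemVN P ε N v → (1 / 2) * sdNorm P ε N Cstar v ^ 2 ≤ aSD P ε N Cstar v v

end SDFEM

end

/-! ### Calculus with one-sided partial derivatives on the closed square -/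

namespace SDFEM

/-! Let `v = uI - uN`, an element of `V^N`, and `η = uI - u`. Coercivity bounds ½‖v‖²_SD by `aSD` at
`(v, v)`. Since `u` solves the differential equation pointwise and `uN` the discrete one, that value
consists of four terms in `η` (`ErrorSetting.aSD_error`): ε(∇η, ∇v), -(η, b·∇v), ((c - ∇·b)η, v),
and C*N⁻¹ times the integral over the coarse region of (εΔu + b·∇η + cη) b·∇v. Each is at most a
constant times `rate ε N` ‖v‖_SD, and one factor of the norm cancels. Below, L = ln N / N, and `tau`
= N^(-5/2) is the size to which the layer functions have decayed at the transition lines.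

Diffusion. For most parts of `u` the Cauchy–Schwarz inequality suffices: the gradient error is of
order L, or it is small through `tau`, or it lives in the corner, of area of order (ε ln N)². The
exception is the x-derivative of E₁ in the layer x > 1 - λ_x, where the pointwise error is only
ε⁻¹L; on a strip of width ε ln N this yields L(ln N)^(1/2), short by a factor N^(-1/2) when ε is
small. Here cancellation helps. The derivative of `v` along a horizontal edge is the same on both
triangles at that edge, and where the mesh is uniform in y these triangles are mirror images in the
midpoint of the edge. The average of the error over symmetric points is of second order, ε⁻¹L²
(`superclose_pointwise`, `abs_gradDefect_add_le`). Pairing fails only for the two rows at y = 1 -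
λ_y; they form a strip of height at most 4/N, whose square root is the missing N^(-1/2)
(`superclose_sum`, `exists_superclose_bound`).

Convection. The derivative has been moved to `v`. On the coarse region |η| is O(N⁻²) and the
streamline norm controls b·∇v up to N^(1/2). In the layers |η| is O(L²), and the factor ε^(-1/2)
lost on ∇v is regained from the measure ε ln N (`ErrorSetting.abs_integral_err_mul_conv_le`). The
reaction term needs only the L² bound `ErrorSetting.nrm_err_le`.

Stabilization. The regular part of the residual is O(L) and contributes N⁻¹ L N^(1/2). Its layer
part is ε⁻¹ times exponentials. These are taken in L¹, where they are O(`tau`) uniformly in ε,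
against a maximum norm bound for b·∇v from an inverse estimate, which costs N². The result N⁻¹ N²
`tau` = N^(-3/2) is where the mesh parameter ρ = 5/2 is just enough
(`ErrorSetting.stabilization_le`).

Coercivity for small C* (`coercive_of_le`) holds because the Laplacian of a piecewise linear
function vanishes on each triangle, so that Young's inequality and the bound for c - ½∇·b suffice.
Estimates in y are those in x for the problem with interchanged variables. Sums over triangles are
treated as integrals of functions defined almost everywhere on the square. -/

theorem uniqueDiffOn_OmegaBar : UniqueDiffOn ℝ OmegaBar :=
  (uniqueDiffOn_Icc one_pos).prod (uniqueDiffOn_Icc one_pos)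

theorem isCompact_OmegaBar : IsCompact OmegaBar := isCompact_Icc.prod isCompact_Icc

theorem isOpen_Omega : IsOpen Omega := isOpen_Ioo.prod isOpen_Ioo

theorem Omega_subset_OmegaBar : Omega ⊆ OmegaBar := prod_mono Ioo_subset_Icc_self Ioo_subset_Icc_self

theorem interior_OmegaBar : interior OmegaBar = Omega := by
  rw [OmegaBar, interior_prod_eq, interior_Icc]; rfl

theorem closure_Omega : closure Omega = OmegaBar := by
  rw [Omega, closure_prod_eq, closure_Ioo zero_ne_one]; rfl

theorem hasDerivWithinAt_fst_aux {f : ℝ × ℝ → ℝ} (hf : ContDiffOn ℝ 1 f OmegaBar) {p : ℝ × ℝ}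
    (hp : p ∈ OmegaBar) : HasDerivWithinAt (fun t => f (t, p.2))
      (fderivWithin ℝ f OmegaBar p (1, 0)) (Icc 0 1) p.1 := by
  have h1 := (hf.differentiableOn one_ne_zero p hp).hasFDerivWithinAt
  have h2 : HasDerivWithinAt (fun t : ℝ => (t, p.2)) ((1 : ℝ), (0 : ℝ)) (Icc 0 1) p.1 :=
    (hasDerivWithinAt_id _ _).prodMk (hasDerivWithinAt_const _ _ _)
  exact h1.comp_hasDerivWithinAt p.1 h2 (fun t ht => (⟨ht, hp.2⟩ : (t, p.2) ∈ OmegaBar))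

theorem hasDerivWithinAt_snd_aux {f : ℝ × ℝ → ℝ} (hf : ContDiffOn ℝ 1 f OmegaBar) {p : ℝ × ℝ}
    (hp : p ∈ OmegaBar) : HasDerivWithinAt (fun t => f (p.1, t))
      (fderivWithin ℝ f OmegaBar p (0, 1)) (Icc 0 1) p.2 := by
  have h1 := (hf.differentiableOn one_ne_zero p hp).hasFDerivWithinAt
  have h2 : HasDerivWithinAt (fun t : ℝ => (p.1, t)) ((0 : ℝ), (1 : ℝ)) (Icc 0 1) p.2 :=
    (hasDerivWithinAt_const _ _ _).prodMk (hasDerivWithinAt_id _ _)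
  exact h1.comp_hasDerivWithinAt p.2 h2 (fun t ht => (⟨hp.1, ht⟩ : (p.1, t) ∈ OmegaBar))

/-- Identifies the slicewise one-sided derivative with a component of the Fréchet derivative within
the square. Regularity and symmetry of second derivatives, up to the boundary, are then inherited
from `fderivWithin`. -/
theorem pdx_eq_fderivWithin {f : ℝ × ℝ → ℝ} (hf : ContDiffOn ℝ 1 f OmegaBar) {p : ℝ × ℝ}
    (hp : p ∈ OmegaBar) : pdx f p = fderivWithin ℝ f OmegaBar p (1, 0) :=
  (hasDerivWithinAt_fst_aux hf hp).derivWithin (uniqueDiffOn_Icc one_pos _ hp.1)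

theorem pdy_eq_fderivWithin {f : ℝ × ℝ → ℝ} (hf : ContDiffOn ℝ 1 f OmegaBar) {p : ℝ × ℝ}
    (hp : p ∈ OmegaBar) : pdy f p = fderivWithin ℝ f OmegaBar p (0, 1) :=
  (hasDerivWithinAt_snd_aux hf hp).derivWithin (uniqueDiffOn_Icc one_pos _ hp.2)

theorem hasDerivWithinAt_pdx {f : ℝ × ℝ → ℝ} (hf : ContDiffOn ℝ 1 f OmegaBar) {x y : ℝ}
    (hx : x ∈ Icc (0 : ℝ) 1) (hy : y ∈ Icc (0 : ℝ) 1) :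
    HasDerivWithinAt (fun t => f (t, y)) (pdx f (x, y)) (Icc 0 1) x := by
  have hp : ((x, y) : ℝ × ℝ) ∈ OmegaBar := ⟨hx, hy⟩
  rw [pdx_eq_fderivWithin hf hp]
  exact hasDerivWithinAt_fst_aux hf hp

theorem hasDerivAt_pdx {f : ℝ × ℝ → ℝ} (hf : ContDiffOn ℝ 1 f OmegaBar) {x y : ℝ}
    (hx : x ∈ Ioo (0 : ℝ) 1) (hy : y ∈ Icc (0 : ℝ) 1) :
    HasDerivAt (fun t => f (t, y)) (pdx f (x, y)) x :=
  (hasDerivWithinAt_pdx hf (Ioo_subset_Icc_self hx) hy).hasDerivAt (Icc_mem_nhds hx.1 hx.2)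

theorem contDiffOn_pdx {f : ℝ × ℝ → ℝ} {m n : WithTop ℕ∞} (hf : ContDiffOn ℝ n f OmegaBar)
    (hmn : m + 1 ≤ n) : ContDiffOn ℝ m (pdx f) OmegaBar := by
  have h1 : ContDiffOn ℝ 1 f OmegaBar := hf.of_le (le_trans (by simp) hmn)
  exact ((hf.fderivWithin uniqueDiffOn_OmegaBar hmn).clm_apply
    (contDiffOn_const (c := ((1 : ℝ), (0 : ℝ))))).congr (fun p hp => pdx_eq_fderivWithin h1 hp)

theorem contDiffOn_pdy {f : ℝ × ℝ → ℝ} {m n : WithTop ℕ∞} (hf : ContDiffOn ℝ n f OmegaBar)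
    (hmn : m + 1 ≤ n) : ContDiffOn ℝ m (pdy f) OmegaBar := by
  have h1 : ContDiffOn ℝ 1 f OmegaBar := hf.of_le (le_trans (by simp) hmn)
  exact ((hf.fderivWithin uniqueDiffOn_OmegaBar hmn).clm_apply
    (contDiffOn_const (c := ((0 : ℝ), (1 : ℝ))))).congr (fun p hp => pdy_eq_fderivWithin h1 hp)

theorem continuousOn_pdx {f : ℝ × ℝ → ℝ} (hf : ContDiffOn ℝ 1 f OmegaBar) :
    ContinuousOn (pdx f) OmegaBar := (contDiffOn_pdx (m := 0) hf (by simp)).continuousOn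

theorem continuousOn_pdy {f : ℝ × ℝ → ℝ} (hf : ContDiffOn ℝ 1 f OmegaBar) :
    ContinuousOn (pdy f) OmegaBar := (contDiffOn_pdy (m := 0) hf (by simp)).continuousOn

theorem pdx_congr {f g : ℝ × ℝ → ℝ} (h : EqOn f g OmegaBar) : EqOn (pdx f) (pdx g) OmegaBar := by
  intro p hp
  exact derivWithin_congr (fun t ht => h ⟨ht, hp.2⟩) (h hp)

theorem pdy_congr {f g : ℝ × ℝ → ℝ} (h : EqOn f g OmegaBar) : EqOn (pdy f) (pdy g) OmegaBar := by
  intro p hp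
  exact derivWithin_congr (fun t ht => h ⟨hp.1, ht⟩) (h hp)

theorem pdx_add {f g : ℝ × ℝ → ℝ} (hf : ContDiffOn ℝ 1 f OmegaBar)
    (hg : ContDiffOn ℝ 1 g OmegaBar) :
    EqOn (pdx (f + g)) (pdx f + pdx g) OmegaBar := fun _ hp =>
  ((hasDerivWithinAt_pdx hf hp.1 hp.2).add (hasDerivWithinAt_pdx hg hp.1 hp.2)).derivWithin
    (uniqueDiffOn_Icc one_pos _ hp.1)

/-- Mixed second derivatives commute on the closed square. -/
theorem pdx_pdy_comm {f : ℝ × ℝ → ℝ} (hf : ContDiffOn ℝ 2 f OmegaBar) :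
    EqOn (pdx (pdy f)) (pdy (pdx f)) OmegaBar := by
  intro p hp
  have h1 : ContDiffOn ℝ 1 f OmegaBar := hf.of_le (by norm_num)
  have hD : ContDiffOn ℝ 1 (fderivWithin ℝ f OmegaBar) OmegaBar :=
    hf.fderivWithin uniqueDiffOn_OmegaBar (by norm_num)
  have hd := hD.differentiableOn one_ne_zero p hp
  have key : ∀ v : ℝ × ℝ, fderivWithin ℝ (fun q => fderivWithin ℝ f OmegaBar q v) OmegaBar p =
      (fderivWithin ℝ (fderivWithin ℝ f OmegaBar) OmegaBar p).flip v := by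
    intro v
    rw [fderivWithin_clm_apply (uniqueDiffOn_OmegaBar p hp) hd (differentiableWithinAt_const v)]
    simp
  rw [pdx_congr (fun q hq => pdy_eq_fderivWithin h1 hq) hp,
    pdy_congr (fun q hq => pdx_eq_fderivWithin h1 hq) hp,
    pdx_eq_fderivWithin (hD.clm_apply contDiffOn_const) hp,
    pdy_eq_fderivWithin (hD.clm_apply contDiffOn_const) hp, key, key]
  -- Symmetry at a boundary point requires the point to be in the closure of the interior of the
  -- set; for the square this is every point.
  have hs := (hf p hp).isSymmSndFDerivWithinAt (by simp) uniqueDiffOn_OmegaBar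
    (by rw [interior_OmegaBar, closure_Omega]; exact hp) hp
  exact hs.eq _ _

theorem swap_mem_OmegaBar {p : ℝ × ℝ} : p.swap ∈ OmegaBar ↔ p ∈ OmegaBar := and_comm

/-- The functions `pdx (f ∘ Prod.swap)` and `pdy f ∘ Prod.swap` agree by definition, so composition
with `Prod.swap` converts statements in x into statements in y. -/
theorem contDiffOn_swap {f : ℝ × ℝ → ℝ} {n : WithTop ℕ∞} (hf : ContDiffOn ℝ n f OmegaBar) :
    ContDiffOn ℝ n (f ∘ Prod.swap) OmegaBar :=
  hf.comp (contDiff_snd.prodMk contDiff_fst).contDiffOn fun _ hp => swap_mem_OmegaBar.2 hp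

/-- Mean value inequality for `w - α x`. With `α = 0` it is a Lipschitz bound; with `α` a slope or a
derivative at a reference point it compares increments with a linear function. -/
theorem increment_fst {w : ℝ × ℝ → ℝ} (hw : ContDiffOn ℝ 1 w OmegaBar) {x₀ x₁ y α M : ℝ}
    (h₀ : x₀ ∈ Icc (0 : ℝ) 1) (h₁ : x₁ ∈ Icc (0 : ℝ) 1) (hy : y ∈ Icc (0 : ℝ) 1)
    (hM : ∀ t ∈ uIcc x₀ x₁, |pdx w (t, y) - α| ≤ M) :
    |w (x₁, y) - w (x₀, y) - α * (x₁ - x₀)| ≤ M * |x₁ - x₀| := by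
  have hsub : uIcc x₀ x₁ ⊆ Icc (0 : ℝ) 1 := uIcc_subset_Icc h₀ h₁
  have := Convex.norm_image_sub_le_of_norm_hasDerivWithin_le (f := fun t => w (t, y) - α * t)
    (f' := fun t => pdx w (t, y) - α * 1) (s := uIcc x₀ x₁) (x := x₀) (y := x₁) (C := M)
    (fun t ht => ((hasDerivWithinAt_pdx hw (hsub ht) hy).mono hsub).sub
      ((hasDerivWithinAt_id t _).const_mul α)) (fun t ht => by simpa using hM t ht)
    (convex_uIcc _ _) left_mem_uIcc right_mem_uIcc
  rw [Real.norm_eq_abs, Real.norm_eq_abs] at this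
  convert this using 2
  ring

theorem increment_snd {w : ℝ × ℝ → ℝ} (hw : ContDiffOn ℝ 1 w OmegaBar) {y₀ y₁ x α M : ℝ}
    (h₀ : y₀ ∈ Icc (0 : ℝ) 1) (h₁ : y₁ ∈ Icc (0 : ℝ) 1) (hx : x ∈ Icc (0 : ℝ) 1)
    (hM : ∀ t ∈ uIcc y₀ y₁, |pdy w (x, t) - α| ≤ M) :
    |w (x, y₁) - w (x, y₀) - α * (y₁ - y₀)| ≤ M * |y₁ - y₀| :=
  increment_fst (contDiffOn_swap hw) h₀ h₁ hx hM

/-- First order increment bound along a path parallel to the axes. -/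
theorem increment_le {w : ℝ × ℝ → ℝ} (hw : ContDiffOn ℝ 1 w OmegaBar) {p q : ℝ × ℝ} {α β M₁ M₂ : ℝ}
    (hp : p ∈ OmegaBar) (hq : q ∈ OmegaBar)
    (h₁ : ∀ r ∈ uIcc p.1 q.1 ×ˢ uIcc p.2 q.2, |pdx w r - α| ≤ M₁)
    (h₂ : ∀ r ∈ uIcc p.1 q.1 ×ˢ uIcc p.2 q.2, |pdy w r - β| ≤ M₂) :
    |w q - w p - α * (q.1 - p.1) - β * (q.2 - p.2)| ≤ M₁ * |q.1 - p.1| + M₂ * |q.2 - p.2| := by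
  have e1 := increment_fst hw hp.1 hq.1 hp.2 fun t ht => h₁ (t, p.2) ⟨ht, left_mem_uIcc⟩
  have e2 := increment_snd hw hp.2 hq.2 hq.1 fun t ht => h₂ (q.1, t) ⟨right_mem_uIcc, ht⟩
  refine le_trans ?_ (add_le_add e1 e2)
  refine le_trans (le_of_eq ?_) (abs_add_le _ _)
  congr 1
  ring

end SDFEM

/-! ### Affine interpolation on a right-angled triangle, and the midpoint symmetry of edges -/

namespace SDFEM

/-- The open right-angled triangle with corner `(x₀, y₀)` and signed legs `h`, `k`. -/
def openTri (x₀ y₀ h k : ℝ) : Set (ℝ × ℝ) :=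
  {p | 0 < (p.1 - x₀) / h ∧ 0 < (p.2 - y₀) / k ∧ (p.1 - x₀) / h + (p.2 - y₀) / k < 1}

theorem isOpen_openTri (x₀ y₀ h k : ℝ) : IsOpen (openTri x₀ y₀ h k) := by
  have h1 : Continuous fun p : ℝ × ℝ => (p.1 - x₀) / h := by fun_prop
  have h2 : Continuous fun p : ℝ × ℝ => (p.2 - y₀) / k := by fun_prop
  exact (isOpen_lt continuous_const h1).inter
    ((isOpen_lt continuous_const h2).inter (isOpen_lt (h1.add h2) continuous_const))

theorem mem_uIcc_of_div_mem {x x₀ h : ℝ} (hh : h ≠ 0) (h0 : 0 ≤ (x - x₀) / h)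
    (h1 : (x - x₀) / h ≤ 1) : x ∈ uIcc x₀ (x₀ + h) := by
  rcases lt_or_gt_of_ne hh with hneg | hpos
  · rw [div_le_one_of_neg hneg] at h1
    have := (div_nonneg_iff.1 h0)
    rw [mem_uIcc]
    right
    rcases this with h | h <;> constructor <;> linarith
  · rw [div_le_one hpos] at h1
    have := (div_nonneg_iff.1 h0)
    rw [mem_uIcc]
    left
    rcases this with h | h <;> constructor <;> linarith

theorem openTri_subset_rect {x₀ y₀ h k : ℝ} (hh : h ≠ 0) (hk : k ≠ 0) {p : ℝ × ℝ}
    (hp : p ∈ openTri x₀ y₀ h k) : p.1 ∈ uIcc x₀ (x₀ + h) ∧ p.2 ∈ uIcc y₀ (y₀ + k) := by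
  obtain ⟨h1, h2, h3⟩ := hp
  exact ⟨mem_uIcc_of_div_mem hh h1.le (by linarith), mem_uIcc_of_div_mem hk h2.le (by linarith)⟩

/-- The affine function with the values of `w` at the vertices of the triangle. -/
noncomputable def affInterp (w : ℝ × ℝ → ℝ) (x₀ y₀ h k : ℝ) (p : ℝ × ℝ) : ℝ :=
  w (x₀, y₀) + (w (x₀ + h, y₀) - w (x₀, y₀)) / h * (p.1 - x₀)
    + (w (x₀, y₀ + k) - w (x₀, y₀)) / k * (p.2 - y₀)

/-- On the triangle the interpolant is a convex combination of the vertex values, with weights `1 -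
s - t`, `s`, `t`. -/
theorem abs_affInterp_le {w : ℝ × ℝ → ℝ} {x₀ y₀ h k M : ℝ} (h1 : |w (x₀, y₀)| ≤ M)
    (h2 : |w (x₀ + h, y₀)| ≤ M) (h3 : |w (x₀, y₀ + k)| ≤ M) {p : ℝ × ℝ}
    (hp : p ∈ openTri x₀ y₀ h k) : |affInterp w x₀ y₀ h k p| ≤ M := by
  obtain ⟨q1, q2, q3⟩ := hp
  set s := (p.1 - x₀) / h
  set t := (p.2 - y₀) / k
  have : affInterp w x₀ y₀ h k p = (1 - s - t) * w (x₀, y₀) + s * w (x₀ + h, y₀)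
      + t * w (x₀, y₀ + k) := by
    simp only [affInterp, s, t]; ring
  rw [this]
  refine (abs_add_three _ _ _).trans ?_
  rw [abs_mul, abs_mul, abs_mul, abs_of_pos q1, abs_of_pos q2, abs_of_pos (by linarith : 0 < 1 - s - t)]
  nlinarith

theorem abs_sub_le_of_mem_uIcc {a c x y : ℝ} (hx : x ∈ uIcc a (a + c)) (hy : y ∈ uIcc a (a + c)) :
    |x - y| ≤ |c| := by
  have := abs_sub_le_of_uIcc_subset_uIcc (uIcc_subset_uIcc hy hx)
  simpa using this

/-- A difference quotient is an average of `pdx w` along the leg, so it inherits every bound for the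
distance of `pdx w` from a constant. -/
theorem slope_fst_le {w : ℝ × ℝ → ℝ} (hw : ContDiffOn ℝ 1 w OmegaBar) {x₀ y₀ h M α : ℝ} (hh : h ≠ 0)
    (hx : x₀ ∈ Icc (0 : ℝ) 1) (hx' : x₀ + h ∈ Icc (0 : ℝ) 1) (hy : y₀ ∈ Icc (0 : ℝ) 1)
    (hM : ∀ x ∈ uIcc x₀ (x₀ + h), |pdx w (x, y₀) - α| ≤ M) :
    |(w (x₀ + h, y₀) - w (x₀, y₀)) / h - α| ≤ M := by
  have := increment_fst hw hx hx' hy hM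
  rw [add_sub_cancel_left] at this
  rw [div_sub' hh, abs_div, div_le_iff₀ (abs_pos.2 hh)]
  rwa [mul_comm h α]

/-- Error of the gradient of the affine interpolant, first component. -/
theorem grad_fst_err {w : ℝ × ℝ → ℝ} (hw : ContDiffOn ℝ 2 w OmegaBar) {x₀ y₀ h k M₁ M₂ : ℝ}
    (hh : h ≠ 0) (hx : x₀ ∈ Icc (0 : ℝ) 1) (hx' : x₀ + h ∈ Icc (0 : ℝ) 1)
    (hy : y₀ ∈ Icc (0 : ℝ) 1) (hy' : y₀ + k ∈ Icc (0 : ℝ) 1)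
    (hM₁ : ∀ x ∈ uIcc x₀ (x₀ + h), ∀ y ∈ uIcc y₀ (y₀ + k), |pdx (pdx w) (x, y)| ≤ M₁)
    (hM₂ : ∀ x ∈ uIcc x₀ (x₀ + h), ∀ y ∈ uIcc y₀ (y₀ + k), |pdx (pdy w) (x, y)| ≤ M₂)
    {x y : ℝ} (px : x ∈ uIcc x₀ (x₀ + h)) (py : y ∈ uIcc y₀ (y₀ + k)) :
    |(w (x₀ + h, y₀) - w (x₀, y₀)) / h - pdx w (x, y)| ≤ M₁ * |h| + M₂ * |k| := by
  have hw1 : ContDiffOn ℝ 1 (pdx w) OmegaBar := contDiffOn_pdx hw (by norm_num)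
  have sx : uIcc x₀ (x₀ + h) ⊆ Icc (0 : ℝ) 1 := uIcc_subset_Icc hx hx'
  have sy : uIcc y₀ (y₀ + k) ⊆ Icc (0 : ℝ) 1 := uIcc_subset_Icc hy hy'
  refine slope_fst_le (hw.of_le (by norm_num)) hh hx hx' hy fun t ht => ?_
  have hM₁0 : 0 ≤ M₁ := (abs_nonneg _).trans (hM₁ x px y py)
  have hM₂0 : 0 ≤ M₂ := (abs_nonneg _).trans (hM₂ x px y py)
  have := increment_le hw1 (p := (x, y)) (q := (t, y₀)) (α := 0) (β := 0) (M₁ := M₁) (M₂ := M₂)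
    ⟨sx px, sy py⟩ ⟨sx ht, hy⟩
    (fun r hr => by
      rw [sub_zero]
      exact hM₁ _ (uIcc_subset_uIcc px ht hr.1) _ (uIcc_subset_uIcc py left_mem_uIcc hr.2))
    (fun r hr => by
      have h1 := uIcc_subset_uIcc px ht hr.1
      have h2 := uIcc_subset_uIcc py left_mem_uIcc hr.2
      rw [sub_zero, ← pdx_pdy_comm hw ⟨sx h1, sy h2⟩]
      exact hM₂ _ h1 _ h2)
  simp only [zero_mul, sub_zero] at this
  refine this.trans (add_le_add (mul_le_mul_of_nonneg_left ?_ hM₁0)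
    (mul_le_mul_of_nonneg_left ?_ hM₂0))
  · exact abs_sub_le_of_mem_uIcc ht px
  · exact abs_sub_le_of_mem_uIcc left_mem_uIcc py

theorem grad_snd_err {w : ℝ × ℝ → ℝ} (hw : ContDiffOn ℝ 2 w OmegaBar) {x₀ y₀ h k M₁ M₂ : ℝ}
    (hk : k ≠ 0) (hx : x₀ ∈ Icc (0 : ℝ) 1) (hx' : x₀ + h ∈ Icc (0 : ℝ) 1)
    (hy : y₀ ∈ Icc (0 : ℝ) 1) (hy' : y₀ + k ∈ Icc (0 : ℝ) 1)
    (hM₁ : ∀ x ∈ uIcc x₀ (x₀ + h), ∀ y ∈ uIcc y₀ (y₀ + k), |pdx (pdy w) (x, y)| ≤ M₁)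
    (hM₂ : ∀ x ∈ uIcc x₀ (x₀ + h), ∀ y ∈ uIcc y₀ (y₀ + k), |pdy (pdy w) (x, y)| ≤ M₂)
    {x y : ℝ} (px : x ∈ uIcc x₀ (x₀ + h)) (py : y ∈ uIcc y₀ (y₀ + k)) :
    |(w (x₀, y₀ + k) - w (x₀, y₀)) / k - pdy w (x, y)| ≤ M₁ * |h| + M₂ * |k| := by
  have sx : uIcc x₀ (x₀ + h) ⊆ Icc (0 : ℝ) 1 := uIcc_subset_Icc hx hx'
  have sy : uIcc y₀ (y₀ + k) ⊆ Icc (0 : ℝ) 1 := uIcc_subset_Icc hy hy'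
  rw [add_comm (M₁ * |h|)]
  refine grad_fst_err (contDiffOn_swap hw) hk hy hy' hx hx' (fun t ht s hs => hM₂ s hs t ht)
    (fun t ht s hs => ?_) py px
  have := hM₁ s hs t ht
  rwa [pdx_pdy_comm hw ⟨sx hs, sy ht⟩] at this

/-- Error of the affine interpolant. -/
theorem interp_err {w : ℝ × ℝ → ℝ} (hw : ContDiffOn ℝ 2 w OmegaBar) {x₀ y₀ h k M₁ M₂ M₃ : ℝ}
    (hh : h ≠ 0) (hk : k ≠ 0) (hx : x₀ ∈ Icc (0 : ℝ) 1) (hx' : x₀ + h ∈ Icc (0 : ℝ) 1)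
    (hy : y₀ ∈ Icc (0 : ℝ) 1) (hy' : y₀ + k ∈ Icc (0 : ℝ) 1)
    (hM₁ : ∀ x ∈ uIcc x₀ (x₀ + h), ∀ y ∈ uIcc y₀ (y₀ + k), |pdx (pdx w) (x, y)| ≤ M₁)
    (hM₂ : ∀ x ∈ uIcc x₀ (x₀ + h), ∀ y ∈ uIcc y₀ (y₀ + k), |pdx (pdy w) (x, y)| ≤ M₂)
    (hM₃ : ∀ x ∈ uIcc x₀ (x₀ + h), ∀ y ∈ uIcc y₀ (y₀ + k), |pdy (pdy w) (x, y)| ≤ M₃)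
    {p : ℝ × ℝ} (hp : p ∈ openTri x₀ y₀ h k) :
    |affInterp w x₀ y₀ h k p - w p| ≤
      (M₁ * |h| + M₂ * |k|) * |h| + (M₂ * |h| + M₃ * |k|) * |k| := by
  obtain ⟨px, py⟩ := openTri_subset_rect hh hk hp
  have sx : uIcc x₀ (x₀ + h) ⊆ Icc (0 : ℝ) 1 := uIcc_subset_Icc hx hx'
  have sy : uIcc y₀ (y₀ + k) ⊆ Icc (0 : ℝ) 1 := uIcc_subset_Icc hy hy'
  have hM₁0 : 0 ≤ M₁ := (abs_nonneg _).trans (hM₁ _ px _ py)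
  have hM₂0 : 0 ≤ M₂ := (abs_nonneg _).trans (hM₂ _ px _ py)
  have hM₃0 : 0 ≤ M₃ := (abs_nonneg _).trans (hM₃ _ px _ py)
  -- The interpolant agrees with `w` at the corner. The error is thus the deviation of the increment
  -- of `w` from the linear function with the interpolant's slopes, and the gradient errors control
  -- it.
  have := increment_le (hw.of_le (by norm_num)) (p := (x₀, y₀)) (q := p)
    (α := (w (x₀ + h, y₀) - w (x₀, y₀)) / h) (β := (w (x₀, y₀ + k) - w (x₀, y₀)) / k)
    (M₁ := M₁ * |h| + M₂ * |k|) (M₂ := M₂ * |h| + M₃ * |k|)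
    ⟨hx, hy⟩ ⟨sx px, sy py⟩
    (fun r hr => by
      rw [abs_sub_comm]
      exact grad_fst_err hw hh hx hx' hy hy' hM₁ hM₂ (uIcc_subset_uIcc left_mem_uIcc px hr.1)
        (uIcc_subset_uIcc left_mem_uIcc py hr.2))
    (fun r hr => by
      rw [abs_sub_comm]
      exact grad_snd_err hw hk hx hx' hy hy' hM₂ hM₃ (uIcc_subset_uIcc left_mem_uIcc px hr.1)
        (uIcc_subset_uIcc left_mem_uIcc py hr.2))
  rw [abs_sub_comm]
  refine le_trans (le_of_eq (by congr 1; simp only [affInterp]; ring)) (this.trans ?_)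
  exact add_le_add
    (mul_le_mul_of_nonneg_left (abs_sub_le_of_mem_uIcc px left_mem_uIcc) (by positivity))
    (mul_le_mul_of_nonneg_left (abs_sub_le_of_mem_uIcc py left_mem_uIcc) (by positivity))

/-- The increment bound is used twice, for `g` against its gradient at `m` and for the components of
that gradient. The usual factor ½ of the remainder is given away. -/
theorem taylor_one {g : ℝ × ℝ → ℝ} (hg : ContDiffOn ℝ 2 g OmegaBar) {m q : ℝ × ℝ} {M₁ M₂ M₃ : ℝ}
    (hm : m ∈ OmegaBar) (hq : q ∈ OmegaBar)
    (hM₁ : ∀ x ∈ uIcc m.1 q.1, ∀ y ∈ uIcc m.2 q.2, |pdx (pdx g) (x, y)| ≤ M₁)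
    (hM₂ : ∀ x ∈ uIcc m.1 q.1, ∀ y ∈ uIcc m.2 q.2, |pdy (pdx g) (x, y)| ≤ M₂)
    (hM₃ : ∀ x ∈ uIcc m.1 q.1, ∀ y ∈ uIcc m.2 q.2, |pdy (pdy g) (x, y)| ≤ M₃) :
    |g q - g m - pdx g m * (q.1 - m.1) - pdy g m * (q.2 - m.2)| ≤
      (M₁ * |q.1 - m.1| + M₂ * |q.2 - m.2|) * |q.1 - m.1|
        + (M₂ * |q.1 - m.1| + M₃ * |q.2 - m.2|) * |q.2 - m.2| := by
  have sx : uIcc m.1 q.1 ⊆ Icc (0 : ℝ) 1 := uIcc_subset_Icc hm.1 hq.1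
  have sy : uIcc m.2 q.2 ⊆ Icc (0 : ℝ) 1 := uIcc_subset_Icc hm.2 hq.2
  have hM₁0 : 0 ≤ M₁ := (abs_nonneg _).trans (hM₁ _ left_mem_uIcc _ left_mem_uIcc)
  have hM₂0 : 0 ≤ M₂ := (abs_nonneg _).trans (hM₂ _ left_mem_uIcc _ left_mem_uIcc)
  have hM₃0 : 0 ≤ M₃ := (abs_nonneg _).trans (hM₃ _ left_mem_uIcc _ left_mem_uIcc)
  have hl : ∀ {a b t : ℝ}, t ∈ uIcc a b → |t - a| ≤ |b - a| := fun ht => by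
    exact abs_sub_left_of_mem_uIcc ht
  refine increment_le (hg.of_le (by norm_num)) hm hq (fun r hr => ?_) (fun r hr => ?_)
  · have := increment_le (contDiffOn_pdx hg (by norm_num)) (p := m) (q := r) (α := 0) (β := 0)
      (M₁ := M₁) (M₂ := M₂) hm ⟨sx hr.1, sy hr.2⟩
      (fun s hs => by
        rw [sub_zero]
        exact hM₁ _ (uIcc_subset_uIcc left_mem_uIcc hr.1 hs.1) _
          (uIcc_subset_uIcc left_mem_uIcc hr.2 hs.2))
      (fun s hs => by
        rw [sub_zero]
        exact hM₂ _ (uIcc_subset_uIcc left_mem_uIcc hr.1 hs.1) _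
          (uIcc_subset_uIcc left_mem_uIcc hr.2 hs.2))
    simp only [zero_mul, sub_zero] at this
    exact this.trans (add_le_add (mul_le_mul_of_nonneg_left (hl hr.1) (by positivity))
      (mul_le_mul_of_nonneg_left (hl hr.2) (by positivity)))
  · have := increment_le (contDiffOn_pdy hg (by norm_num)) (p := m) (q := r) (α := 0) (β := 0)
      (M₁ := M₂) (M₂ := M₃) hm ⟨sx hr.1, sy hr.2⟩
      (fun s hs => by
        have h1 := uIcc_subset_uIcc left_mem_uIcc hr.1 hs.1
        have h2 := uIcc_subset_uIcc left_mem_uIcc hr.2 hs.2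
        rw [sub_zero, pdx_pdy_comm hg ⟨sx h1, sy h2⟩]
        exact hM₂ _ h1 _ h2)
      (fun s hs => by
        rw [sub_zero]
        exact hM₃ _ (uIcc_subset_uIcc left_mem_uIcc hr.1 hs.1) _
          (uIcc_subset_uIcc left_mem_uIcc hr.2 hs.2))
    simp only [zero_mul, sub_zero] at this
    exact this.trans (add_le_add (mul_le_mul_of_nonneg_left (hl hr.1) (by positivity))
      (mul_le_mul_of_nonneg_left (hl hr.2) (by positivity)))

/-- Symmetric second difference. -/
theorem second_difference {g : ℝ × ℝ → ℝ} (hg : ContDiffOn ℝ 2 g OmegaBar) {m₁ m₂ a b M₁ M₂ M₃ : ℝ}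
    (ha : Icc (m₁ - a) (m₁ + a) ⊆ Icc 0 1) (hb : Icc (m₂ - b) (m₂ + b) ⊆ Icc 0 1)
    (hM₁ : ∀ x ∈ Icc (m₁ - a) (m₁ + a), ∀ y ∈ Icc (m₂ - b) (m₂ + b), |pdx (pdx g) (x, y)| ≤ M₁)
    (hM₂ : ∀ x ∈ Icc (m₁ - a) (m₁ + a), ∀ y ∈ Icc (m₂ - b) (m₂ + b), |pdy (pdx g) (x, y)| ≤ M₂)
    (hM₃ : ∀ x ∈ Icc (m₁ - a) (m₁ + a), ∀ y ∈ Icc (m₂ - b) (m₂ + b), |pdy (pdy g) (x, y)| ≤ M₃)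
    {s t : ℝ} (hs : |s| ≤ a) (ht : |t| ≤ b) :
    |g (m₁ + s, m₂ + t) + g (m₁ - s, m₂ - t) - 2 * g (m₁, m₂)| ≤
      2 * ((M₁ * a + M₂ * b) * a + (M₂ * a + M₃ * b) * b) := by
  have ha0 : 0 ≤ a := (abs_nonneg s).trans hs
  have hb0 : 0 ≤ b := (abs_nonneg t).trans ht
  have mm1 : m₁ ∈ Icc (m₁ - a) (m₁ + a) := ⟨by linarith, by linarith⟩
  have mm2 : m₂ ∈ Icc (m₂ - b) (m₂ + b) := ⟨by linarith, by linarith⟩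
  have key : ∀ s t : ℝ, |s| ≤ a → |t| ≤ b →
      |g (m₁ + s, m₂ + t) - g (m₁, m₂) - pdx g (m₁, m₂) * s - pdy g (m₁, m₂) * t| ≤
      (M₁ * a + M₂ * b) * a + (M₂ * a + M₃ * b) * b := by
    intro s t hs ht
    have q1 : m₁ + s ∈ Icc (m₁ - a) (m₁ + a) := by
      rw [abs_le] at hs; constructor <;> linarith
    have q2 : m₂ + t ∈ Icc (m₂ - b) (m₂ + b) := by
      rw [abs_le] at ht; constructor <;> linarith
    have u1 := uIcc_subset_Icc mm1 q1
    have u2 := uIcc_subset_Icc mm2 q2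
    have hM₁0 : 0 ≤ M₁ := (abs_nonneg _).trans (hM₁ _ mm1 _ mm2)
    have hM₂0 : 0 ≤ M₂ := (abs_nonneg _).trans (hM₂ _ mm1 _ mm2)
    have hM₃0 : 0 ≤ M₃ := (abs_nonneg _).trans (hM₃ _ mm1 _ mm2)
    have := taylor_one hg (m := (m₁, m₂)) (q := (m₁ + s, m₂ + t)) (M₁ := M₁) (M₂ := M₂) (M₃ := M₃)
      ⟨ha mm1, hb mm2⟩ ⟨ha q1, hb q2⟩ (fun x hx y hy => hM₁ x (u1 hx) y (u2 hy))
      (fun x hx y hy => hM₂ x (u1 hx) y (u2 hy)) (fun x hx y hy => hM₃ x (u1 hx) y (u2 hy))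
    simp only [add_sub_cancel_left] at this
    refine this.trans ?_
    gcongr
  -- The linear Taylor terms at `(s, t)` and `(-s, -t)` cancel in the sum.
  have k1 := key s t hs ht
  have k2 := key (-s) (-t) (by rwa [abs_neg]) (by rwa [abs_neg])
  rw [← sub_eq_add_neg, ← sub_eq_add_neg] at k2
  rw [abs_le] at k1 k2 ⊢
  constructor <;> linarith

/-- The function w(m₁ + t) - w(m₁ - t) - 2t w_x(m₁) vanishes at t = 0, and its derivative is a
symmetric second difference of w_x. Hence the centred quotient is exact to second order, with only
the third x-derivative in the error. -/
theorem midpoint_slope {w : ℝ × ℝ → ℝ} (hw : ContDiffOn ℝ 3 w OmegaBar) {m₁ m₂ a M : ℝ}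
    (ha0 : 0 < a) (ha : Icc (m₁ - a) (m₁ + a) ⊆ Icc 0 1) (hm₂ : m₂ ∈ Icc (0 : ℝ) 1)
    (hM : ∀ x ∈ Icc (m₁ - a) (m₁ + a), |pdx (pdx (pdx w)) (x, m₂)| ≤ M) :
    |(w (m₁ + a, m₂) - w (m₁ - a, m₂)) / (2 * a) - pdx w (m₁, m₂)| ≤ M * a ^ 2 := by
  have hw1 : ContDiffOn ℝ 1 w OmegaBar := hw.of_le (by norm_num)
  have hg : ContDiffOn ℝ 2 (pdx w) OmegaBar := contDiffOn_pdx hw (by norm_num)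
  have hM0 : 0 ≤ M := (abs_nonneg _).trans (hM m₁ ⟨by linarith, by linarith⟩)
  have hd : ∀ t ∈ Icc (0 : ℝ) a, HasDerivWithinAt
      (fun t => w (m₁ + t, m₂) - w (m₁ - t, m₂) - 2 * pdx w (m₁, m₂) * t)
      (pdx w (m₁ + t, m₂) * 1 - pdx w (m₁ - t, m₂) * (-1) - 2 * pdx w (m₁, m₂) * 1)
      (Icc 0 a) t := by
    intro t ht
    have i1 : m₁ + t ∈ Icc (m₁ - a) (m₁ + a) := ⟨by linarith [ht.1], by linarith [ht.2]⟩
    have i2 : m₁ - t ∈ Icc (m₁ - a) (m₁ + a) := ⟨by linarith [ht.2], by linarith [ht.1]⟩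
    have d1 := hasDerivWithinAt_pdx hw1 (ha i1) hm₂
    have d2 := hasDerivWithinAt_pdx hw1 (ha i2) hm₂
    refine HasDerivWithinAt.sub (HasDerivWithinAt.sub ?_ ?_)
      ((hasDerivWithinAt_id t _).const_mul _)
    · exact d1.comp t ((hasDerivWithinAt_id t _).const_add m₁)
        (fun s hs => ha ⟨by linarith [hs.1], by linarith [hs.2]⟩)
    · exact d2.comp t ((hasDerivWithinAt_id t _).const_sub m₁)
        (fun s hs => ha ⟨by linarith [hs.2], by linarith [hs.1]⟩)
  have := Convex.norm_image_sub_le_of_norm_hasDerivWithin_le (x := 0) (y := a)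
    (C := 2 * (M * a ^ 2)) hd (fun t ht => by
      have hta : |t| ≤ a := by rw [abs_of_nonneg ht.1]; exact ht.2
      have key : ∀ s, |s| ≤ a → |pdx w (m₁ + s, m₂) - pdx w (m₁, m₂)
          - pdx (pdx w) (m₁, m₂) * s| ≤ M * a ^ 2 := by
        intro s hs
        have mm : m₁ ∈ Icc (m₁ - a) (m₁ + a) := ⟨by linarith, by linarith⟩
        have qq : m₁ + s ∈ Icc (m₁ - a) (m₁ + a) := by
          rw [abs_le] at hs; constructor <;> linarith
        have e := increment_fst (hg.of_le (by norm_num)) (α := pdx (pdx w) (m₁, m₂)) (M := M * a)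
          (ha mm) (ha qq) hm₂ (fun t ht => by
            have e2 := increment_fst (contDiffOn_pdx (m := 1) hg (by norm_num)) (α := 0) (M := M)
              (ha mm) (ha (uIcc_subset_Icc mm qq ht)) hm₂
              (fun r hr => by
                rw [sub_zero]
                exact hM _ (uIcc_subset_Icc mm (uIcc_subset_Icc mm qq ht) hr))
            rw [zero_mul, sub_zero] at e2
            refine e2.trans (mul_le_mul_of_nonneg_left ?_ hM0)
            refine (abs_sub_left_of_mem_uIcc ht).trans ?_
            rwa [add_sub_cancel_left])
        rw [add_sub_cancel_left] at e
        refine e.trans ?_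
        rw [pow_two, ← mul_assoc]
        exact mul_le_mul_of_nonneg_left hs (by positivity)
      have k1 := key t hta
      have k2 := key (-t) (by rwa [abs_neg])
      rw [← sub_eq_add_neg] at k2
      rw [Real.norm_eq_abs]
      rw [abs_le] at k1 k2 ⊢
      constructor <;> linarith) (convex_Icc _ _) ⟨le_rfl, ha0.le⟩ ⟨ha0.le, le_rfl⟩
  rw [Real.norm_eq_abs, Real.norm_eq_abs, sub_zero a, abs_of_pos ha0] at this
  rw [div_sub' (by positivity), abs_div, abs_of_pos (by positivity : 0 < 2 * a),
    div_le_iff₀ (by positivity)]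
  refine le_trans (le_of_eq ?_) (this.trans (le_of_eq ?_))
  · congr 1
    simp only [add_zero, sub_zero]
    ring
  · ring

/-- Pointwise form of the superclose estimate: the error of the tangential derivative on an edge
with midpoint `(m₁, m₂)`, averaged over two points that are symmetric about this midpoint. -/
theorem superclose_pointwise {w : ℝ × ℝ → ℝ} (hw : ContDiffOn ℝ 3 w OmegaBar)
    {m₁ m₂ a b M₁ M₂ M₃ : ℝ} (ha0 : 0 < a)
    (ha : Icc (m₁ - a) (m₁ + a) ⊆ Icc 0 1) (hb : Icc (m₂ - b) (m₂ + b) ⊆ Icc 0 1)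
    (hM₁ : ∀ x ∈ Icc (m₁ - a) (m₁ + a), ∀ y ∈ Icc (m₂ - b) (m₂ + b),
      |pdx (pdx (pdx w)) (x, y)| ≤ M₁)
    (hM₂ : ∀ x ∈ Icc (m₁ - a) (m₁ + a), ∀ y ∈ Icc (m₂ - b) (m₂ + b),
      |pdx (pdx (pdy w)) (x, y)| ≤ M₂)
    (hM₃ : ∀ x ∈ Icc (m₁ - a) (m₁ + a), ∀ y ∈ Icc (m₂ - b) (m₂ + b),
      |pdx (pdy (pdy w)) (x, y)| ≤ M₃)
    {x y : ℝ} (hx : |x - m₁| ≤ a) (hy : |y - m₂| ≤ b) :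
    |2 * ((w (m₁ + a, m₂) - w (m₁ - a, m₂)) / (2 * a)) - pdx w (x, y)
        - pdx w (2 * m₁ - x, 2 * m₂ - y)| ≤
      2 * (M₁ * a ^ 2) + 2 * ((M₁ * a + M₂ * b) * a + (M₂ * a + M₃ * b) * b) := by
  have hb0 : 0 ≤ b := (abs_nonneg _).trans hy
  have mm2 : m₂ ∈ Icc (m₂ - b) (m₂ + b) := ⟨by linarith, by linarith⟩
  have hg : ContDiffOn ℝ 2 (pdx w) OmegaBar := contDiffOn_pdx hw (by norm_num)
  have c1 : EqOn (pdx (pdy w)) (pdy (pdx w)) OmegaBar := pdx_pdy_comm (hw.of_le (by norm_num))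
  -- The value of `pdx w` at the midpoint is the intermediary: it is close to the slope of the edge,
  -- and to the average over two symmetric points, both to second order.
  have k1 := midpoint_slope hw ha0 ha (hb mm2) (fun x hx => hM₁ x hx m₂ mm2)
  -- The layer bounds list derivatives as `pdx^[i] (pdy^[j] ·)`; here they are commuted into second
  -- derivatives of `pdx w`.
  have k2 := second_difference hg ha hb hM₁ (M₂ := M₂) (M₃ := M₃)
    (fun x hx y hy => by
      have hp : ((x, y) : ℝ × ℝ) ∈ OmegaBar := ⟨ha hx, hb hy⟩
      have := hM₂ x hx y hy
      rwa [pdx_congr c1 hp, pdx_pdy_comm hg hp] at this)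
    (fun x hx y hy => by
      have hp : ((x, y) : ℝ × ℝ) ∈ OmegaBar := ⟨ha hx, hb hy⟩
      have := hM₃ x hx y hy
      rwa [pdx_pdy_comm (contDiffOn_pdy hw (by norm_num)) hp, pdy_congr c1 hp] at this)
    hx hy
  rw [show m₁ + (x - m₁) = x by ring, show m₂ + (y - m₂) = y by ring,
    show m₁ - (x - m₁) = 2 * m₁ - x by ring, show m₂ - (y - m₂) = 2 * m₂ - y by ring] at k2
  rw [abs_le] at k1 k2 ⊢
  constructor <;> linarith

end SDFEM

/-! ### One-dimensional grids and the geometry of the triangulation -/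

namespace SDFEM

/-- A one-dimensional mesh `0 = X 0 < X 1 < ⋯ < X N = 1` of the unit interval. -/
structure IsGrid (N : ℕ) (X : ℕ → ℝ) : Prop where
  zero : X 0 = 0
  last : X N = 1
  lt : ∀ i < N, X i < X (i + 1)

namespace IsGrid

variable {N : ℕ} {X : ℕ → ℝ}

theorem le (hX : IsGrid N X) {i j : ℕ} (hij : i ≤ j) (hj : j ≤ N) : X i ≤ X j := by
  induction j, hij using Nat.le_induction with
  | base => exact le_rfl
  | succ n _ ih => exact (ih (by omega)).trans (hX.lt n (by omega)).le

theorem mem (hX : IsGrid N X) {i : ℕ} (hi : i ≤ N) : X i ∈ Icc (0 : ℝ) 1 :=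
  ⟨hX.zero ▸ hX.le (Nat.zero_le i) hi, hX.last ▸ hX.le hi le_rfl⟩

theorem pos (hX : IsGrid N X) : 0 < N := by
  rcases Nat.eq_zero_or_pos N with h | h
  · have h1 := hX.zero
    have h2 := hX.last
    rw [h] at h2
    linarith
  · exact h

theorem exists_cell (hX : IsGrid N X) {x : ℝ} (hx : x ∈ Icc (0 : ℝ) 1) :
    ∃ i < N, X i ≤ x ∧ x ≤ X (i + 1) := by
  have key : ∀ n ≤ N, X n ≤ x ∨ ∃ i < n, X i ≤ x ∧ x ≤ X (i + 1) := by
    intro n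
    induction n with
    | zero => exact fun _ => Or.inl (hX.zero ▸ hx.1)
    | succ n ih =>
      intro hn
      rcases ih (by omega) with h | ⟨i, hi, h⟩
      · rcases le_total (X (n + 1)) x with h' | h'
        · exact Or.inl h'
        · exact Or.inr ⟨n, by omega, h, h'⟩
      · exact Or.inr ⟨i, by omega, h⟩
  rcases key N le_rfl with h | h
  · obtain ⟨m, rfl⟩ := Nat.exists_eq_succ_of_ne_zero hX.pos.ne'
    refine ⟨m, by omega, (hX.lt m (by omega)).le.trans h, ?_⟩
    rw [hX.last]; exact hx.2
  · exact h

theorem index_unique (hX : IsGrid N X) {i j : ℕ} (hi : i < N) (hj : j < N) {x : ℝ}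
    (h1 : X i ≤ x) (h2 : x ≤ X (i + 1)) (h3 : X j < x) (h4 : x < X (j + 1)) : i = j := by
  rcases lt_trichotomy i j with h | h | h
  · have := hX.le (show i + 1 ≤ j by omega) hj.le
    linarith
  · exact h
  · have := hX.le (show j + 1 ≤ i by omega) hi.le
    linarith

end IsGrid

/-- The coordinate of the right-angled corner of a mesh triangle. -/
def corner (X : ℕ → ℝ) (i : ℕ) (b : Bool) : ℝ := cond b (X (i + 1)) (X i)

/-- The signed length of a leg of a mesh triangle. -/
noncomputable def leg (X : ℕ → ℝ) (i : ℕ) (b : Bool) : ℝ :=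
  cond b (X i - X (i + 1)) (X (i + 1) - X i)

theorem leg_ne_zero {N : ℕ} {X : ℕ → ℝ} (hX : IsGrid N X) {i : ℕ} (hi : i < N) (b : Bool) :
    leg X i b ≠ 0 := by
  have := hX.lt i hi
  cases b <;> simp only [leg, cond] <;> intro h <;> linarith

theorem abs_leg {N : ℕ} {X : ℕ → ℝ} (hX : IsGrid N X) {i : ℕ} (hi : i < N) (b : Bool) :
    |leg X i b| = X (i + 1) - X i := by
  have := hX.lt i hi
  cases b <;> simp only [leg, cond]
  · exact abs_of_pos (by linarith)
  · rw [abs_of_neg (by linarith)]; ring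

theorem corner_mem {N : ℕ} {X : ℕ → ℝ} (hX : IsGrid N X) {i : ℕ} (hi : i < N) (b : Bool) :
    corner X i b ∈ Icc (0 : ℝ) 1 := by
  cases b
  · exact hX.mem hi.le
  · exact hX.mem hi

theorem corner_add_leg_mem {N : ℕ} {X : ℕ → ℝ} (hX : IsGrid N X) {i : ℕ} (hi : i < N) (b : Bool) :
    corner X i b + leg X i b ∈ Icc (0 : ℝ) 1 := by
  cases b <;> simp only [corner, leg, cond, add_sub_cancel]
  · exact hX.mem hi
  · exact hX.mem hi.le

theorem uIcc_corner {N : ℕ} {X : ℕ → ℝ} (hX : IsGrid N X) {i : ℕ} (hi : i < N) (b : Bool) :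
    uIcc (corner X i b) (corner X i b + leg X i b) = Icc (X i) (X (i + 1)) := by
  have := hX.lt i hi
  cases b <;> simp only [corner, leg, cond, add_sub_cancel]
  · exact uIcc_of_le this.le
  · exact uIcc_of_ge this.le

theorem corner_add_leg (X : ℕ → ℝ) (i : ℕ) (b : Bool) :
    corner X i b + leg X i b = corner X i (!b) := by
  cases b <;> simp [corner, leg]

/-- The open mesh triangles. -/
def otri (X Y : ℕ → ℝ) (k : ℕ × ℕ × Bool) : Set (ℝ × ℝ) :=
  openTri (corner X k.1 k.2.2) (corner Y k.2.1 k.2.2) (leg X k.1 k.2.2) (leg Y k.2.1 k.2.2)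

/-- The closed mesh triangles. -/
def ctri (X Y : ℕ → ℝ) : ℕ × ℕ × Bool → Set (ℝ × ℝ)
  | (i, j, false) => convexHull ℝ {(X i, Y j), (X (i + 1), Y j), (X i, Y (j + 1))}
  | (i, j, true) => convexHull ℝ {(X i, Y (j + 1)), (X (i + 1), Y j), (X (i + 1), Y (j + 1))}

/-- Gives both orientations one description, a right-angled corner with signed legs; the legs are
negative for the upper triangle. Later arguments need no case distinction between the two. -/
theorem ctri_eq (X Y : ℕ → ℝ) (k : ℕ × ℕ × Bool) : ctri X Y k = convexHull ℝ
    {(corner X k.1 k.2.2, corner Y k.2.1 k.2.2),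
      (corner X k.1 k.2.2 + leg X k.1 k.2.2, corner Y k.2.1 k.2.2),
      (corner X k.1 k.2.2, corner Y k.2.1 k.2.2 + leg Y k.2.1 k.2.2)} := by
  obtain ⟨i, j, b⟩ := k
  cases b
  · simp only [ctri, corner_add_leg]
    simp only [corner, Bool.not_false, cond]
  · simp only [ctri, corner_add_leg]
    simp only [corner, Bool.not_true, cond]
    congr 1
    ext p
    simp only [mem_insert_iff, mem_singleton_iff]
    tauto

/-- The closed triangle with corner `(x₀, y₀)` and signed legs `h`, `k`. -/
def closedTri (x₀ y₀ h k : ℝ) : Set (ℝ × ℝ) :=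
  {p | 0 ≤ (p.1 - x₀) / h ∧ 0 ≤ (p.2 - y₀) / k ∧ (p.1 - x₀) / h + (p.2 - y₀) / k ≤ 1}

theorem convex_closedTri (x₀ y₀ h k : ℝ) : Convex ℝ (closedTri x₀ y₀ h k) := by
  intro p hp q hq a b ha hb hab
  obtain ⟨p1, p2, p3⟩ := hp
  obtain ⟨q1, q2, q3⟩ := hq
  have e1 : ((a • p + b • q).1 - x₀) / h = a * ((p.1 - x₀) / h) + b * ((q.1 - x₀) / h) := by
    have : x₀ = a * x₀ + b * x₀ := by rw [← add_mul, hab, one_mul]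
    conv_lhs => rw [this]
    simp only [Prod.fst_add, Prod.smul_fst, smul_eq_mul]
    ring
  have e2 : ((a • p + b • q).2 - y₀) / k = a * ((p.2 - y₀) / k) + b * ((q.2 - y₀) / k) := by
    have : y₀ = a * y₀ + b * y₀ := by rw [← add_mul, hab, one_mul]
    conv_lhs => rw [this]
    simp only [Prod.snd_add, Prod.smul_snd, smul_eq_mul]
    ring
  refine ⟨?_, ?_, ?_⟩
  · rw [e1]; positivity
  · rw [e2]; positivity
  · rw [e1, e2]; nlinarith

theorem ctri_subset {N : ℕ} {X Y : ℕ → ℝ} (hX : IsGrid N X) (hY : IsGrid N Y) {k : ℕ × ℕ × Bool}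
    (h1 : k.1 < N) (h2 : k.2.1 < N) : ctri X Y k ⊆
      closedTri (corner X k.1 k.2.2) (corner Y k.2.1 k.2.2) (leg X k.1 k.2.2) (leg Y k.2.1 k.2.2) := by
  have l1 := leg_ne_zero hX h1 k.2.2
  have l2 := leg_ne_zero hY h2 k.2.2
  rw [ctri_eq]
  refine convexHull_min ?_ (convex_closedTri _ _ _ _)
  rintro p (rfl | rfl | rfl) <;> simp [closedTri, l1, l2]

theorem ctri_subset_cell {N : ℕ} {X Y : ℕ → ℝ} (hX : IsGrid N X) (hY : IsGrid N Y)
    {k : ℕ × ℕ × Bool} (h1 : k.1 < N) (h2 : k.2.1 < N) :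
    ctri X Y k ⊆ Icc (X k.1) (X (k.1 + 1)) ×ˢ Icc (Y k.2.1) (Y (k.2.1 + 1)) := by
  intro p hp
  obtain ⟨p1, p2, p3⟩ := ctri_subset hX hY h1 h2 hp
  rw [← uIcc_corner hX h1 k.2.2, ← uIcc_corner hY h2 k.2.2]
  exact ⟨mem_uIcc_of_div_mem (leg_ne_zero hX h1 _) p1 (by linarith),
    mem_uIcc_of_div_mem (leg_ne_zero hY h2 _) p2 (by linarith)⟩

theorem otri_subset_ctri {N : ℕ} {X Y : ℕ → ℝ} (hX : IsGrid N X) (hY : IsGrid N Y)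
    {k : ℕ × ℕ × Bool} (h1 : k.1 < N) (h2 : k.2.1 < N) : otri X Y k ⊆ ctri X Y k := by
  rintro p ⟨p1, p2, p3⟩
  have l1 := leg_ne_zero hX h1 k.2.2
  have l2 := leg_ne_zero hY h2 k.2.2
  rw [ctri_eq]
  set x₀ := corner X k.1 k.2.2
  set y₀ := corner Y k.2.1 k.2.2
  set h := leg X k.1 k.2.2
  set l := leg Y k.2.1 k.2.2
  set s := (p.1 - x₀) / h with hs
  set t := (p.2 - y₀) / l with ht
  have hc := convex_convexHull ℝ ({(x₀, y₀), (x₀ + h, y₀), (x₀, y₀ + l)} : Set (ℝ × ℝ))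
  have hst : 0 < s + t := by linarith
  -- Two binary convex combinations: a point of the hypotenuse with weights proportional to `s` and
  -- `t`, then a point between it and the corner.
  have m1 := hc (subset_convexHull ℝ _ (show (x₀ + h, y₀) ∈ _ by simp))
    (subset_convexHull ℝ _ (show (x₀, y₀ + l) ∈ _ by simp))
    (show 0 ≤ s / (s + t) by positivity) (show 0 ≤ t / (s + t) by positivity)
    (by field_simp)
  have m2 := hc (subset_convexHull ℝ _ (show (x₀, y₀) ∈ _ by simp)) m1
    (show 0 ≤ 1 - (s + t) by linarith) hst.le (by ring)
  convert m2 using 1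
  have e1 : p.1 = x₀ + s * h := by rw [hs]; field_simp; ring
  have e2 : p.2 = y₀ + t * l := by rw [ht]; field_simp; ring
  ext
  · rw [e1]
    simp only [Prod.fst_add, Prod.smul_fst, smul_eq_mul]
    field_simp
    ring
  · rw [e2]
    simp only [Prod.snd_add, Prod.smul_snd, smul_eq_mul]
    field_simp
    ring

theorem mem_triIndex {N : ℕ} {k : ℕ × ℕ × Bool} : k ∈ triIndex N ↔ k.1 < N ∧ k.2.1 < N := by
  simp [triIndex]

theorem otri_bounds {N : ℕ} {X Y : ℕ → ℝ} (hX : IsGrid N X) (hY : IsGrid N Y)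
    {k : ℕ × ℕ × Bool} (h1 : k.1 < N) (h2 : k.2.1 < N) {p : ℝ × ℝ} (hp : p ∈ otri X Y k) :
    X k.1 < p.1 ∧ p.1 < X (k.1 + 1) ∧ Y k.2.1 < p.2 ∧ p.2 < Y (k.2.1 + 1) := by
  obtain ⟨i, j, b⟩ := k
  obtain ⟨p1, p2, p3⟩ := hp
  have g1 := hX.lt i h1
  have g2 := hY.lt j h2
  cases b <;> simp only [corner, leg, cond] at p1 p2 p3
  · have a1 : 0 < X (i + 1) - X i := by linarith
    have a2 : 0 < Y (j + 1) - Y j := by linarith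
    have q1 : (p.1 - X i) / (X (i + 1) - X i) < 1 := by linarith
    have q2 : (p.2 - Y j) / (Y (j + 1) - Y j) < 1 := by linarith
    rw [div_lt_one a1] at q1
    rw [div_lt_one a2] at q2
    rw [div_pos_iff_of_pos_right a1] at p1
    rw [div_pos_iff_of_pos_right a2] at p2
    refine ⟨?_, ?_, ?_, ?_⟩ <;> simp only <;> linarith
  · have a1 : X i - X (i + 1) < 0 := by linarith
    have a2 : Y j - Y (j + 1) < 0 := by linarith
    have q1 : (p.1 - X (i + 1)) / (X i - X (i + 1)) < 1 := by linarith
    have q2 : (p.2 - Y (j + 1)) / (Y j - Y (j + 1)) < 1 := by linarith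
    rw [div_lt_one_of_neg a1] at q1
    rw [div_lt_one_of_neg a2] at q2
    have r1 := (div_pos_iff.1 p1)
    have r2 := (div_pos_iff.1 p2)
    rcases r1 with r1 | r1
    · linarith
    rcases r2 with r2 | r2
    · linarith
    refine ⟨?_, ?_, ?_, ?_⟩ <;> simp only <;> linarith

theorem otri_subset_Omega {N : ℕ} {X Y : ℕ → ℝ} (hX : IsGrid N X) (hY : IsGrid N Y)
    {k : ℕ × ℕ × Bool} (hk : k ∈ triIndex N) : otri X Y k ⊆ Omega := by
  intro p hp
  obtain ⟨h1, h2⟩ := mem_triIndex.1 hk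
  obtain ⟨a, b, c, d⟩ := otri_bounds hX hY h1 h2 hp
  exact ⟨⟨(hX.mem h1.le).1.trans_lt a, b.trans_le (hX.mem h1).2⟩,
    ⟨(hY.mem h2.le).1.trans_lt c, d.trans_le (hY.mem h2).2⟩⟩

theorem ctri_subset_OmegaBar {N : ℕ} {X Y : ℕ → ℝ} (hX : IsGrid N X) (hY : IsGrid N Y)
    {k : ℕ × ℕ × Bool} (hk : k ∈ triIndex N) : ctri X Y k ⊆ OmegaBar := by
  obtain ⟨h1, h2⟩ := mem_triIndex.1 hk
  exact (ctri_subset_cell hX hY h1 h2).trans (prod_mono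
    (Icc_subset_Icc (hX.mem h1.le).1 (hX.mem h1).2) (Icc_subset_Icc (hY.mem h2.le).1 (hY.mem h2).2))

/-- An open mesh triangle meets no other closed mesh triangle. -/
theorem tri_index_unique {N : ℕ} {X Y : ℕ → ℝ} (hX : IsGrid N X) (hY : IsGrid N Y)
    {k l : ℕ × ℕ × Bool} (hk : k ∈ triIndex N) (hl : l ∈ triIndex N) {p : ℝ × ℝ}
    (hp : p ∈ ctri X Y k) (hp' : p ∈ otri X Y l) : k = l := by
  obtain ⟨i, j, b⟩ := k
  obtain ⟨i', j', b'⟩ := l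
  obtain ⟨h1, h2⟩ := mem_triIndex.1 hk
  obtain ⟨h1', h2'⟩ := mem_triIndex.1 hl
  obtain ⟨q1, q2, q3, q4⟩ := otri_bounds hX hY h1' h2' hp'
  obtain ⟨⟨r1, r2⟩, ⟨r3, r4⟩⟩ := ctri_subset_cell hX hY h1 h2 hp
  have ei : i = i' := hX.index_unique h1 h1' r1 r2 q1 q2
  have ej : j = j' := hY.index_unique h2 h2' r3 r4 q3 q4
  subst ei ej
  have g1 : X (i + 1) - X i ≠ 0 := (sub_pos.2 (hX.lt i h1)).ne'
  have g2 : Y (j + 1) - Y j ≠ 0 := (sub_pos.2 (hY.lt j h2)).ne'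
  -- Relative coordinates from the upper right corner are complementary to those from the lower left
  -- one, so the two triangles of a cell lie on opposite sides of the diagonal.
  have s1 : (p.1 - X (i + 1)) / (X i - X (i + 1)) = 1 - (p.1 - X i) / (X (i + 1) - X i) := by
    rw [← neg_sub (X (i + 1)) (X i)]; field_simp; ring
  have s2 : (p.2 - Y (j + 1)) / (Y j - Y (j + 1)) = 1 - (p.2 - Y j) / (Y (j + 1) - Y j) := by
    rw [← neg_sub (Y (j + 1)) (Y j)]; field_simp; ring
  obtain ⟨-, -, c3⟩ := ctri_subset hX hY h1 h2 hp
  obtain ⟨-, -, o3⟩ := hp'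
  cases b <;> cases b' <;> simp only [corner, leg, cond] at c3 o3 ⊢
  · rw [s1, s2] at o3; linarith
  · rw [s1, s2] at c3; linarith

theorem disjoint_otri {N : ℕ} {X Y : ℕ → ℝ} (hX : IsGrid N X) (hY : IsGrid N Y)
    {k l : ℕ × ℕ × Bool} (hk : k ∈ triIndex N) (hl : l ∈ triIndex N) (hkl : k ≠ l) :
    Disjoint (otri X Y k) (otri X Y l) := by
  rw [Set.disjoint_left]
  intro p hp hp'
  obtain ⟨h1, h2⟩ := mem_triIndex.1 hk
  exact hkl (tri_index_unique hX hY hk hl (otri_subset_ctri hX hY h1 h2 hp) hp')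

theorem exists_otri {N : ℕ} {X Y : ℕ → ℝ} (hX : IsGrid N X) (hY : IsGrid N Y) {x y : ℝ}
    (hx : x ∈ Ioo (0 : ℝ) 1) (hy : y ∈ Ioo (0 : ℝ) 1) (h1 : ∀ i ≤ N, x ≠ X i)
    (h2 : ∀ j ≤ N, y ≠ Y j)
    (h3 : ∀ i < N, ∀ j < N, (x - X i) / (X (i + 1) - X i) + (y - Y j) / (Y (j + 1) - Y j) ≠ 1) :
    ∃ k ∈ triIndex N, (x, y) ∈ otri X Y k := by
  obtain ⟨i, hi, a1, a2⟩ := hX.exists_cell (Ioo_subset_Icc_self hx)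
  obtain ⟨j, hj, b1, b2⟩ := hY.exists_cell (Ioo_subset_Icc_self hy)
  have a1' : X i < x := lt_of_le_of_ne a1 (h1 i hi.le).symm
  have a2' : x < X (i + 1) := lt_of_le_of_ne a2 (h1 _ hi)
  have b1' : Y j < y := lt_of_le_of_ne b1 (h2 j hj.le).symm
  have b2' : y < Y (j + 1) := lt_of_le_of_ne b2 (h2 _ hj)
  have g1 : X (i + 1) - X i ≠ 0 := (sub_pos.2 (hX.lt i hi)).ne'
  have g2 : Y (j + 1) - Y j ≠ 0 := (sub_pos.2 (hY.lt j hj)).ne'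
  rcases lt_or_gt_of_ne (h3 i hi j hj) with h | h
  · refine ⟨(i, j, false), mem_triIndex.2 ⟨hi, hj⟩, ?_, ?_, ?_⟩ <;>
      simp only [corner, leg, cond]
    · exact div_pos (by linarith) (by linarith)
    · exact div_pos (by linarith) (by linarith)
    · exact h
  · refine ⟨(i, j, true), mem_triIndex.2 ⟨hi, hj⟩, ?_, ?_, ?_⟩ <;>
      simp only [corner, leg, cond]
    · exact div_pos_of_neg_of_neg (by linarith) (by linarith)
    · exact div_pos_of_neg_of_neg (by linarith) (by linarith)
    · have s1 : (x - X (i + 1)) / (X i - X (i + 1)) = 1 - (x - X i) / (X (i + 1) - X i) := by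
        rw [← neg_sub (X (i + 1)) (X i)]; field_simp; ring
      have s2 : (y - Y (j + 1)) / (Y j - Y (j + 1)) = 1 - (y - Y j) / (Y (j + 1) - Y j) := by
        rw [← neg_sub (Y (j + 1)) (Y j)]; field_simp; ring
      rw [s1, s2]
      linarith

/-- Almost every horizontal line meets the mesh edges in finitely many points. -/
theorem exists_otri_of_snd {N : ℕ} {X Y : ℕ → ℝ} (hX : IsGrid N X) (hY : IsGrid N Y) {y : ℝ}
    (hy : y ∈ Ioo (0 : ℝ) 1) (h2 : ∀ j ≤ N, y ≠ Y j) :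
    ∃ s : Set ℝ, s.Finite ∧ ∀ x ∈ Ioo (0 : ℝ) 1 \ s, ∃ k ∈ triIndex N, (x, y) ∈ otri X Y k := by
  -- The exceptional abscissas are the grid points and, for each cell, the solution of the equation
  -- of its diagonal at height `y`.
  refine ⟨X '' Iic N ∪ (fun q : ℕ × ℕ => X q.1 + (X (q.1 + 1) - X q.1) *
      (1 - (y - Y q.2) / (Y (q.2 + 1) - Y q.2))) '' (Iio N ×ˢ Iio N),
    ((finite_Iic N).image _).union (((finite_Iio N).prod (finite_Iio N)).image _), ?_⟩
  rintro x ⟨hx, hxs⟩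
  refine exists_otri hX hY hx hy (fun i hi h => hxs (Or.inl ⟨i, hi, h.symm⟩)) h2
    (fun i hi j hj h => hxs (Or.inr ⟨(i, j), ⟨hi, hj⟩, ?_⟩))
  have g1 : X (i + 1) - X i ≠ 0 := (sub_pos.2 (hX.lt i hi)).ne'
  rw [← h]
  field_simp
  ring

theorem swap_mem_otri {X Y : ℕ → ℝ} {k : ℕ × ℕ × Bool} {p : ℝ × ℝ} :
    p.swap ∈ otri Y X (k.2.1, k.1, k.2.2) ↔ p ∈ otri X Y k := by
  simp only [otri, openTri, mem_ofPred_eq, Prod.fst_swap, Prod.snd_swap]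
  constructor
  · rintro ⟨a, b, c⟩; exact ⟨b, a, by linarith⟩
  · rintro ⟨a, b, c⟩; exact ⟨b, a, by linarith⟩

theorem exists_otri_of_fst {N : ℕ} {X Y : ℕ → ℝ} (hX : IsGrid N X) (hY : IsGrid N Y) {x : ℝ}
    (hx : x ∈ Ioo (0 : ℝ) 1) (h2 : ∀ j ≤ N, x ≠ X j) :
    ∃ s : Set ℝ, s.Finite ∧ ∀ y ∈ Ioo (0 : ℝ) 1 \ s, ∃ k ∈ triIndex N, (x, y) ∈ otri X Y k := by
  obtain ⟨s, hs, h⟩ := exists_otri_of_snd hY hX hx h2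
  refine ⟨s, hs, fun y hy => ?_⟩
  obtain ⟨k, hk, hp⟩ := h y hy
  exact ⟨(k.2.1, k.1, k.2.2), mem_triIndex.2 (mem_triIndex.1 hk).symm,
    swap_mem_otri.2 hp⟩

theorem ae_ne_grid (X : ℕ → ℝ) (N : ℕ) : ∀ᵐ x : ℝ, ∀ j ≤ N, x ≠ X j := by
  have : (X '' Iic N).Finite := (finite_Iic N).image _
  have h0 : volume (X '' Iic N) = 0 := this.measure_zero _
  rw [ae_iff]
  refine measure_mono_null ?_ h0
  intro x hx
  simp only [ne_eq, not_forall, not_not, mem_ofPred_eq] at hx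
  obtain ⟨j, hj, h⟩ := hx
  exact ⟨j, hj, h.symm⟩

/-- The open mesh triangles cover almost all of the square. -/
theorem ae_exists_otri {N : ℕ} {X Y : ℕ → ℝ} (hX : IsGrid N X) (hY : IsGrid N Y) :
    ∀ᵐ p ∂(volume.restrict Omega), ∃ k ∈ triIndex N, p ∈ otri X Y k := by
  have hU : IsOpen (⋃ k ∈ triIndex N, otri X Y k) :=
    isOpen_biUnion fun k _ => isOpen_openTri _ _ _ _
  have hmeas : MeasurableSet (Omega \ ⋃ k ∈ triIndex N, otri X Y k) :=
    isOpen_Omega.measurableSet.diff hU.measurableSet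
  have hnull : volume (Omega \ ⋃ k ∈ triIndex N, otri X Y k) = 0 := by
    -- By Fubini it suffices that almost every vertical slice of the uncovered set is null; off the
    -- grid lines the slices are finite.
    rw [Measure.volume_eq_prod, Measure.measure_prod_null hmeas]
    filter_upwards [ae_ne_grid X N] with x hx
    by_cases hx1 : x ∈ Ioo (0 : ℝ) 1
    · obtain ⟨s, hs, h⟩ := exists_otri_of_fst hX hY hx1 hx
      refine measure_mono_null ?_ (hs.measure_zero volume)
      rintro y ⟨hy, hy'⟩
      by_contra hys
      obtain ⟨k, hk, hp⟩ := h y ⟨hy.2, hys⟩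
      exact hy' (mem_biUnion hk hp)
    · refine measure_mono_null ?_ measure_empty
      rintro y ⟨hy, -⟩
      exact (hx1 hy.1).elim
  rw [ae_restrict_iff' isOpen_Omega.measurableSet, ae_iff]
  refine measure_mono_null ?_ hnull
  intro p hp
  simp only [Classical.not_imp, mem_ofPred_eq] at hp
  refine ⟨hp.1, fun h => hp.2 ?_⟩
  simpa using h

end SDFEM

/-! ### Bounded functions, the L² norm, and integration by parts on the square -/

namespace SDFEM

/-- Essentially bounded measurable functions on the unit square. -/
abbrev Bd (F : ℝ × ℝ → ℝ) : Prop := MemLp F ⊤ (volume.restrict Omega)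

instance isFiniteMeasure_Omega : IsFiniteMeasure (volume.restrict Omega) :=
  ⟨by
    rw [Measure.restrict_apply_univ]
    exact (measure_mono Omega_subset_OmegaBar).trans_lt isCompact_OmegaBar.measure_lt_top⟩

theorem ae_mem_Omega : ∀ᵐ p ∂(volume.restrict Omega), p ∈ Omega :=
  ae_restrict_mem isOpen_Omega.measurableSet

/-- The square has finite measure, and `Bd` is stable under sums and products. Working in this class
makes the integrability of the integrands a formality. -/
theorem Bd.integrable {F : ℝ × ℝ → ℝ} (hF : Bd F) : Integrable F (volume.restrict Omega) :=
  MemLp.integrable le_top hF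

theorem Bd.mul {F G : ℝ × ℝ → ℝ} (hF : Bd F) (hG : Bd G) : Bd (fun p => F p * G p) :=
  MemLp.mul hG hF

theorem Bd.add {F G : ℝ × ℝ → ℝ} (hF : Bd F) (hG : Bd G) : Bd (fun p => F p + G p) :=
  MemLp.add hF hG

theorem Bd.sub {F G : ℝ × ℝ → ℝ} (hF : Bd F) (hG : Bd G) : Bd (fun p => F p - G p) :=
  MemLp.sub hF hG

theorem Bd.const_mul {F : ℝ × ℝ → ℝ} (hF : Bd F) (c : ℝ) : Bd (fun p => c * F p) :=
  MemLp.const_mul hF c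

theorem Bd.pow_two {F : ℝ × ℝ → ℝ} (hF : Bd F) : Bd (fun p => F p ^ 2) := by
  simpa only [sq] using hF.mul hF

theorem bd_const (c : ℝ) : Bd (fun _ => c) := memLp_const c

theorem bd_of_continuousOn {F : ℝ × ℝ → ℝ} (hF : ContinuousOn F OmegaBar) : Bd F := by
  obtain ⟨C, hC⟩ := isCompact_OmegaBar.exists_bound_of_continuousOn hF
  refine memLp_top_of_bound
    ((hF.mono Omega_subset_OmegaBar).aestronglyMeasurable isOpen_Omega.measurableSet) C ?_
  filter_upwards [ae_mem_Omega] with p hp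
  exact hC p (Omega_subset_OmegaBar hp)

theorem Bd.congr {F G : ℝ × ℝ → ℝ} (hF : Bd F) (h : F =ᵐ[volume.restrict Omega] G) : Bd G :=
  MemLp.ae_eq h hF

theorem Bd.indicator {F : ℝ × ℝ → ℝ} (hF : Bd F) {D : Set (ℝ × ℝ)} (hD : MeasurableSet D) :
    Bd (D.indicator F) := MemLp.indicator hD hF

/-- The norm of `L²(Ω)`. -/
noncomputable def nrm (F : ℝ × ℝ → ℝ) : ℝ := Real.sqrt (∫ p in Omega, F p ^ 2)

theorem nrm_nonneg (F : ℝ × ℝ → ℝ) : 0 ≤ nrm F := Real.sqrt_nonneg _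

theorem nrm_sq (F : ℝ × ℝ → ℝ) : nrm F ^ 2 = ∫ p in Omega, F p ^ 2 :=
  Real.sq_sqrt (integral_nonneg fun _ => sq_nonneg _)

/-- The Cauchy–Schwarz inequality. -/
theorem abs_integral_mul_le {F G : ℝ × ℝ → ℝ} (hF : Bd F) (hG : Bd G) :
    |∫ p in Omega, F p * G p| ≤ nrm F * nrm G := by
  have hF2 : MemLp (fun p => |F p|) (ENNReal.ofReal 2) (volume.restrict Omega) :=
    (MemLp.mono_exponent hF le_top).norm
  have hG2 : MemLp (fun p => |G p|) (ENNReal.ofReal 2) (volume.restrict Omega) :=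
    (MemLp.mono_exponent hG le_top).norm
  have h := integral_mul_le_Lp_mul_Lq_of_nonneg Real.HolderConjugate.two_two
    (Filter.Eventually.of_forall fun p => abs_nonneg (F p))
    (Filter.Eventually.of_forall fun p => abs_nonneg (G p)) hF2 hG2
  refine (abs_integral_le_integral_abs).trans ?_
  simp only [abs_mul]
  refine h.trans (le_of_eq ?_)
  simp only [nrm, Real.sqrt_eq_rpow, Real.rpow_two, sq_abs]

theorem nrm_mono {F H : ℝ × ℝ → ℝ} (hH : Bd H)
    (h : ∀ᵐ p ∂(volume.restrict Omega), |F p| ≤ H p) : nrm F ≤ nrm H := by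
  refine Real.sqrt_le_sqrt (integral_mono_of_nonneg
    (Filter.Eventually.of_forall fun p => sq_nonneg (F p)) hH.pow_two.integrable ?_)
  filter_upwards [h] with p hp
  rw [← sq_abs (F p)]
  exact pow_le_pow_left₀ (abs_nonneg _) hp 2

theorem nrm_add_le {F G : ℝ × ℝ → ℝ} (hF : Bd F) (hG : Bd G) :
    nrm (fun p => F p + G p) ≤ nrm F + nrm G := by
  refine Real.sqrt_le_iff.2 ⟨add_nonneg (nrm_nonneg _) (nrm_nonneg _), ?_⟩
  have h1 := (abs_le.1 (abs_integral_mul_le hF hG)).2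
  have h2 : ∫ p in Omega, (F p + G p) ^ 2 =
      (∫ p in Omega, F p ^ 2) + 2 * (∫ p in Omega, F p * G p) + ∫ p in Omega, G p ^ 2 := by
    have i1 := hF.pow_two.integrable
    have i2 : Integrable (fun p => 2 * (F p * G p)) (volume.restrict Omega) :=
      (hF.mul hG).integrable.const_mul 2
    have i12 : Integrable (fun p => F p ^ 2 + 2 * (F p * G p)) (volume.restrict Omega) := i1.add i2
    rw [← integral_const_mul, ← integral_add i1 i2, ← integral_add i12 hG.pow_two.integrable]
    congr 1
    ext p
    ring
  rw [h2, ← nrm_sq, ← nrm_sq]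
  nlinarith

theorem nrm_const_mul (c : ℝ) (F : ℝ × ℝ → ℝ) : nrm (fun p => c * F p) = |c| * nrm F := by
  simp only [nrm, mul_pow]
  rw [integral_const_mul, Real.sqrt_mul (sq_nonneg c), Real.sqrt_sq_eq_abs]

theorem measureReal_Omega : (volume.restrict Omega).real univ = 1 := by
  rw [measureReal_restrict_apply_univ, Measure.real, Omega, Measure.volume_eq_prod,
    Measure.prod_prod]
  simp

theorem nrm_const (c : ℝ) : nrm (fun _ => c) = |c| := by
  simp only [nrm]
  rw [integral_const, measureReal_Omega, one_smul, Real.sqrt_sq_eq_abs]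

theorem nrm_le_const {F : ℝ × ℝ → ℝ} {c : ℝ} (h : ∀ᵐ p ∂(volume.restrict Omega), |F p| ≤ c) :
    nrm F ≤ |c| := (nrm_mono (bd_const c) h).trans_eq (nrm_const c)

theorem mem_frontier_Omega {p : ℝ × ℝ} : p ∈ frontier Omega ↔
    p ∈ OmegaBar ∧ (p.1 = 0 ∨ p.1 = 1 ∨ p.2 = 0 ∨ p.2 = 1) := by
  rw [Omega, frontier_prod_eq, frontier_Ioo zero_lt_one, closure_Ioo zero_ne_one]
  simp only [mem_union, mem_prod, mem_insert_iff, mem_singleton_iff, OmegaBar]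
  constructor
  · rintro (⟨h1, h2⟩ | ⟨h1, h2⟩)
    · exact ⟨⟨h1, by rcases h2 with h | h <;> rw [h] <;> simp⟩, by tauto⟩
    · exact ⟨⟨by rcases h1 with h | h <;> rw [h] <;> simp, h2⟩, by tauto⟩
  · tauto

theorem measurePreserving_swap_Omega :
    MeasurePreserving Prod.swap (volume.restrict Omega) (volume.restrict Omega) := by
  have h : MeasurePreserving (Prod.swap : ℝ × ℝ → ℝ × ℝ) volume volume :=
    Measure.measurePreserving_swap
  have := h.restrict_preimage isOpen_Omega.measurableSet
  have e : (Prod.swap ⁻¹' Omega : Set (ℝ × ℝ)) = Omega := by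
    ext p; exact and_comm
  rwa [e] at this

theorem Bd.swap {F : ℝ × ℝ → ℝ} (hF : Bd F) : Bd (F ∘ Prod.swap) :=
  MemLp.comp_measurePreserving hF measurePreserving_swap_Omega

theorem integral_swap (F : ℝ × ℝ → ℝ) :
    ∫ p in Omega, F p.swap = ∫ p in Omega, F p := by
  have h := setIntegral_prod_swap (μ := volume) (ν := volume) (Ioo (0 : ℝ) 1) (Ioo (0 : ℝ) 1) F
  exact h

/-- The partial derivative of a function without flux through the boundary has integral zero. -/
theorem integral_fst_deriv_eq_zero {F F' : ℝ × ℝ → ℝ} (hF : ContinuousOn F OmegaBar)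
    (h0 : ∀ p ∈ frontier Omega, F p = 0) (hF' : Bd F')
    (hd : ∀ᵐ y : ℝ, y ∈ Ioo (0 : ℝ) 1 → ∃ s : Set ℝ, s.Finite ∧
      ∀ x ∈ Ioo (0 : ℝ) 1 \ s, HasDerivAt (fun t => F (t, y)) (F' (x, y)) x) :
    ∫ p in Omega, F' p = 0 := by
  have hi : IntegrableOn F' (Ioo (0 : ℝ) 1 ×ˢ Ioo (0 : ℝ) 1) (volume.prod volume) :=
    hF'.integrable
  have hfr : ∀ y ∈ Ioo (0 : ℝ) 1, F (1, y) - F (0, y) = 0 := by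
    intro y hy
    have hy' := Ioo_subset_Icc_self hy
    rw [h0 _ (mem_frontier_Omega.2 ⟨⟨by simp, hy'⟩, by simp⟩),
      h0 _ (mem_frontier_Omega.2 ⟨⟨by simp, hy'⟩, by simp⟩), sub_zero]
  have hsw : IntegrableOn (fun z => F' z.swap) (Ioo (0 : ℝ) 1 ×ˢ Ioo (0 : ℝ) 1)
      (volume.prod volume) := hi.swap
  -- The swap makes x the inner variable of Fubini. On almost every horizontal line the function is
  -- continuous and differentiable off a finite set, and the fundamental theorem of calculus
  -- applies.
  rw [← integral_swap, Omega, Measure.volume_eq_prod, setIntegral_prod _ hsw]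
  refine setIntegral_eq_zero_of_ae_eq_zero ?_
  filter_upwards [hd] with y hdy hy
  obtain ⟨s, hs, hds⟩ := hdy hy
  by_cases hint : IntegrableOn (fun x => F' (x, y)) (Ioo 0 1)
  · have hc : ContinuousOn (fun x => F (x, y)) (Icc 0 1) :=
      hF.comp (by fun_prop) fun x hx => ⟨hx, Ioo_subset_Icc_self hy⟩
    have := integral_eq_of_hasDerivAt_off_countable_of_le (fun x => F (x, y)) (fun x => F' (x, y))
      zero_le_one hs.countable hc hds
      ((intervalIntegrable_iff_integrableOn_Ioo_of_le zero_le_one).2 hint)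
    rw [intervalIntegral.integral_of_le zero_le_one, integral_Ioc_eq_integral_Ioo, hfr y hy] at this
    exact this
  -- On a slice where the derivative is not integrable the inner integral is zero by convention, so
  -- these slices need no separate argument.
  · exact integral_undef hint

/-- Continuous functions that are continuously differentiable on every open mesh triangle. -/
structure PC1 (N : ℕ) (X Y : ℕ → ℝ) (v : ℝ × ℝ → ℝ) : Prop where
  cont : ContinuousOn v OmegaBar
  dx : ∀ k ∈ triIndex N, ∀ p ∈ otri X Y k, HasDerivAt (fun t => v (t, p.2)) (pdx v p) p.1
  dy : ∀ k ∈ triIndex N, ∀ p ∈ otri X Y k, HasDerivAt (fun t => v (p.1, t)) (pdy v p) p.2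
  bdx : Bd (pdx v)
  bdy : Bd (pdy v)

theorem pdx_eq_of_hasDerivAt {v : ℝ × ℝ → ℝ} {p : ℝ × ℝ} {a : ℝ} (hp : p ∈ Omega)
    (h : HasDerivAt (fun t => v (t, p.2)) a p.1) : pdx v p = a :=
  h.hasDerivWithinAt.derivWithin (uniqueDiffOn_Icc one_pos _ (Ioo_subset_Icc_self hp.1))

theorem pdy_eq_of_hasDerivAt {v : ℝ × ℝ → ℝ} {p : ℝ × ℝ} {a : ℝ} (hp : p ∈ Omega)
    (h : HasDerivAt (fun t => v (p.1, t)) a p.2) : pdy v p = a :=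
  h.hasDerivWithinAt.derivWithin (uniqueDiffOn_Icc one_pos _ (Ioo_subset_Icc_self hp.2))

section PC1

variable {N : ℕ} {X Y : ℕ → ℝ} {f g : ℝ × ℝ → ℝ}

theorem ae_of_otri (hX : IsGrid N X) (hY : IsGrid N Y) {Q : ℝ × ℝ → Prop}
    (h : ∀ k ∈ triIndex N, ∀ p ∈ otri X Y k, Q p) : ∀ᵐ p ∂(volume.restrict Omega), Q p := by
  filter_upwards [ae_exists_otri hX hY] with p ⟨k, hk, hp⟩
  exact h k hk p hp

theorem PC1.bd (hf : PC1 N X Y f) : Bd f := bd_of_continuousOn hf.cont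

theorem PC1.swap (hf : PC1 N X Y f) : PC1 N Y X (f ∘ Prod.swap) where
  cont := hf.cont.comp continuous_swap.continuousOn fun _ hp => swap_mem_OmegaBar.2 hp
  dx k hk p hp := hf.dy (k.2.1, k.1, k.2.2) (mem_triIndex.2 (mem_triIndex.1 hk).symm) p.swap
    (swap_mem_otri.2 hp)
  dy k hk p hp := hf.dx (k.2.1, k.1, k.2.2) (mem_triIndex.2 (mem_triIndex.1 hk).symm) p.swap
    (swap_mem_otri.2 hp)
  bdx := hf.bdy.swap
  bdy := hf.bdx.swap

theorem pc1_of_contDiffOn (hX : IsGrid N X) (hY : IsGrid N Y) (hf : ContDiffOn ℝ 1 f OmegaBar) :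
    PC1 N X Y f where
  cont := hf.continuousOn
  dx k hk p hp := by
    have := otri_subset_Omega hX hY hk hp
    exact hasDerivAt_pdx hf this.1 (Ioo_subset_Icc_self this.2)
  dy k hk p hp := by
    have := otri_subset_Omega hX hY hk hp
    exact hasDerivAt_pdx (contDiffOn_swap hf) (x := p.2) (y := p.1) this.2
      (Ioo_subset_Icc_self this.1)
  bdx := bd_of_continuousOn (continuousOn_pdx hf)
  bdy := bd_of_continuousOn (continuousOn_pdy hf)

theorem PC1.pdx_mul (hX : IsGrid N X) (hY : IsGrid N Y) (hf : PC1 N X Y f) (hg : PC1 N X Y g)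
    {k : ℕ × ℕ × Bool} (hk : k ∈ triIndex N) {p : ℝ × ℝ} (hp : p ∈ otri X Y k) :
    pdx (fun q => f q * g q) p = pdx f p * g p + f p * pdx g p :=
  pdx_eq_of_hasDerivAt (otri_subset_Omega hX hY hk hp) ((hf.dx k hk p hp).mul (hg.dx k hk p hp))

theorem PC1.pdy_mul (hX : IsGrid N X) (hY : IsGrid N Y) (hf : PC1 N X Y f) (hg : PC1 N X Y g)
    {k : ℕ × ℕ × Bool} (hk : k ∈ triIndex N) {p : ℝ × ℝ} (hp : p ∈ otri X Y k) :
    pdy (fun q => f q * g q) p = pdy f p * g p + f p * pdy g p :=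
  pdy_eq_of_hasDerivAt (otri_subset_Omega hX hY hk hp) ((hf.dy k hk p hp).mul (hg.dy k hk p hp))

theorem PC1.mul (hX : IsGrid N X) (hY : IsGrid N Y) (hf : PC1 N X Y f) (hg : PC1 N X Y g) :
    PC1 N X Y (fun q => f q * g q) where
  cont := hf.cont.mul hg.cont
  dx k hk p hp := by
    rw [hf.pdx_mul hX hY hg hk hp]
    exact (hf.dx k hk p hp).mul (hg.dx k hk p hp)
  dy k hk p hp := by
    rw [hf.pdy_mul hX hY hg hk hp]
    exact (hf.dy k hk p hp).mul (hg.dy k hk p hp)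
  bdx := ((hf.bdx.mul hg.bd).add (hf.bd.mul hg.bdx)).congr
    (ae_of_otri hX hY fun k hk p hp => (hf.pdx_mul hX hY hg hk hp).symm)
  bdy := ((hf.bdy.mul hg.bd).add (hf.bd.mul hg.bdy)).congr
    (ae_of_otri hX hY fun k hk p hp => (hf.pdy_mul hX hY hg hk hp).symm)

theorem PC1.pdx_sub (hX : IsGrid N X) (hY : IsGrid N Y) (hf : PC1 N X Y f) (hg : PC1 N X Y g)
    {k : ℕ × ℕ × Bool} (hk : k ∈ triIndex N) {p : ℝ × ℝ} (hp : p ∈ otri X Y k) :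
    pdx (f - g) p = pdx f p - pdx g p :=
  pdx_eq_of_hasDerivAt (otri_subset_Omega hX hY hk hp) ((hf.dx k hk p hp).sub (hg.dx k hk p hp))

theorem PC1.pdy_sub (hX : IsGrid N X) (hY : IsGrid N Y) (hf : PC1 N X Y f) (hg : PC1 N X Y g)
    {k : ℕ × ℕ × Bool} (hk : k ∈ triIndex N) {p : ℝ × ℝ} (hp : p ∈ otri X Y k) :
    pdy (f - g) p = pdy f p - pdy g p :=
  pdy_eq_of_hasDerivAt (otri_subset_Omega hX hY hk hp) ((hf.dy k hk p hp).sub (hg.dy k hk p hp))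

theorem PC1.sub (hX : IsGrid N X) (hY : IsGrid N Y) (hf : PC1 N X Y f) (hg : PC1 N X Y g) :
    PC1 N X Y (f - g) where
  cont := hf.cont.sub hg.cont
  dx k hk p hp := by
    rw [hf.pdx_sub hX hY hg hk hp]
    exact (hf.dx k hk p hp).sub (hg.dx k hk p hp)
  dy k hk p hp := by
    rw [hf.pdy_sub hX hY hg hk hp]
    exact (hf.dy k hk p hp).sub (hg.dy k hk p hp)
  bdx := (hf.bdx.sub hg.bdx).congr
    (ae_of_otri hX hY fun k hk p hp => (hf.pdx_sub hX hY hg hk hp).symm)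
  bdy := (hf.bdy.sub hg.bdy).congr
    (ae_of_otri hX hY fun k hk p hp => (hf.pdy_sub hX hY hg hk hp).symm)

theorem PC1.integral_pdx_eq_zero (hX : IsGrid N X) (hY : IsGrid N Y) (hf : PC1 N X Y f)
    (h0 : ∀ p ∈ frontier Omega, f p = 0) : ∫ p in Omega, pdx f p = 0 := by
  refine integral_fst_deriv_eq_zero hf.cont h0 hf.bdx ?_
  filter_upwards [ae_ne_grid Y N] with y hy hy'
  obtain ⟨s, hs, h⟩ := exists_otri_of_snd hX hY hy' hy
  refine ⟨s, hs, fun x hx => ?_⟩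
  obtain ⟨k, hk, hp⟩ := h x hx
  exact hf.dx k hk _ hp

theorem PC1.integral_pdy_eq_zero (hX : IsGrid N X) (hY : IsGrid N Y) (hf : PC1 N X Y f)
    (h0 : ∀ p ∈ frontier Omega, f p = 0) : ∫ p in Omega, pdy f p = 0 := by
  rw [← hf.swap.integral_pdx_eq_zero hY hX fun p hp => h0 _ ?_, ← integral_swap]
  · rfl
  · rw [mem_frontier_Omega] at hp ⊢
    exact ⟨swap_mem_OmegaBar.2 hp.1, by simp only [Prod.fst_swap, Prod.snd_swap]; tauto⟩

end PC1

/-! ### Piecewise linear functions and step functions -/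

/-- Slopes of the affine interpolant on a mesh triangle. -/
noncomputable def slopeX (X Y : ℕ → ℝ) (w : ℝ × ℝ → ℝ) (k : ℕ × ℕ × Bool) : ℝ :=
  (w (corner X k.1 k.2.2 + leg X k.1 k.2.2, corner Y k.2.1 k.2.2)
    - w (corner X k.1 k.2.2, corner Y k.2.1 k.2.2)) / leg X k.1 k.2.2

/-- The slope in `y` of the affine interpolant on a mesh triangle. -/
noncomputable def slopeY (X Y : ℕ → ℝ) (w : ℝ × ℝ → ℝ) (k : ℕ × ℕ × Bool) : ℝ :=
  (w (corner X k.1 k.2.2, corner Y k.2.1 k.2.2 + leg Y k.2.1 k.2.2)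
    - w (corner X k.1 k.2.2, corner Y k.2.1 k.2.2)) / leg Y k.2.1 k.2.2

/-- The affine interpolant on a mesh triangle. -/
noncomputable def loc (X Y : ℕ → ℝ) (w : ℝ × ℝ → ℝ) (k : ℕ × ℕ × Bool) : ℝ × ℝ → ℝ :=
  affInterp w (corner X k.1 k.2.2) (corner Y k.2.1 k.2.2) (leg X k.1 k.2.2) (leg Y k.2.1 k.2.2)

/-- Triangles that share a horizontal edge have the same slope. -/
theorem slopeX_true {X Y : ℕ → ℝ} (w : ℝ × ℝ → ℝ) (i j : ℕ) :
    slopeX X Y w (i, j, true) = slopeX X Y w (i, j + 1, false) := by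
  simp only [slopeX, corner, leg, cond, add_sub_cancel]
  rw [← neg_sub (X (i + 1)) (X i), ← neg_sub (w (X (i + 1), Y (j + 1))), neg_div_neg_eq]

theorem slopeX_false {X Y : ℕ → ℝ} (w : ℝ × ℝ → ℝ) (i j : ℕ) :
    slopeX X Y w (i, j, false) = (w (X (i + 1), Y j) - w (X i, Y j)) / (X (i + 1) - X i) := by
  simp only [slopeX, corner, leg, cond, add_sub_cancel]

/-- Continuous functions that are affine on every mesh triangle. -/
structure IsPL (N : ℕ) (X Y : ℕ → ℝ) (v : ℝ × ℝ → ℝ) : Prop where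
  cont : ContinuousOn v OmegaBar
  affine : ∀ k ∈ triIndex N, ∃ a₀ a₁ a₂ : ℝ, ∀ p ∈ ctri X Y k, v p = a₀ + a₁ * p.1 + a₂ * p.2

/-- The step function with the value `c k` on the open mesh triangle with index `k`. -/
noncomputable def stepFn (N : ℕ) (X Y : ℕ → ℝ) (c : ℕ × ℕ × Bool → ℝ) (p : ℝ × ℝ) : ℝ :=
  ∑ k ∈ triIndex N, (otri X Y k).indicator (fun _ => c k) p

section PL

variable {N : ℕ} {X Y : ℕ → ℝ} {v : ℝ × ℝ → ℝ}

theorem measurableSet_otri (k : ℕ × ℕ × Bool) : MeasurableSet (otri X Y k) :=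
  (isOpen_openTri _ _ _ _).measurableSet

theorem stepFn_eq (hX : IsGrid N X) (hY : IsGrid N Y) (c : ℕ × ℕ × Bool → ℝ)
    {k : ℕ × ℕ × Bool} (hk : k ∈ triIndex N) {p : ℝ × ℝ} (hp : p ∈ otri X Y k) :
    stepFn N X Y c p = c k := by
  rw [stepFn, Finset.sum_eq_single_of_mem k hk, indicator_of_mem hp]
  intro l hl hlk
  exact indicator_of_notMem (fun h => Set.disjoint_left.1 (disjoint_otri hX hY hl hk hlk) h hp) _

theorem bd_stepFn (c : ℕ × ℕ × Bool → ℝ) : Bd (stepFn N X Y c) := by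
  have : stepFn N X Y c = ∑ k ∈ triIndex N, (otri X Y k).indicator (fun _ => c k) := by
    ext p; simp [stepFn]
  rw [this]
  exact memLp_finsetSum' _ fun k _ => (bd_const (c k)).indicator (measurableSet_otri k)

/-- An affine function is determined by its values at three vertices. This makes coefficients that
are only known to exist explicit. -/
theorem IsPL.eq_loc (hX : IsGrid N X) (hY : IsGrid N Y) (hv : IsPL N X Y v)
    {k : ℕ × ℕ × Bool} (hk : k ∈ triIndex N) {p : ℝ × ℝ} (hp : p ∈ otri X Y k) :
    v p = loc X Y v k p := by
  obtain ⟨h1, h2⟩ := mem_triIndex.1 hk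
  have l1 := leg_ne_zero hX h1 k.2.2
  have l2 := leg_ne_zero hY h2 k.2.2
  obtain ⟨a₀, a₁, a₂, h⟩ := hv.affine k hk
  have e0 := h (corner X k.1 k.2.2, corner Y k.2.1 k.2.2)
    (by rw [ctri_eq]; exact subset_convexHull ℝ _ (by simp))
  have e1 := h (corner X k.1 k.2.2 + leg X k.1 k.2.2, corner Y k.2.1 k.2.2)
    (by rw [ctri_eq]; exact subset_convexHull ℝ _ (by simp))
  have e2 := h (corner X k.1 k.2.2, corner Y k.2.1 k.2.2 + leg Y k.2.1 k.2.2)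
    (by rw [ctri_eq]; exact subset_convexHull ℝ _ (by simp))
  rw [h p (otri_subset_ctri hX hY h1 h2 hp), loc, affInterp, e0, e1, e2]
  field_simp
  ring

theorem IsPL.hasDerivAt_fst (hX : IsGrid N X) (hY : IsGrid N Y) (hv : IsPL N X Y v)
    {k : ℕ × ℕ × Bool} (hk : k ∈ triIndex N) {p : ℝ × ℝ} (hp : p ∈ otri X Y k) :
    HasDerivAt (fun t => v (t, p.2)) (slopeX X Y v k) p.1 := by
  have h1 : HasDerivAt (fun t => loc X Y v k (t, p.2)) (slopeX X Y v k) p.1 := by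
    have := ((((hasDerivAt_id p.1).sub_const (corner X k.1 k.2.2)).const_mul
      (slopeX X Y v k)).const_add (v (corner X k.1 k.2.2, corner Y k.2.1 k.2.2))).add_const
      (slopeY X Y v k * (p.2 - corner Y k.2.1 k.2.2))
    rwa [mul_one] at this
  refine h1.congr_of_eventuallyEq ?_
  have ho : IsOpen {t : ℝ | (t, p.2) ∈ otri X Y k} :=
    (isOpen_openTri _ _ _ _).preimage (by fun_prop : Continuous fun t : ℝ => (t, p.2))
  filter_upwards [ho.mem_nhds hp] with t ht
  exact hv.eq_loc hX hY hk ht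

theorem IsPL.hasDerivAt_snd (hX : IsGrid N X) (hY : IsGrid N Y) (hv : IsPL N X Y v)
    {k : ℕ × ℕ × Bool} (hk : k ∈ triIndex N) {p : ℝ × ℝ} (hp : p ∈ otri X Y k) :
    HasDerivAt (fun t => v (p.1, t)) (slopeY X Y v k) p.2 := by
  have h1 : HasDerivAt (fun t => loc X Y v k (p.1, t)) (slopeY X Y v k) p.2 := by
    have := ((((hasDerivAt_id p.2).sub_const (corner Y k.2.1 k.2.2)).const_mul
      (slopeY X Y v k)).const_add (v (corner X k.1 k.2.2, corner Y k.2.1 k.2.2) +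
      slopeX X Y v k * (p.1 - corner X k.1 k.2.2)))
    rwa [mul_one] at this
  refine h1.congr_of_eventuallyEq ?_
  have ho : IsOpen {t : ℝ | (p.1, t) ∈ otri X Y k} :=
    (isOpen_openTri _ _ _ _).preimage (by fun_prop : Continuous fun t : ℝ => (p.1, t))
  filter_upwards [ho.mem_nhds hp] with t ht
  exact hv.eq_loc hX hY hk ht

theorem IsPL.pdx_eq (hX : IsGrid N X) (hY : IsGrid N Y) (hv : IsPL N X Y v)
    {k : ℕ × ℕ × Bool} (hk : k ∈ triIndex N) {p : ℝ × ℝ} (hp : p ∈ otri X Y k) :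
    pdx v p = slopeX X Y v k :=
  pdx_eq_of_hasDerivAt (otri_subset_Omega hX hY hk hp) (hv.hasDerivAt_fst hX hY hk hp)

theorem IsPL.pdy_eq (hX : IsGrid N X) (hY : IsGrid N Y) (hv : IsPL N X Y v)
    {k : ℕ × ℕ × Bool} (hk : k ∈ triIndex N) {p : ℝ × ℝ} (hp : p ∈ otri X Y k) :
    pdy v p = slopeY X Y v k :=
  pdy_eq_of_hasDerivAt (otri_subset_Omega hX hY hk hp) (hv.hasDerivAt_snd hX hY hk hp)

/-- The first derivatives are locally constant on open triangles. This removes the diffusion term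
from the stabilization form on `V^N`. -/
theorem IsPL.lap_eq_zero (hX : IsGrid N X) (hY : IsGrid N Y) (hv : IsPL N X Y v)
    {k : ℕ × ℕ × Bool} (hk : k ∈ triIndex N) {p : ℝ × ℝ} (hp : p ∈ otri X Y k) :
    lap v p = 0 := by
  have hΩ := otri_subset_Omega hX hY hk hp
  have h1 : pdx (pdx v) p = 0 := by
    refine pdx_eq_of_hasDerivAt hΩ ((hasDerivAt_const p.1 (slopeX X Y v k)).congr_of_eventuallyEq ?_)
    have ho : IsOpen {t : ℝ | (t, p.2) ∈ otri X Y k} :=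
      (isOpen_openTri _ _ _ _).preimage (by fun_prop : Continuous fun t : ℝ => (t, p.2))
    filter_upwards [ho.mem_nhds hp] with t ht
    exact hv.pdx_eq hX hY hk ht
  have h2 : pdy (pdy v) p = 0 := by
    refine pdy_eq_of_hasDerivAt hΩ ((hasDerivAt_const p.2 (slopeY X Y v k)).congr_of_eventuallyEq ?_)
    have ho : IsOpen {t : ℝ | (p.1, t) ∈ otri X Y k} :=
      (isOpen_openTri _ _ _ _).preimage (by fun_prop : Continuous fun t : ℝ => (p.1, t))
    filter_upwards [ho.mem_nhds hp] with t ht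
    exact hv.pdy_eq hX hY hk ht
  rw [lap, h1, h2, add_zero]

theorem IsPL.pc1 (hX : IsGrid N X) (hY : IsGrid N Y) (hv : IsPL N X Y v) : PC1 N X Y v where
  cont := hv.cont
  dx k hk p hp := by
    rw [hv.pdx_eq hX hY hk hp]; exact hv.hasDerivAt_fst hX hY hk hp
  dy k hk p hp := by
    rw [hv.pdy_eq hX hY hk hp]; exact hv.hasDerivAt_snd hX hY hk hp
  bdx := (bd_stepFn (N := N) (X := X) (Y := Y) (slopeX X Y v)).congr
    (ae_of_otri hX hY fun k hk p hp => by rw [stepFn_eq hX hY _ hk hp, hv.pdx_eq hX hY hk hp])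
  bdy := (bd_stepFn (N := N) (X := X) (Y := Y) (slopeY X Y v)).congr
    (ae_of_otri hX hY fun k hk p hp => by rw [stepFn_eq hX hY _ hk hp, hv.pdy_eq hX hY hk hp])

theorem IsPL.sub {w : ℝ × ℝ → ℝ} (hv : IsPL N X Y v) (hw : IsPL N X Y w) :
    IsPL N X Y (v - w) where
  cont := hv.cont.sub hw.cont
  affine k hk := by
    obtain ⟨a₀, a₁, a₂, h⟩ := hv.affine k hk
    obtain ⟨c₀, c₁, c₂, h'⟩ := hw.affine k hk
    refine ⟨a₀ - c₀, a₁ - c₁, a₂ - c₂, fun p hp => ?_⟩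
    rw [Pi.sub_apply, h p hp, h' p hp]
    ring

/-- Integrals over closed mesh triangles are integrals over the open ones. -/
theorem setIntegral_ctri (hX : IsGrid N X) (hY : IsGrid N Y) {k : ℕ × ℕ × Bool}
    (hk : k ∈ triIndex N) (F : ℝ × ℝ → ℝ) :
    ∫ p in ctri X Y k, F p = ∫ p in Omega, (otri X Y k).indicator F p := by
  obtain ⟨h1, h2⟩ := mem_triIndex.1 hk
  rw [setIntegral_indicator (measurableSet_otri k), inter_eq_right.2 (otri_subset_Omega hX hY hk)]
  refine setIntegral_congr_set ?_
  have hnull : ∀ᵐ p : ℝ × ℝ, p ∉ OmegaBar \ Omega := by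
    have : volume (OmegaBar \ Omega) = 0 := by
      rw [← closure_Omega, ← isOpen_Omega.frontier_eq]
      exact ((convex_Ioo 0 1).prod (convex_Ioo 0 1)).addHaar_frontier volume
    exact measure_eq_zero_iff_ae_notMem.1 this
  have hae := (ae_restrict_iff' isOpen_Omega.measurableSet).1 (ae_exists_otri hX hY)
  filter_upwards [hnull, hae] with p hp1 hp2
  refine propext ⟨fun h => ?_, fun h => otri_subset_ctri hX hY h1 h2 h⟩
  have hΩ : p ∈ Omega := by
    by_contra hc
    exact hp1 ⟨ctri_subset_OmegaBar hX hY hk h, hc⟩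
  -- Almost every point of the closed triangle lies in some open triangle, which must be the one
  -- with the same index.
  obtain ⟨l, hl, hpl⟩ := hp2 hΩ
  rwa [tri_index_unique hX hY hk hl h hpl]

/-- Weighted sums of integrals over the mesh triangles. -/
theorem sum_mul_setIntegral_ctri (hX : IsGrid N X) (hY : IsGrid N Y) (c : ℕ × ℕ × Bool → ℝ)
    {F : ℝ × ℝ → ℝ} (hF : Bd F) :
    ∑ k ∈ triIndex N, c k * ∫ p in ctri X Y k, F p = ∫ p in Omega, stepFn N X Y c p * F p := by
  have : ∀ k ∈ triIndex N, c k * ∫ p in ctri X Y k, F p =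
      ∫ p in Omega, (otri X Y k).indicator (fun _ => c k) p * F p := by
    intro k hk
    rw [setIntegral_ctri hX hY hk, ← integral_const_mul]
    congr 1
    ext p
    by_cases hp : p ∈ otri X Y k <;> simp [hp]
  rw [Finset.sum_congr rfl this, ← integral_finsetSum]
  · simp only [stepFn, Finset.sum_mul]
  · intro k _
    exact (((bd_const (c k)).indicator (measurableSet_otri k)).mul hF).integrable

end PL

end SDFEM

/-! ### The layer-adapted mesh, the bilinear form and its coercivity -/

namespace SDFEM

section node

variable {lam : ℝ} {N : ℕ}

theorem node_of_le {i : ℕ} (hi : i ≤ N / 2) :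
    node lam N i = (i : ℝ) * ((1 - lam) / ((N : ℝ) / 2)) := if_pos hi

theorem node_half (hN : 0 < N) (he : Even N) : node lam N (N / 2) = 1 - lam := by
  obtain ⟨m, rfl⟩ := he
  have hm : (0 : ℝ) < m := by exact_mod_cast (show 0 < m by omega)
  rw [node_of_le le_rfl, show (m + m) / 2 = m by omega]
  push_cast
  field_simp
  ring

/-- As `N` is even, both branches of `node` give `1 - lam` at `N / 2`, so the formula of the fine
part is valid from there on. -/
theorem node_of_ge (hN : 0 < N) (he : Even N) {i : ℕ} (hi : N / 2 ≤ i) :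
    node lam N i = 1 - lam + ((i : ℝ) - (N : ℝ) / 2) * (lam / ((N : ℝ) / 2)) := by
  rcases hi.eq_or_lt with rfl | h
  · rw [node_half hN he]
    obtain ⟨m, rfl⟩ := he
    rw [show (m + m) / 2 = m by omega]
    push_cast
    ring
  · exact if_neg (by omega)

theorem node_step_coarse {i : ℕ} (hi : i < N / 2) :
    node lam N (i + 1) - node lam N i = 2 * (1 - lam) / N := by
  have hN : (0 : ℝ) < N := by exact_mod_cast (show 0 < N by omega)
  rw [node_of_le hi.le, node_of_le hi]
  push_cast
  field_simp
  ring

theorem node_step_fine (hN : 0 < N) (he : Even N) {i : ℕ} (hi : N / 2 ≤ i) :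
    node lam N (i + 1) - node lam N i = 2 * lam / N := by
  have hN' : (0 : ℝ) < N := by exact_mod_cast hN
  rw [node_of_ge hN he hi, node_of_ge hN he (hi.trans (Nat.le_succ i))]
  push_cast
  field_simp
  ring

theorem isGrid_node (hN : 0 < N) (he : Even N) (h0 : 0 < lam) (h1 : lam < 1) :
    IsGrid N (node lam N) where
  zero := by rw [node_of_le (Nat.zero_le _)]; simp
  last := by
    have hN' : (0 : ℝ) < N := by exact_mod_cast hN
    rw [node_of_ge hN he (Nat.div_le_self N 2)]
    field_simp
    ring
  lt i _ := by
    have hN' : (0 : ℝ) < N := by exact_mod_cast hN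
    rw [← sub_pos]
    rcases lt_or_ge i (N / 2) with h | h
    · rw [node_step_coarse h]
      have : 0 < 1 - lam := by linarith
      positivity
    · rw [node_step_fine hN he h]
      positivity

end node

/-- The mesh in the `x` direction. -/
noncomputable def meshX (P : Coeffs) (ε : ℝ) (N : ℕ) : ℕ → ℝ := node (transition P.β₁ ε N) N

/-- The mesh in the `y` direction. -/
noncomputable def meshY (P : Coeffs) (ε : ℝ) (N : ℕ) : ℕ → ℝ := node (transition P.β₂ ε N) N

theorem transition_pos {β ε : ℝ} {N : ℕ} (hβ : 0 < β) (hε : 0 < ε) (hN : 4 ≤ N) :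
    0 < transition β ε N := by
  have : 0 < Real.log N := Real.log_pos (by exact_mod_cast (show 1 < N by omega))
  exact lt_min (by norm_num) (by positivity)

theorem transition_le (β ε : ℝ) (N : ℕ) : transition β ε N ≤ 1 / 2 := min_le_left _ _

theorem tri_eq_ctri (P : Coeffs) (ε : ℝ) (N : ℕ) (k : ℕ × ℕ × Bool) :
    tri P ε N k = ctri (meshX P ε N) (meshY P ε N) k := by
  obtain ⟨i, j, b⟩ := k
  cases b <;> rfl

/-- The region of the coarse mesh. -/
def coarse (P : Coeffs) (ε : ℝ) (N : ℕ) : Set (ℝ × ℝ) :=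
  {p | p.1 < 1 - transition P.β₁ ε N ∧ p.2 < 1 - transition P.β₂ ε N}

theorem measurableSet_coarse (P : Coeffs) (ε : ℝ) (N : ℕ) : MeasurableSet (coarse P ε N) :=
  (measurableSet_lt measurable_fst measurable_const).inter
    (measurableSet_lt measurable_snd measurable_const)

section mesh

variable {P : Coeffs} {ε : ℝ} {N : ℕ}

theorem MeshAssumption.gridX (hM : MeshAssumption P ε N) (hP : P.Admissible) :
    IsGrid N (meshX P ε N) :=
  isGrid_node (by have := hM.four_le; omega) hM.even
    (transition_pos hP.β₁_pos hM.ε_pos hM.four_le) (by have := transition_le P.β₁ ε N; linarith)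

theorem MeshAssumption.gridY (hM : MeshAssumption P ε N) (hP : P.Admissible) :
    IsGrid N (meshY P ε N) :=
  isGrid_node (by have := hM.four_le; omega) hM.even
    (transition_pos hP.β₂_pos hM.ε_pos hM.four_le) (by have := transition_le P.β₂ ε N; linarith)

theorem IsPiecewiseLinear.isPL {v : ℝ × ℝ → ℝ} (hv : IsPiecewiseLinear P ε N v) :
    IsPL N (meshX P ε N) (meshY P ε N) v where
  cont := hv.continuousOn
  affine k hk := by rw [← tri_eq_ctri]; exact hv.affine k hk

theorem MemVN.isPL {v : ℝ × ℝ → ℝ} (hv : MemVN P ε N v) :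
    IsPL N (meshX P ε N) (meshY P ε N) v := hv.toIsPiecewiseLinear.isPL

theorem lt_half_iff (hM : MeshAssumption P ε N) {β : ℝ} (hG : IsGrid N (node (transition β ε N) N))
    {i : ℕ} (hi : i < N) {x : ℝ} (h1 : node (transition β ε N) N i < x)
    (h2 : x < node (transition β ε N) N (i + 1)) :
    i < N / 2 ↔ x < 1 - transition β ε N := by
  have h4 := hM.four_le
  have hh := node_half (lam := transition β ε N) (show 0 < N by omega) hM.even
  constructor
  · intro h
    have := hG.le (show i + 1 ≤ N / 2 by omega) (by omega)
    linarith
  · intro h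
    by_contra hc
    have := hG.le (show N / 2 ≤ i by omega) hi.le
    linarith

/-- The transition lines are grid lines and no triangle straddles them. The stabilization parameter
is therefore a function of the point, and sums over triangles become integrals weighted with the
indicator of the coarse region. -/
theorem delta_eq (hM : MeshAssumption P ε N) (hP : P.Admissible) (Cstar : ℝ) {k : ℕ × ℕ × Bool}
    (hk : k ∈ triIndex N) {p : ℝ × ℝ} (hp : p ∈ otri (meshX P ε N) (meshY P ε N) k) :
    delta P ε N Cstar k =
      (Cstar * (N : ℝ)⁻¹) * (coarse P ε N).indicator (fun _ => (1 : ℝ)) p := by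
  have hX := hM.gridX hP
  have hY := hM.gridY hP
  obtain ⟨h1, h2⟩ := mem_triIndex.1 hk
  obtain ⟨b1, b2, b3, b4⟩ := otri_bounds hX hY h1 h2 hp
  have i1 := lt_half_iff hM hX h1 b1 b2
  have i2 := lt_half_iff hM hY h2 b3 b4
  have h4 := hM.four_le
  have hhx : meshX P ε N (N / 2) = 1 - transition P.β₁ ε N := node_half (by omega) hM.even
  have hhy : meshY P ε N (N / 2) = 1 - transition P.β₂ ε N := node_half (by omega) hM.even
  have hiff : tri P ε N k ⊆ OmegaS P ε N ↔ p ∈ coarse P ε N := by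
    rw [tri_eq_ctri, coarse, mem_ofPred_eq, ← i1, ← i2]
    constructor
    · intro hsub
      have v1 : (meshX P ε N (k.1 + 1), meshY P ε N k.2.1) ∈ ctri (meshX P ε N) (meshY P ε N) k := by
        obtain ⟨i, j, b⟩ := k
        cases b <;> exact subset_convexHull ℝ _ (by simp)
      have v2 : (meshX P ε N k.1, meshY P ε N (k.2.1 + 1)) ∈ ctri (meshX P ε N) (meshY P ε N) k := by
        obtain ⟨i, j, b⟩ := k
        cases b <;> exact subset_convexHull ℝ _ (by simp)
      have w1 : meshX P ε N (k.1 + 1) ≤ 1 - transition P.β₁ ε N := (hsub v1).1.2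
      have w2 : meshY P ε N (k.2.1 + 1) ≤ 1 - transition P.β₂ ε N := (hsub v2).2.2
      constructor
      · by_contra hc
        have := hX.le (show N / 2 ≤ k.1 by omega) h1.le
        have := hX.lt _ h1
        linarith
      · by_contra hc
        have := hY.le (show N / 2 ≤ k.2.1 by omega) h2.le
        have := hY.lt _ h2
        linarith
    · rintro ⟨c1, c2⟩
      refine (ctri_subset_cell hX hY h1 h2).trans (prod_mono (Icc_subset_Icc (hX.mem h1.le).1 ?_)
        (Icc_subset_Icc (hY.mem h2.le).1 ?_))
      · rw [← hhx]; exact hX.le (by omega) (by omega)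
      · rw [← hhy]; exact hY.le (by omega) (by omega)
  by_cases h : p ∈ coarse P ε N
  · rw [delta, if_pos (hiff.2 h), indicator_of_mem h, mul_one]
  · rw [delta, if_neg (fun h' => h (hiff.1 h')), indicator_of_notMem h, mul_zero]

/-- The characteristic function of the region of the coarse mesh. -/
noncomputable def chi (P : Coeffs) (ε : ℝ) (N : ℕ) : ℝ × ℝ → ℝ :=
  (coarse P ε N).indicator fun _ => 1

theorem bd_chi : Bd (chi P ε N) := (bd_const 1).indicator (measurableSet_coarse P ε N)

theorem sum_delta_mul (hM : MeshAssumption P ε N) (hP : P.Admissible) (Cstar : ℝ)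
    {F : ℝ × ℝ → ℝ} (hF : Bd F) :
    ∑ k ∈ triIndex N, delta P ε N Cstar k * ∫ p in tri P ε N k, F p =
      Cstar * (N : ℝ)⁻¹ * ∫ p in Omega, chi P ε N p * F p := by
  have hX := hM.gridX hP
  have hY := hM.gridY hP
  simp only [tri_eq_ctri]
  rw [sum_mul_setIntegral_ctri hX hY _ hF, ← integral_const_mul]
  refine integral_congr_ae (ae_of_otri hX hY fun k hk p hp => ?_)
  simp only
  rw [stepFn_eq hX hY _ hk hp, delta_eq hM hP Cstar hk hp, chi, mul_assoc]

theorem sum_delta_mul' (hM : MeshAssumption P ε N) (hP : P.Admissible) (Cstar : ℝ)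
    {F G : ℝ × ℝ → ℝ} (hF : Bd fun p => F p * G p) :
    ∑ k ∈ triIndex N, ∫ p in tri P ε N k, F p * (delta P ε N Cstar k * G p) =
      Cstar * (N : ℝ)⁻¹ * ∫ p in Omega, chi P ε N p * (F p * G p) := by
  rw [← sum_delta_mul hM hP Cstar hF]
  refine Finset.sum_congr rfl fun k _ => ?_
  rw [← integral_const_mul]
  congr 1
  ext p
  ring

theorem bd_conv (hP : P.Admissible) {X Y : ℕ → ℝ} {v : ℝ × ℝ → ℝ} (hv : PC1 N X Y v) :
    Bd (P.conv v) :=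
  ((bd_of_continuousOn hP.smooth_b₁.continuousOn).mul hv.bdx).add
    ((bd_of_continuousOn hP.smooth_b₂.continuousOn).mul hv.bdy)

theorem bd_c (hP : P.Admissible) : Bd P.c := bd_of_continuousOn hP.cont_c

/-- The bilinear form for piecewise linear functions. -/
theorem aSD_eq (hM : MeshAssumption P ε N) (hP : P.Admissible) (Cstar : ℝ) {w v : ℝ × ℝ → ℝ}
    (hw : IsPL N (meshX P ε N) (meshY P ε N) w) (hv : IsPL N (meshX P ε N) (meshY P ε N) v) :
    aSD P ε N Cstar w v = ε * (∫ p in Omega, (pdx w p * pdx v p + pdy w p * pdy v p))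
      + (∫ p in Omega, (P.conv w p + P.c p * w p) * v p)
      + Cstar * (N : ℝ)⁻¹ * ∫ p in Omega, chi P ε N p *
        ((P.conv w p + P.c p * w p) * P.conv v p) := by
  have hX := hM.gridX hP
  have hY := hM.gridY hP
  have hw1 := hw.pc1 hX hY
  have hv1 := hv.pc1 hX hY
  have hae : ∀ᵐ p ∂(volume.restrict Omega),
      P.conv w p + P.c p * w p = -ε * lap w p + P.conv w p + P.c p * w p :=
    ae_of_otri hX hY fun k hk p hp => by rw [hw.lap_eq_zero hX hY hk hp]; ring
  have hb : Bd fun p => (-ε * lap w p + P.conv w p + P.c p * w p) * P.conv v p :=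
    (((bd_conv hP hw1).add ((bd_c hP).mul hw1.bd)).congr hae).mul (bd_conv hP hv1)
  rw [aSD, aGal, aStab, sum_delta_mul' hM hP Cstar hb]
  congr 2
  refine integral_congr_ae ?_
  filter_upwards [hae] with p hp
  rw [← hp]

theorem rhs_eq (hM : MeshAssumption P ε N) (hP : P.Admissible) (Cstar : ℝ) {f v : ℝ × ℝ → ℝ}
    (hf : ContinuousOn f OmegaBar) (hv : IsPL N (meshX P ε N) (meshY P ε N) v) :
    ∑ k ∈ triIndex N, ∫ p in tri P ε N k, f p * (delta P ε N Cstar k * P.conv v p) =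
      Cstar * (N : ℝ)⁻¹ * ∫ p in Omega, chi P ε N p * (f p * P.conv v p) :=
  sum_delta_mul' hM hP Cstar
    ((bd_of_continuousOn hf).mul (bd_conv hP (hv.pc1 (hM.gridX hP) (hM.gridY hP))))

theorem chi_mul_self (p : ℝ × ℝ) : chi P ε N p * chi P ε N p = chi P ε N p := by
  by_cases h : p ∈ coarse P ε N <;> simp [chi, h]

theorem chi_nonneg (p : ℝ × ℝ) : 0 ≤ chi P ε N p := indicator_nonneg (fun _ _ => zero_le_one) p

theorem chi_le_one (p : ℝ × ℝ) : chi P ε N p ≤ 1 := by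
  by_cases h : p ∈ coarse P ε N <;> simp [chi, h]

/-- The streamline diffusion norm in terms of norms of `L²(Ω)`. -/
theorem sdSq_eq (hM : MeshAssumption P ε N) (hP : P.Admissible) (Cstar : ℝ) {v : ℝ × ℝ → ℝ}
    (hv : IsPL N (meshX P ε N) (meshY P ε N) v) :
    sdSq P ε N Cstar v = ε * (nrm (pdx v) ^ 2 + nrm (pdy v) ^ 2) + P.μ₀ * nrm v ^ 2
      + Cstar * (N : ℝ)⁻¹ * nrm (fun p => chi P ε N p * P.conv v p) ^ 2 := by
  have hX := hM.gridX hP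
  have hY := hM.gridY hP
  have hv1 := hv.pc1 hX hY
  rw [sdSq, energySq, sum_delta_mul hM hP Cstar (bd_conv hP hv1).pow_two,
    integral_add hv1.bdx.pow_two.integrable hv1.bdy.pow_two.integrable, nrm_sq, nrm_sq, nrm_sq,
    nrm_sq]
  congr 3
  ext p
  rw [mul_pow, sq (chi P ε N p), chi_mul_self]

theorem sdSq_nonneg (hM : MeshAssumption P ε N) (hP : P.Admissible) {Cstar : ℝ} (hC : 0 ≤ Cstar)
    {v : ℝ × ℝ → ℝ} (hv : IsPL N (meshX P ε N) (meshY P ε N) v) : 0 ≤ sdSq P ε N Cstar v := by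
  rw [sdSq_eq hM hP Cstar hv]
  have := hM.ε_pos
  have := hP.μ₀_pos
  positivity

theorem energyNorm_le_sdNorm (hM : MeshAssumption P ε N) (hP : P.Admissible) {Cstar : ℝ}
    (hC : 0 ≤ Cstar) {v : ℝ × ℝ → ℝ} (hv : IsPL N (meshX P ε N) (meshY P ε N) v) :
    energyNorm P ε v ≤ sdNorm P ε N Cstar v := by
  refine Real.sqrt_le_sqrt ?_
  rw [sdSq, sum_delta_mul hM hP Cstar (bd_conv hP (hv.pc1 (hM.gridX hP) (hM.gridY hP))).pow_two]
  have : 0 ≤ ∫ p in Omega, chi P ε N p * P.conv v p ^ 2 :=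
    integral_nonneg fun p => mul_nonneg (chi_nonneg p) (sq_nonneg _)
  have : 0 ≤ Cstar * (N : ℝ)⁻¹ * ∫ p in Omega, chi P ε N p * P.conv v p ^ 2 := by positivity
  linarith

/-- Integration by parts in the convective term. -/
theorem integral_conv_mul (hP : P.Admissible) {X Y : ℕ → ℝ} (hX : IsGrid N X) (hY : IsGrid N Y)
    {w v : ℝ × ℝ → ℝ} (hw : PC1 N X Y w) (hv : PC1 N X Y v) (h0 : ∀ p ∈ frontier Omega, v p = 0) :
    ∫ p in Omega, P.conv w p * v p = -(∫ p in Omega, w p * P.conv v p)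
      - ∫ p in Omega, (pdx P.b₁ p + pdy P.b₂ p) * (w p * v p) := by
  have hb1 := pc1_of_contDiffOn hX hY hP.smooth_b₁
  have hb2 := pc1_of_contDiffOn hX hY hP.smooth_b₂
  have hwv := hw.mul hX hY hv
  -- The divergence theorem for the field `w v b`, which vanishes on the boundary with `v`.
  have e1 := (hb1.mul hX hY hwv).integral_pdx_eq_zero hX hY fun p hp => by simp [h0 p hp]
  have e2 := (hb2.mul hX hY hwv).integral_pdy_eq_zero hX hY fun p hp => by simp [h0 p hp]
  have i1 : Integrable (fun p => P.conv w p * v p) (volume.restrict Omega) :=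
    ((bd_conv hP hw).mul hv.bd).integrable
  have i2 : Integrable (fun p => w p * P.conv v p) (volume.restrict Omega) :=
    (hw.bd.mul (bd_conv hP hv)).integrable
  have i3 : Integrable (fun p => (pdx P.b₁ p + pdy P.b₂ p) * (w p * v p))
      (volume.restrict Omega) := ((hb1.bdx.add hb2.bdy).mul (hw.bd.mul hv.bd)).integrable
  have i12 : Integrable (fun p => P.conv w p * v p + w p * P.conv v p) (volume.restrict Omega) :=
    i1.add i2
  have key : (∫ p in Omega, (P.conv w p * v p + w p * P.conv v p
      + (pdx P.b₁ p + pdy P.b₂ p) * (w p * v p))) = 0 := by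
    rw [← add_zero (0 : ℝ), ← congrArg₂ (· + ·) e1 e2, ← integral_add
      (hb1.mul hX hY hwv).bdx.integrable (hb2.mul hX hY hwv).bdy.integrable]
    refine integral_congr_ae (ae_of_otri hX hY fun k hk p hp => ?_)
    simp only
    rw [hb1.pdx_mul hX hY hwv hk hp, hb2.pdy_mul hX hY hwv hk hp, hw.pdx_mul hX hY hv hk hp,
      hw.pdy_mul hX hY hv hk hp, Coeffs.conv, Coeffs.conv]
    ring
  rw [integral_add i12 i3, integral_add i1 i2] at key
  linarith

/-- Integration by parts with both arguments equal to `v` turns (b·∇v, v) into -½(∇·b v, v); the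
lower bound for c - ½∇·b does the rest. -/
theorem galerkin_coercive (hP : P.Admissible) {X Y : ℕ → ℝ} (hX : IsGrid N X) (hY : IsGrid N Y)
    {v : ℝ × ℝ → ℝ} (hv : PC1 N X Y v) (h0 : ∀ p ∈ frontier Omega, v p = 0) :
    P.μ₀ * nrm v ^ 2 ≤ ∫ p in Omega, (P.conv v p + P.c p * v p) * v p := by
  have hb1 := pc1_of_contDiffOn hX hY hP.smooth_b₁
  have hb2 := pc1_of_contDiffOn hX hY hP.smooth_b₂
  have hconv := integral_conv_mul hP hX hY hv hv h0
  have e1 : ∫ p in Omega, v p * P.conv v p = ∫ p in Omega, P.conv v p * v p := by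
    congr 1; ext p; ring
  have j1 : Bd fun p => P.conv v p * v p := (bd_conv hP hv).mul hv.bd
  have j2 : Bd fun p => P.c p * v p * v p := ((bd_c hP).mul hv.bd).mul hv.bd
  have j3 : Bd fun p => (pdx P.b₁ p + pdy P.b₂ p) * (v p * v p) :=
    (hb1.bdx.add hb2.bdy).mul (hv.bd.mul hv.bd)
  have e2 : ∫ p in Omega, (P.conv v p + P.c p * v p) * v p =
      ∫ p in Omega, (P.c p * v p * v p - 1 / 2 * ((pdx P.b₁ p + pdy P.b₂ p) * (v p * v p))) := by
    have : ∫ p in Omega, (P.conv v p + P.c p * v p) * v p =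
        ∫ p in Omega, (P.conv v p * v p + P.c p * v p * v p) := by congr 1; ext p; ring
    rw [this, integral_add j1.integrable j2.integrable,
      integral_sub j2.integrable (j3.const_mul (1 / 2)).integrable, integral_const_mul]
    linarith
  rw [e2, nrm_sq, ← integral_const_mul]
  refine integral_mono_ae (hv.bd.pow_two.const_mul P.μ₀).integrable
    (j2.sub (j3.const_mul (1 / 2))).integrable ?_
  filter_upwards [ae_mem_Omega] with p hp
  have := hP.c_sub_div_ge p (Omega_subset_OmegaBar hp)
  nlinarith [sq_nonneg (v p)]

/-- With δ the parameter on the coarse region, the stabilization form is δ(b·∇v + cv, b·∇v) there,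
at least ½δ‖b·∇v‖² - ½δ cM²‖v‖² by Young's inequality. Since δ ≤ `Cstar`, half of the term μ₀‖v‖²
absorbs the loss. -/
theorem coercive_of_le (hM : MeshAssumption P ε N) (hP : P.Admissible) {Cstar cM : ℝ}
    (hC : 0 < Cstar) (hcM : ∀ p ∈ OmegaBar, |P.c p| ≤ cM) (hle : Cstar * cM ^ 2 ≤ P.μ₀) :
    Coercive P ε N Cstar := by
  intro v hv
  have hX := hM.gridX hP
  have hY := hM.gridY hP
  have hpl := hv.isPL
  have hv1 := hpl.pc1 hX hY
  have hN : (1 : ℝ) ≤ N := by exact_mod_cast (show 1 ≤ N by have := hM.four_le; omega)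
  set d := Cstar * (N : ℝ)⁻¹ with hd
  have hd0 : 0 ≤ d := by positivity
  have hdC : d ≤ Cstar := mul_le_of_le_one_right hC.le (inv_le_one_of_one_le₀ hN)
  rw [sdNorm, Real.sq_sqrt (sdSq_nonneg hM hP hC.le hpl), sdSq_eq hM hP Cstar hpl,
    aSD_eq hM hP Cstar hpl hpl]
  have g := galerkin_coercive hP hX hY hv1 hv.boundary
  have t1 : ∫ p in Omega, (pdx v p * pdx v p + pdy v p * pdy v p) =
      nrm (pdx v) ^ 2 + nrm (pdy v) ^ 2 := by
    rw [nrm_sq, nrm_sq, ← integral_add hv1.bdx.pow_two.integrable hv1.bdy.pow_two.integrable]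
    congr 1; ext p; ring
  have hbc : Bd fun p => chi P ε N p * P.conv v p := bd_chi.mul (bd_conv hP hv1)
  have t2 : 1 / 2 * nrm (fun p => chi P ε N p * P.conv v p) ^ 2 - cM ^ 2 / 2 * nrm v ^ 2 ≤
      ∫ p in Omega, chi P ε N p * ((P.conv v p + P.c p * v p) * P.conv v p) := by
    rw [nrm_sq, nrm_sq, ← integral_const_mul, ← integral_const_mul, ← integral_sub
      (hbc.pow_two.const_mul (1 / 2)).integrable (hv1.bd.pow_two.const_mul (cM ^ 2 / 2)).integrable]
    refine integral_mono_ae ((hbc.pow_two.const_mul (1 / 2)).sub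
      (hv1.bd.pow_two.const_mul (cM ^ 2 / 2))).integrable
      (bd_chi.mul (((bd_conv hP hv1).add ((bd_c hP).mul hv1.bd)).mul (bd_conv hP hv1))).integrable ?_
    filter_upwards [ae_mem_Omega] with p hp
    have hc := hcM p (Omega_subset_OmegaBar hp)
    have hc2 : P.c p ^ 2 ≤ cM ^ 2 := sq_le_sq' (abs_le.1 hc).1 (abs_le.1 hc).2
    have h1 := chi_nonneg (P := P) (ε := ε) (N := N) p
    have h2 := chi_le_one (P := P) (ε := ε) (N := N) p
    have h3 : (chi P ε N p * P.conv v p) ^ 2 = chi P ε N p * P.conv v p ^ 2 := by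
      rw [mul_pow, sq (chi P ε N p), chi_mul_self]
    rw [h3]
    have h4 : 0 ≤ chi P ε N p * (P.conv v p + P.c p * v p) ^ 2 := by positivity
    have h5 : chi P ε N p * (P.c p * v p) ^ 2 ≤ cM ^ 2 * v p ^ 2 := by
      rw [mul_pow]
      have : P.c p ^ 2 * v p ^ 2 ≤ cM ^ 2 * v p ^ 2 :=
        mul_le_mul_of_nonneg_right hc2 (sq_nonneg _)
      have h0 : 0 ≤ P.c p ^ 2 * v p ^ 2 := by positivity
      nlinarith
    nlinarith
  rw [t1]
  have t3 := mul_le_mul_of_nonneg_left t2 hd0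
  have t4 : d * cM ^ 2 ≤ P.μ₀ := (mul_le_mul_of_nonneg_right hdC (sq_nonneg cM)).trans hle
  have t5 := mul_le_mul_of_nonneg_right t4 (sq_nonneg (nrm v))
  have t6 : 0 ≤ ε * (nrm (pdx v) ^ 2 + nrm (pdy v) ^ 2) := by
    have := hM.ε_pos
    positivity
  nlinarith

theorem exists_coercive (hP : P.Admissible) : ∃ C₀ : ℝ, 0 < C₀ ∧ ∀ Cstar : ℝ, 0 < Cstar →
    Cstar ≤ C₀ → ∀ (ε : ℝ) (N : ℕ), MeshAssumption P ε N → Coercive P ε N Cstar := by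
  obtain ⟨cM, hcM⟩ := isCompact_OmegaBar.exists_bound_of_continuousOn hP.cont_c
  have h0 := hP.μ₀_pos
  -- The added 1 keeps the denominator positive when the bound for `c` is zero.
  refine ⟨P.μ₀ / (cM ^ 2 + 1), by positivity, fun Cstar hC hle ε N hM =>
    coercive_of_le hM hP hC hcM ?_⟩
  rw [le_div_iff₀ (by positivity)] at hle
  nlinarith

end mesh

end SDFEM

/-! ### Supercloseness: pairing the triangles at a common horizontal edge -/

namespace SDFEM

/-- The integral over the square is the sum of the integrals over the mesh triangles. -/
theorem integral_eq_sum_otri {N : ℕ} {X Y : ℕ → ℝ} (hX : IsGrid N X) (hY : IsGrid N Y)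
    {F : ℝ × ℝ → ℝ} (hF : Bd F) :
    ∫ p in Omega, F p = ∑ k ∈ triIndex N, ∫ p in otri X Y k, F p := by
  have h := sum_mul_setIntegral_ctri hX hY (fun _ => 1) hF
  have e : ∫ p in Omega, stepFn N X Y (fun _ => 1) p * F p = ∫ p in Omega, F p :=
    integral_congr_ae (ae_of_otri hX hY fun k hk p hp => by
      simp only
      rw [stepFn_eq hX hY _ hk hp, one_mul])
  rw [← e, ← h]
  refine Finset.sum_congr rfl fun k hk => ?_
  rw [one_mul, setIntegral_ctri hX hY hk, setIntegral_indicator (measurableSet_otri k),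
    inter_eq_right.2 (otri_subset_Omega hX hY hk)]

/-- Point reflections preserve Lebesgue measure. With `c` twice the midpoint of an edge this carries
an integral over the triangle below the edge to the triangle above it. -/
theorem setIntegral_reflect (c : ℝ × ℝ) (K : Set (ℝ × ℝ)) (hK : MeasurableSet K)
    (F : ℝ × ℝ → ℝ) :
    ∫ p in (fun p => c - p) ⁻¹' K, F p = ∫ p in K, F (c - p) := by
  have hm : MeasurableSet ((fun p => c - p) ⁻¹' K) :=
    (measurable_const.sub measurable_id) hK
  rw [← integral_indicator hm, ← integral_indicator hK, ← integral_sub_left_eq_self _ _ c]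
  congr 1
  ext p
  by_cases hp : p ∈ K <;> simp [hp]

theorem integrableOn_otri {N : ℕ} {X Y : ℕ → ℝ} (hX : IsGrid N X) (hY : IsGrid N Y)
    {k : ℕ × ℕ × Bool} (hk : k ∈ triIndex N) {F : ℝ × ℝ → ℝ} (hF : Bd F) :
    IntegrableOn F (otri X Y k) :=
  hF.integrable.mono_measure (Measure.restrict_mono_set _ (otri_subset_Omega hX hY hk))

theorem volume_otri_lt_top {N : ℕ} {X Y : ℕ → ℝ} (hX : IsGrid N X) (hY : IsGrid N Y)
    {k : ℕ × ℕ × Bool} (hk : k ∈ triIndex N) : volume (otri X Y k) < ⊤ :=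
  (measure_mono ((otri_subset_Omega hX hY hk).trans Omega_subset_OmegaBar)).trans_lt
    isCompact_OmegaBar.measure_lt_top

/-- The integral over a mesh triangle of the error of the first component of the gradient. -/
noncomputable def gradDefect (X Y : ℕ → ℝ) (w : ℝ × ℝ → ℝ) (k : ℕ × ℕ × Bool) : ℝ :=
  ∫ p in otri X Y k, (slopeX X Y w k - pdx w p)

theorem abs_gradDefect_le {N : ℕ} {X Y : ℕ → ℝ} (hX : IsGrid N X) (hY : IsGrid N Y)
    {w : ℝ × ℝ → ℝ} {k : ℕ × ℕ × Bool} (hk : k ∈ triIndex N) {Q : ℝ}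
    (hQ : ∀ p ∈ otri X Y k, |slopeX X Y w k - pdx w p| ≤ Q) :
    |gradDefect X Y w k| ≤ Q * volume.real (otri X Y k) := by
  rw [gradDefect, ← Real.norm_eq_abs]
  exact norm_setIntegral_le_of_norm_le_const (volume_otri_lt_top hX hY hk) hQ

/-- Superclose estimate on the two triangles with a common horizontal edge, if the mesh is locally
uniform in the vertical direction. -/
theorem abs_gradDefect_add_le {N : ℕ} {X Y : ℕ → ℝ} (hX : IsGrid N X) (hY : IsGrid N Y)
    {w : ℝ × ℝ → ℝ} (hw : ContDiffOn ℝ 3 w OmegaBar) {i j : ℕ} (hi : i < N) (hj : j + 1 < N)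
    (hstep : Y (j + 2) - Y (j + 1) = Y (j + 1) - Y j) {M₁ M₂ M₃ Q : ℝ}
    (hM₁ : ∀ x ∈ Icc (X i) (X (i + 1)), ∀ y ∈ Icc (0 : ℝ) 1, |pdx (pdx (pdx w)) (x, y)| ≤ M₁)
    (hM₂ : ∀ x ∈ Icc (X i) (X (i + 1)), ∀ y ∈ Icc (0 : ℝ) 1, |pdx (pdx (pdy w)) (x, y)| ≤ M₂)
    (hM₃ : ∀ x ∈ Icc (X i) (X (i + 1)), ∀ y ∈ Icc (0 : ℝ) 1, |pdx (pdy (pdy w)) (x, y)| ≤ M₃)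
    (hQ : 2 * (M₁ * ((X (i + 1) - X i) / 2) ^ 2) + 2 * ((M₁ * ((X (i + 1) - X i) / 2)
      + M₂ * (Y (j + 1) - Y j)) * ((X (i + 1) - X i) / 2) + (M₂ * ((X (i + 1) - X i) / 2)
      + M₃ * (Y (j + 1) - Y j)) * (Y (j + 1) - Y j)) ≤ Q) :
    |gradDefect X Y w (i, j + 1, false) + gradDefect X Y w (i, j, true)| ≤
      Q * volume.real (otri X Y (i, j + 1, false)) := by
  have hk1 : (i, j + 1, false) ∈ triIndex N := mem_triIndex.2 ⟨hi, hj⟩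
  have hk2 : (i, j, true) ∈ triIndex N := mem_triIndex.2 ⟨hi, by simp only; omega⟩
  have hw1 : ContDiffOn ℝ 1 w OmegaBar := hw.of_le (by norm_num)
  set c : ℝ × ℝ := (X i + X (i + 1), 2 * Y (j + 1)) with hc
  set K := otri X Y (i, j + 1, false) with hK
  -- Equality of the two y-steps is what makes the lower triangle the reflection of the upper one in
  -- the midpoint of the edge.
  have hrefl : otri X Y (i, j, true) = (fun p => c - p) ⁻¹' K := by
    ext p
    simp only [K, otri, openTri, corner, leg, cond, mem_preimage, mem_ofPred_eq, Prod.fst_sub,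
      Prod.snd_sub, hc]
    have s1 : (X i + X (i + 1) - p.1 - X i) / (X (i + 1) - X i) =
        (p.1 - X (i + 1)) / (X i - X (i + 1)) := by
      rw [← neg_div_neg_eq]; ring
    have s2 : (2 * Y (j + 1) - p.2 - Y (j + 1)) / (Y (j + 1 + 1) - Y (j + 1)) =
        (p.2 - Y (j + 1)) / (Y j - Y (j + 1)) := by
      rw [show Y (j + 1 + 1) - Y (j + 1) = Y (j + 1) - Y j from hstep, ← neg_div_neg_eq]; ring
    rw [s1, s2]
  have hKm : MeasurableSet K := measurableSet_otri _
  have hbd : Bd (fun p => slopeX X Y w (i, j + 1, false) - pdx w p) :=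
    (bd_const _).sub (bd_of_continuousOn (continuousOn_pdx hw1))
  have i1 := integrableOn_otri hX hY hk1 hbd
  have i2 : IntegrableOn (fun p => slopeX X Y w (i, j + 1, false) - pdx w (c - p)) K := by
    have h := integrableOn_otri hX hY hk2 hbd
    rw [hrefl] at h
    have hmp : MeasurePreserving (fun p : ℝ × ℝ => c - p) volume volume :=
      Measure.measurePreserving_sub_left volume c
    have hcomp : (fun p => slopeX X Y w (i, j + 1, false) - pdx w (c - (c - p))) =
        fun p => slopeX X Y w (i, j + 1, false) - pdx w p := by simp
    have := (hmp.integrableOn_comp_preimage (MeasurableEquiv.subLeft c).measurableEmbedding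
      (f := fun p => slopeX X Y w (i, j + 1, false) - pdx w (c - p)) (s := K)).1
    refine this ?_
    simpa only [Function.comp_def, hcomp] using h
  have e : gradDefect X Y w (i, j + 1, false) + gradDefect X Y w (i, j, true) =
      ∫ p in K, (2 * slopeX X Y w (i, j + 1, false) - pdx w p - pdx w (c - p)) := by
    rw [gradDefect, gradDefect, slopeX_true, hrefl, setIntegral_reflect c K hKm, ← hK,
      ← integral_add i1 i2]
    congr 1
    ext p
    ring
  rw [e, ← Real.norm_eq_abs]
  refine norm_setIntegral_le_of_norm_le_const (volume_otri_lt_top hX hY hk1) fun p hp => ?_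
  obtain ⟨b1, b2, b3, b4⟩ := otri_bounds hX hY hi hj hp
  simp only at b1 b2 b3 b4
  have g1 := hX.lt i hi
  have hm1 : (X i + X (i + 1)) / 2 - (X (i + 1) - X i) / 2 = X i := by ring
  have hm2 : (X i + X (i + 1)) / 2 + (X (i + 1) - X i) / 2 = X (i + 1) := by ring
  have hn1 : Y (j + 1) - (Y (j + 1) - Y j) = Y j := by ring
  have hn2 : Y (j + 1) + (Y (j + 1) - Y j) = Y (j + 2) := by rw [← hstep]; ring
  have ysub : Icc (Y j) (Y (j + 2)) ⊆ Icc (0 : ℝ) 1 :=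
    Icc_subset_Icc (hY.mem (by omega)).1 (hY.mem (by omega)).2
  -- The edge extends half an x-step to either side of its midpoint, while each triangle extends a
  -- full y-step away from it; hence the factor ½ in `a` but not in `b`.
  have key := superclose_pointwise hw (m₁ := (X i + X (i + 1)) / 2) (m₂ := Y (j + 1))
    (a := (X (i + 1) - X i) / 2) (b := Y (j + 1) - Y j) (M₁ := M₁) (M₂ := M₂) (M₃ := M₃)
    (by linarith) (by rw [hm1, hm2]; exact Icc_subset_Icc (hX.mem hi.le).1 (hX.mem hi).2)
    (by rw [hn1, hn2]; exact ysub)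
    (by rw [hm1, hm2, hn1, hn2]; exact fun x hx y hy => hM₁ x hx y (ysub hy))
    (by rw [hm1, hm2, hn1, hn2]; exact fun x hx y hy => hM₂ x hx y (ysub hy))
    (by rw [hm1, hm2, hn1, hn2]; exact fun x hx y hy => hM₃ x hx y (ysub hy))
    (x := p.1) (y := p.2) (by rw [abs_le]; constructor <;> linarith)
    (by rw [show j + 1 + 1 = j + 2 from rfl] at b4; rw [abs_le]; constructor <;> linarith)
  rw [hm1, hm2] at key
  refine le_trans (le_of_eq ?_) (key.trans hQ)
  rw [Real.norm_eq_abs, slopeX_false]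
  congr 3
  · congr 3
    ring
  · simp only [hc]
    ext
    · simp only [Prod.fst_sub]; ring
    · simp only [Prod.snd_sub]

/-- Summation of the superclose estimates: the weight is `Q₁` in the fine region `x > X M` and there
is an additional `Q₂` on the two rows of triangles next to the line `y = Y M`. -/
theorem superclose_sum {N : ℕ} {X Y : ℕ → ℝ} (hX : IsGrid N X) (hY : IsGrid N Y)
    {w v : ℝ × ℝ → ℝ} (hw : ContDiffOn ℝ 1 w OmegaBar) (hv : IsPL N X Y v)
    (h0 : ∀ p ∈ frontier Omega, v p = 0) {M : ℕ} (hM : M < N) {Q₁ Q₂ : ℝ}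
    (hQ₁ : 0 ≤ Q₁) (hQ₂ : 0 ≤ Q₂)
    (H1 : ∀ i j, M ≤ i → i < N → j + 1 < N → j + 1 ≠ M →
      |gradDefect X Y w (i, j + 1, false) + gradDefect X Y w (i, j, true)| ≤
        Q₁ * volume.real (otri X Y (i, j + 1, false)))
    (H2 : ∀ k ∈ triIndex N, M ≤ k.1 → |gradDefect X Y w k| ≤ Q₂ * volume.real (otri X Y k)) :
    |∫ p in Omega, {p : ℝ × ℝ | X M < p.1}.indicator
        (fun p => stepFn N X Y (slopeX X Y w) p - pdx w p) p * pdx v p| ≤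
      ∫ p in Omega, ({p : ℝ × ℝ | X M < p.1}.indicator (fun _ => Q₁) p +
        {p : ℝ × ℝ | X M < p.1 ∧ Y (M - 1) < p.2 ∧ p.2 < Y (M + 1)}.indicator (fun _ => Q₂) p)
          * |pdx v p| := by
  have hv1 := hv.pc1 hX hY
  have mD : MeasurableSet {p : ℝ × ℝ | X M < p.1} := measurableSet_lt measurable_const measurable_fst
  have mS : MeasurableSet {p : ℝ × ℝ | X M < p.1 ∧ Y (M - 1) < p.2 ∧ p.2 < Y (M + 1)} :=
    mD.inter ((measurableSet_lt measurable_const measurable_snd).inter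
      (measurableSet_lt measurable_snd measurable_const))
  have habs : Bd fun p => |pdx v p| := MemLp.abs hv1.bdx
  have bF : Bd fun p => {p : ℝ × ℝ | X M < p.1}.indicator
      (fun p => stepFn N X Y (slopeX X Y w) p - pdx w p) p * pdx v p :=
    (((bd_stepFn _).sub (bd_of_continuousOn (continuousOn_pdx hw))).indicator mD).mul hv1.bdx
  have bW : Bd fun p => ({p : ℝ × ℝ | X M < p.1}.indicator (fun _ => Q₁) p +
        {p : ℝ × ℝ | X M < p.1 ∧ Y (M - 1) < p.2 ∧ p.2 < Y (M + 1)}.indicator (fun _ => Q₂) p)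
          * |pdx v p| :=
    (((bd_const Q₁).indicator mD).add ((bd_const Q₂).indicator mS)).mul habs
  rw [integral_eq_sum_otri hX hY bF, integral_eq_sum_otri hX hY bW]
  have hXM : ∀ k ∈ triIndex N, ∀ p ∈ otri X Y k, (X M < p.1 ↔ M ≤ k.1) := by
    intro k hk p hp
    obtain ⟨h1, h2⟩ := mem_triIndex.1 hk
    obtain ⟨b1, b2, -, -⟩ := otri_bounds hX hY h1 h2 hp
    constructor
    · intro h
      by_contra hc
      have := hX.le (show k.1 + 1 ≤ M by omega) hM.le
      linarith
    · intro h
      exact (hX.le h h1.le).trans_lt b1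
  have eL : ∀ k ∈ triIndex N, ∫ p in otri X Y k, {p : ℝ × ℝ | X M < p.1}.indicator
        (fun p => stepFn N X Y (slopeX X Y w) p - pdx w p) p * pdx v p =
      if M ≤ k.1 then slopeX X Y v k * gradDefect X Y w k else 0 := by
    intro k hk
    split_ifs with h
    · rw [gradDefect, ← integral_const_mul]
      refine setIntegral_congr_fun (measurableSet_otri k) fun p hp => ?_
      rw [indicator_of_mem (show p ∈ {p : ℝ × ℝ | X M < p.1} from (hXM k hk p hp).2 h),
        stepFn_eq hX hY _ hk hp, hv.pdx_eq hX hY hk hp, mul_comm]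
    · refine setIntegral_eq_zero_of_forall_eq_zero fun p hp => ?_
      rw [indicator_of_notMem (fun h' : p ∈ {p : ℝ × ℝ | X M < p.1} => h ((hXM k hk p hp).1 h')), zero_mul]
  have eR : ∀ k ∈ triIndex N, ∀ q : ℝ, (∀ p ∈ otri X Y k,
        q ≤ {p : ℝ × ℝ | X M < p.1}.indicator (fun _ => Q₁) p +
        {p : ℝ × ℝ | X M < p.1 ∧ Y (M - 1) < p.2 ∧ p.2 < Y (M + 1)}.indicator (fun _ => Q₂) p) →
      |slopeX X Y v k| * (q * volume.real (otri X Y k)) ≤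
      ∫ p in otri X Y k, ({p : ℝ × ℝ | X M < p.1}.indicator (fun _ => Q₁) p +
        {p : ℝ × ℝ | X M < p.1 ∧ Y (M - 1) < p.2 ∧ p.2 < Y (M + 1)}.indicator (fun _ => Q₂) p)
          * |pdx v p| := by
    intro k hk q hq
    have : |slopeX X Y v k| * (q * volume.real (otri X Y k)) =
        ∫ p in otri X Y k, q * |slopeX X Y v k| := by
      rw [setIntegral_const, smul_eq_mul]; ring
    rw [this]
    refine setIntegral_mono_on (integrableOn_otri hX hY hk (bd_const _))
      (integrableOn_otri hX hY hk bW) (measurableSet_otri k) fun p hp => ?_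
    rw [hv.pdx_eq hX hY hk hp]
    exact mul_le_mul_of_nonneg_right (hq p hp) (abs_nonneg _)
  rw [Finset.sum_congr rfl eL]
  simp only [triIndex, Finset.sum_product, Fintype.sum_bool]
  refine (Finset.abs_sum_le_sum_abs _ _).trans (Finset.sum_le_sum fun i hi => ?_)
  have hi' : i < N := Finset.mem_range.1 hi
  set R : ℕ → Bool → ℝ := fun j b => ∫ p in otri X Y (i, j, b),
    ({p : ℝ × ℝ | X M < p.1}.indicator (fun _ => Q₁) p +
        {p : ℝ × ℝ | X M < p.1 ∧ Y (M - 1) < p.2 ∧ p.2 < Y (M + 1)}.indicator (fun _ => Q₂) p)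
          * |pdx v p| with hR
  have hR0 : ∀ j b, 0 ≤ R j b := fun j b => integral_nonneg fun p =>
    mul_nonneg (add_nonneg (indicator_nonneg (fun _ _ => hQ₁) p)
      (indicator_nonneg (fun _ _ => hQ₂) p)) (abs_nonneg _)
  change _ ≤ ∑ j ∈ Finset.range N, (R j true + R j false)
  split_ifs with hMi
  swap
  · simp only [add_zero, Finset.sum_const_zero, abs_zero]
    exact Finset.sum_nonneg fun j _ => add_nonneg (hR0 _ _) (hR0 _ _)
  -- `v` vanishes on the bottom and the top side, so the triangles there, which have no partner,
  -- contribute nothing.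
  have a0 : slopeX X Y v (i, 0, false) = 0 := by
    have hz : ∀ l ≤ N, v (X l, Y 0) = 0 := fun l hl => by
      refine h0 _ (mem_frontier_Omega.2 ⟨⟨hX.mem hl, hY.mem (Nat.zero_le _)⟩, ?_⟩)
      simp [hY.zero]
    rw [slopeX_false, hz _ hi'.le, hz _ hi', sub_zero, zero_div]
  have aN : slopeX X Y v (i, N, false) = 0 := by
    have hz : ∀ l ≤ N, v (X l, Y N) = 0 := fun l hl => by
      refine h0 _ (mem_frontier_Omega.2 ⟨⟨hX.mem hl, hY.mem le_rfl⟩, ?_⟩)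
      simp [hY.last]
    rw [slopeX_false, hz _ hi'.le, hz _ hi', sub_zero, zero_div]
  obtain ⟨m, rfl⟩ : ∃ m, N = m + 1 := Nat.exists_eq_succ_of_ne_zero (by omega)
  -- The row index is shifted by one: the upper triangle of row `j` and the lower triangle of row `j
  -- + 1` share a horizontal edge.
  have regroup : ∀ T F : ℕ → ℝ, ∑ j ∈ Finset.range (m + 1), (T j + F j) =
      ∑ j ∈ Finset.range m, (T j + F (j + 1)) + (T m + F 0) := by
    intro T F
    rw [Finset.sum_add_distrib, Finset.sum_range_succ T, Finset.sum_range_succ' F,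
      Finset.sum_add_distrib]
    ring
  rw [regroup (fun j => slopeX X Y v (i, j, true) * gradDefect X Y w (i, j, true))
    (fun j => slopeX X Y v (i, j, false) * gradDefect X Y w (i, j, false)),
    regroup (fun j => R j true) (fun j => R j false), slopeX_true, aN, a0]
  simp only [zero_mul, add_zero]
  refine (Finset.abs_sum_le_sum_abs _ _).trans (le_add_of_le_of_nonneg
    (Finset.sum_le_sum fun j hj => ?_) (add_nonneg (hR0 _ _) (hR0 _ _)))
  have hj' : j < m := Finset.mem_range.1 hj
  have k1 : (i, j + 1, false) ∈ triIndex (m + 1) := mem_triIndex.2 ⟨hi', by simp only; omega⟩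
  have k2 : (i, j, true) ∈ triIndex (m + 1) := mem_triIndex.2 ⟨hi', by simp only; omega⟩
  rw [slopeX_true, ← mul_add, abs_mul]
  -- At height `Y M` no paired estimate is assumed, since the step size may jump there; the two
  -- triangles are estimated singly, with weight `Q₂`.
  by_cases hjM : j + 1 = M
  · have st : ∀ k ∈ triIndex (m + 1), M ≤ k.1 → (∀ p ∈ otri X Y k,
        Y (M - 1) < p.2 ∧ p.2 < Y (M + 1)) → ∀ p ∈ otri X Y k,
        Q₂ ≤ {p : ℝ × ℝ | X M < p.1}.indicator (fun _ => Q₁) p +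
        {p : ℝ × ℝ | X M < p.1 ∧ Y (M - 1) < p.2 ∧ p.2 < Y (M + 1)}.indicator (fun _ => Q₂) p := by
      intro k hk hMk hb p hp
      have hx := (hXM k hk p hp).2 hMk
      rw [indicator_of_mem (show p ∈ {p : ℝ × ℝ | X M < p.1} from hx), indicator_of_mem
        (show p ∈ {p : ℝ × ℝ | X M < p.1 ∧ Y (M - 1) < p.2 ∧ p.2 < Y (M + 1)} from ⟨hx, hb p hp⟩)]
      linarith
    have r1 := eR _ k1 Q₂ (st _ k1 hMi fun p hp => by
      obtain ⟨-, -, b3, b4⟩ := otri_bounds hX hY hi' (show j + 1 < m + 1 by omega) hp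
      simp only at b3 b4
      rw [hjM] at b3 b4
      exact ⟨(hY.le (Nat.sub_le M 1) hM.le).trans_lt b3, b4⟩)
    have r2 := eR _ k2 Q₂ (st _ k2 hMi fun p hp => by
      obtain ⟨-, -, b3, b4⟩ := otri_bounds hX hY hi' (show j < m + 1 by omega) hp
      simp only at b3 b4
      rw [hjM] at b4
      rw [show M - 1 = j by omega]
      exact ⟨b3, b4.trans_le (hY.le (Nat.le_succ M) hM)⟩)
    rw [slopeX_true] at r2
    have d1 := H2 _ k1 hMi
    have d2 := H2 _ k2 hMi
    calc |slopeX X Y v (i, j + 1, false)| *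
          |gradDefect X Y w (i, j, true) + gradDefect X Y w (i, j + 1, false)|
        ≤ |slopeX X Y v (i, j + 1, false)| * (Q₂ * volume.real (otri X Y (i, j, true)) +
          Q₂ * volume.real (otri X Y (i, j + 1, false))) :=
          mul_le_mul_of_nonneg_left ((abs_add_le _ _).trans (add_le_add d2 d1)) (abs_nonneg _)
      _ ≤ R j true + R (j + 1) false := by rw [mul_add]; exact add_le_add r2 r1
  · have r1 := eR _ k1 Q₁ fun p hp => by
      rw [indicator_of_mem (show p ∈ {p : ℝ × ℝ | X M < p.1} from (hXM _ k1 p hp).2 hMi)]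
      exact le_add_of_nonneg_right (indicator_nonneg (fun _ _ => hQ₂) p)
    rw [add_comm (gradDefect X Y w (i, j, true))]
    refine (mul_le_mul_of_nonneg_left (H1 i j hMi hi' (by omega) hjM) (abs_nonneg _)).trans ?_
    exact r1.trans (le_add_of_nonneg_left (hR0 _ _))

end SDFEM

/-! ### Norms of layer functions, and an inverse estimate -/

namespace SDFEM

theorem integral_Ioo_exp_le {γ c : ℝ} (hγ : 0 < γ) (hc : 0 ≤ c) :
    ∫ x in Ioo 0 c, Real.exp (-(γ * (1 - x))) ≤ Real.exp (-(γ * (1 - c))) / γ := by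
  have h : ∫ x in (0 : ℝ)..c, Real.exp (-(γ * (1 - x))) =
      Real.exp (-(γ * (1 - c))) / γ - Real.exp (-(γ * (1 - 0))) / γ := by
    refine intervalIntegral.integral_eq_sub_of_hasDerivAt
      (f := fun x => Real.exp (-(γ * (1 - x))) / γ) (fun x _ => ?_)
      (Continuous.intervalIntegrable (by fun_prop) _ _)
    have h1 : HasDerivAt (fun x : ℝ => -(γ * (1 - x))) γ x := by
      exact ((((hasDerivAt_id x).const_sub 1).const_mul γ).neg).congr_deriv (by ring)
    have h2 := h1.exp.div_const γ
    rwa [mul_div_assoc, div_self hγ.ne', mul_one] at h2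
  rw [intervalIntegral.integral_of_le hc, integral_Ioc_eq_integral_Ioo] at h
  rw [h]
  have : 0 < Real.exp (-(γ * (1 - 0))) / γ := by positivity
  linarith

/-- The norm of `L²(0,1)`. -/
noncomputable def nrm1 (φ : ℝ → ℝ) : ℝ := Real.sqrt (∫ x in Ioo (0 : ℝ) 1, φ x ^ 2)

theorem nrm1_nonneg (φ : ℝ → ℝ) : 0 ≤ nrm1 φ := Real.sqrt_nonneg _

theorem integral_Omega_prod (φ ψ : ℝ → ℝ) : ∫ p in Omega, φ p.1 * ψ p.2 =
    (∫ x in Ioo (0 : ℝ) 1, φ x) * ∫ y in Ioo (0 : ℝ) 1, ψ y :=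
  setIntegral_prod_mul φ ψ (Ioo (0 : ℝ) 1) (Ioo (0 : ℝ) 1)

theorem nrm_prod (φ ψ : ℝ → ℝ) : nrm (fun p => φ p.1 * ψ p.2) = nrm1 φ * nrm1 ψ := by
  simp only [nrm, mul_pow]
  rw [integral_Omega_prod (fun x => φ x ^ 2) (fun y => ψ y ^ 2), Real.sqrt_mul
    (integral_nonneg fun x => sq_nonneg _)]
  rfl

theorem nrm1_one : nrm1 (fun _ => 1) = 1 := by
  simp [nrm1]

theorem nrm1_indicator_Ioo_le {a b : ℝ} (hab : a ≤ b) :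
    nrm1 ((Ioo a b).indicator fun _ => 1) ≤ Real.sqrt (b - a) := by
  refine Real.sqrt_le_sqrt ?_
  have : (fun x => ((Ioo a b).indicator (fun _ => (1 : ℝ)) x) ^ 2) =
      (Ioo a b).indicator fun _ => 1 := by
    ext x
    by_cases hx : x ∈ Ioo a b <;> simp [hx]
  rw [this, setIntegral_indicator measurableSet_Ioo, setIntegral_const, smul_eq_mul, mul_one]
  calc volume.real (Ioo (0 : ℝ) 1 ∩ Ioo a b) ≤ volume.real (Ioo a b) :=
        measureReal_mono inter_subset_right (by simp)
    _ = b - a := by rw [Real.volume_real_Ioo_of_le hab]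

theorem nrm1_exp_le {γ c : ℝ} (hγ : 0 < γ) (hc : 0 ≤ c) (hc1 : c ≤ 1) :
    nrm1 ((Ioo 0 c).indicator fun x => Real.exp (-(γ * (1 - x)))) ≤
      Real.exp (-(γ * (1 - c))) / Real.sqrt (2 * γ) := by
  have e : (fun x => ((Ioo 0 c).indicator (fun x => Real.exp (-(γ * (1 - x)))) x) ^ 2) =
      (Ioo 0 c).indicator fun x => Real.exp (-(2 * γ * (1 - x))) := by
    ext x
    by_cases hx : x ∈ Ioo 0 c
    · simp only [hx, indicator_of_mem, ← Real.exp_nat_mul]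
      congr 1
      push_cast
      ring
    · simp [hx]
  rw [nrm1, e, setIntegral_indicator measurableSet_Ioo,
    inter_eq_right.2 (Ioo_subset_Ioo_right hc1)]
  refine (Real.sqrt_le_sqrt (integral_Ioo_exp_le (by positivity : 0 < 2 * γ) hc)).trans_eq ?_
  rw [Real.sqrt_div (Real.exp_pos _).le]
  congr 1
  rw [Real.sqrt_eq_iff_mul_self_eq (Real.exp_pos _).le (Real.exp_pos _).le, ← Real.exp_add]
  congr 1
  ring

theorem integral_exp_Omega_le {γ c : ℝ} (hγ : 0 < γ) (hc : 0 ≤ c) (hc1 : c ≤ 1) :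
    ∫ p in Omega, (Ioo 0 c).indicator (fun x => Real.exp (-(γ * (1 - x)))) p.1 ≤
      Real.exp (-(γ * (1 - c))) / γ := by
  have h := integral_Omega_prod ((Ioo 0 c).indicator fun x => Real.exp (-(γ * (1 - x))))
    (fun _ => 1)
  simp only [mul_one] at h
  rw [h, setIntegral_indicator measurableSet_Ioo, inter_eq_right.2 (Ioo_subset_Ioo_right hc1)]
  simpa using integral_Ioo_exp_le hγ hc

theorem bd_fst_indicator {φ : ℝ → ℝ} (hφ : Continuous φ) {I : Set ℝ} (hI : MeasurableSet I) :
    Bd fun p => I.indicator φ p.1 := by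
  have h : Bd ((Prod.fst ⁻¹' I : Set (ℝ × ℝ)).indicator fun p => φ p.1) :=
    (bd_of_continuousOn (hφ.comp continuous_fst).continuousOn).indicator (measurable_fst hI)
  exact h

theorem bd_snd_indicator {φ : ℝ → ℝ} (hφ : Continuous φ) {I : Set ℝ} (hI : MeasurableSet I) :
    Bd fun p => I.indicator φ p.2 := (bd_fst_indicator hφ hI).swap

/-- Points at relative distance less than `r` along a leg, whatever its sign. A product of two such
intervals is the rectangle used in the inverse estimate. -/
theorem exists_interval_of_leg {x₀ h : ℝ} (hh : h ≠ 0) {r : ℝ} (hr : 0 < r) :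
    ∃ a b : ℝ, a ≤ b ∧ b - a = r * |h| ∧ ∀ x ∈ Ioo a b, 0 < (x - x₀) / h ∧ (x - x₀) / h < r := by
  rcases lt_or_gt_of_ne hh with hneg | hpos
  · refine ⟨x₀ + r * h, x₀, by nlinarith, by rw [abs_of_neg hneg]; ring, fun x hx => ⟨?_, ?_⟩⟩
    · exact div_pos_of_neg_of_neg (by linarith [hx.2]) hneg
    · rw [div_lt_iff_of_neg hneg]; linarith [hx.1]
  · refine ⟨x₀, x₀ + r * h, by nlinarith, by rw [abs_of_pos hpos]; ring, fun x hx => ⟨?_, ?_⟩⟩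
    · exact div_pos (by linarith [hx.1]) hpos
    · rw [div_lt_iff₀ hpos]; linarith [hx.2]

/-- Inverse estimate for an affine function on a triangle. -/
theorem inverse_estimate_affine {x₀ y₀ h k : ℝ} (hh : h ≠ 0) (hk : k ≠ 0)
    (hT : openTri x₀ y₀ h k ⊆ Omega) (c₀ c₁ c₂ : ℝ) :
    c₁ ^ 2 * |h| ^ 3 * |k| ≤
      512 * ∫ p in openTri x₀ y₀ h k, (c₀ + c₁ * p.1 + c₂ * p.2) ^ 2 := by
  -- A rectangle of relative width ¼ and relative height ½ stays in the triangle when it is moved by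
  -- a quarter of the leg, because ¼ + ¼ + ½ = 1.
  obtain ⟨a, b, hab, hba, hI⟩ := exists_interval_of_leg (x₀ := x₀) hh (show (0 : ℝ) < 1 / 4 by norm_num)
  obtain ⟨a', b', hab', hba', hJ⟩ :=
    exists_interval_of_leg (x₀ := y₀) hk (show (0 : ℝ) < 1 / 2 by norm_num)
  set ℓ : ℝ × ℝ → ℝ := fun p => c₀ + c₁ * p.1 + c₂ * p.2 with hℓ
  have hc : Continuous ℓ := by fun_prop
  set T := openTri x₀ y₀ h k with hTdef
  set q : Set (ℝ × ℝ) := Ioo a b ×ˢ Ioo a' b' with hq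
  set d : ℝ × ℝ := (h / 4, 0) with hd
  have hqT : q ⊆ T := by
    rintro p ⟨hp1, hp2⟩
    obtain ⟨u1, u2⟩ := hI _ hp1
    obtain ⟨v1, v2⟩ := hJ _ hp2
    exact ⟨u1, v1, by linarith⟩
  have hqT' : ∀ p ∈ q, p + d ∈ T := by
    rintro p ⟨hp1, hp2⟩
    obtain ⟨u1, u2⟩ := hI _ hp1
    obtain ⟨v1, v2⟩ := hJ _ hp2
    have e1 : ((p + d).1 - x₀) / h = (p.1 - x₀) / h + 1 / 4 := by
      simp only [hd, Prod.fst_add]; field_simp; ring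
    have e2 : ((p + d).2 - y₀) / k = (p.2 - y₀) / k := by simp [hd]
    refine ⟨?_, ?_, ?_⟩
    · rw [e1]; linarith
    · rw [e2]; exact v1
    · rw [e1, e2]; linarith
  have hqm : MeasurableSet q := measurableSet_Ioo.prod measurableSet_Ioo
  have hTm : MeasurableSet T := (isOpen_openTri _ _ _ _).measurableSet
  have intT : IntegrableOn (fun p => ℓ p ^ 2) T :=
    ((hc.pow 2).continuousOn.integrableOn_compact isCompact_OmegaBar).mono_set
      (hT.trans Omega_subset_OmegaBar)
  have intq : IntegrableOn (fun p => ℓ p ^ 2) q := intT.mono_set hqT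
  set s : Set (ℝ × ℝ) := (fun p => p - d) ⁻¹' q with hs
  have hsT : s ⊆ T := fun p hp => by
    have := hqT' _ hp
    simpa using this
  have ints : IntegrableOn (fun p => ℓ p ^ 2) s := intT.mono_set hsT
  have hpre : (fun p : ℝ × ℝ => p + d) ⁻¹' s = q := by
    ext p; simp [hs]
  have hmp : MeasurePreserving (fun p : ℝ × ℝ => p + d) volume volume :=
    measurePreserving_add_right volume d
  have hemb : MeasurableEmbedding (fun p : ℝ × ℝ => p + d) := measurableEmbedding_addRight d
  have shift : ∫ p in q, ℓ (p + d) ^ 2 = ∫ p in s, ℓ p ^ 2 := by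
    rw [← hpre]
    exact hmp.setIntegral_preimage_emb hemb (fun p => ℓ p ^ 2) s
  have intshift : IntegrableOn (fun p => ℓ (p + d) ^ 2) q := by
    rw [← hpre]
    exact (hmp.integrableOn_comp_preimage hemb).2 ints
  have n1 : ∫ p in q, ℓ p ^ 2 ≤ ∫ p in T, ℓ p ^ 2 :=
    setIntegral_mono_set intT (Filter.Eventually.of_forall fun p => sq_nonneg _)
      hqT.eventuallyLE
  have n2 : ∫ p in s, ℓ p ^ 2 ≤ ∫ p in T, ℓ p ^ 2 :=
    setIntegral_mono_set intT (Filter.Eventually.of_forall fun p => sq_nonneg _)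
      hsT.eventuallyLE
  have vol : volume.real q = 1 / 4 * |h| * (1 / 2 * |k|) := by
    rw [hq, Measure.volume_eq_prod, measureReal_prod_prod, Real.volume_real_Ioo_of_le hab,
      Real.volume_real_Ioo_of_le hab', hba, hba']
  have hfin : volume q < ⊤ := (measure_mono ((hqT.trans hT).trans Omega_subset_OmegaBar)).trans_lt
    isCompact_OmegaBar.measure_lt_top
  -- The values at `p + d` and `p` differ by exactly `c₁ h / 4`, and (s - t)² ≤ 2s² + 2t². The
  -- rectangle has area |h||k|/8 and each integral is at most that over the triangle, so the
  -- constant is 16 · 8 · 4 = 512.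
  have main : (c₁ * (h / 4)) ^ 2 * volume.real q ≤
      2 * (∫ p in q, ℓ (p + d) ^ 2) + 2 * ∫ p in q, ℓ p ^ 2 := by
    rw [← integral_const_mul, ← integral_const_mul,
      ← integral_add (intshift.const_mul 2) (intq.const_mul 2), mul_comm, ← smul_eq_mul,
      ← setIntegral_const]
    refine setIntegral_mono_on (integrableOn_const hfin.ne) ((intshift.const_mul 2).add
      (intq.const_mul 2)) hqm fun p _ => ?_
    have : c₁ * (h / 4) = ℓ (p + d) - ℓ p := by
      simp only [hℓ, hd, Prod.fst_add, Prod.snd_add]; ring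
    rw [this]
    nlinarith [sq_nonneg (ℓ (p + d) + ℓ p)]
  rw [shift, vol] at main
  have habs : |h| ^ 3 = h ^ 2 * |h| := by rw [pow_succ, sq_abs]
  rw [habs]
  have e : (c₁ * (h / 4)) ^ 2 * (1 / 4 * |h| * (1 / 2 * |k|)) =
      c₁ ^ 2 * (h ^ 2 * |h|) * |k| / 128 := by ring
  rw [e] at main
  linarith

theorem inverse_estimate_fst {N : ℕ} {X Y : ℕ → ℝ} (hX : IsGrid N X) (hY : IsGrid N Y)
    {v : ℝ × ℝ → ℝ} (hv : IsPL N X Y v) {k : ℕ × ℕ × Bool} (hk : k ∈ triIndex N) :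
    slopeX X Y v k ^ 2 * (X (k.1 + 1) - X k.1) ^ 3 * (Y (k.2.1 + 1) - Y k.2.1) ≤
      512 * nrm v ^ 2 := by
  obtain ⟨h1, h2⟩ := mem_triIndex.1 hk
  have l1 := leg_ne_zero hX h1 k.2.2
  have l2 := leg_ne_zero hY h2 k.2.2
  have hT := otri_subset_Omega hX hY hk
  have key := inverse_estimate_affine l1 l2 hT (v (corner X k.1 k.2.2, corner Y k.2.1 k.2.2)
    - slopeX X Y v k * corner X k.1 k.2.2 - slopeY X Y v k * corner Y k.2.1 k.2.2)
    (slopeX X Y v k) (slopeY X Y v k)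
  rw [abs_leg hX h1, abs_leg hY h2] at key
  refine key.trans (mul_le_mul_of_nonneg_left ?_ (by norm_num))
  rw [nrm_sq]
  have e : ∫ p in otri X Y k, (v (corner X k.1 k.2.2, corner Y k.2.1 k.2.2)
      - slopeX X Y v k * corner X k.1 k.2.2 - slopeY X Y v k * corner Y k.2.1 k.2.2
      + slopeX X Y v k * p.1 + slopeY X Y v k * p.2) ^ 2 = ∫ p in otri X Y k, v p ^ 2 := by
    refine setIntegral_congr_fun (measurableSet_otri k) fun p hp => ?_
    rw [hv.eq_loc hX hY hk hp, loc, affInterp, slopeX, slopeY]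
    ring
  refine e.le.trans (setIntegral_mono_set (bd_of_continuousOn hv.cont).pow_two.integrable
    (Filter.Eventually.of_forall fun p => sq_nonneg _) hT.eventuallyLE)

theorem IsPL.swap {N : ℕ} {X Y : ℕ → ℝ} {v : ℝ × ℝ → ℝ} (hv : IsPL N X Y v) :
    IsPL N Y X (v ∘ Prod.swap) where
  cont := hv.cont.comp continuous_swap.continuousOn fun _ hp => swap_mem_OmegaBar.2 hp
  affine k hk := by
    obtain ⟨a₀, a₁, a₂, h⟩ := hv.affine (k.2.1, k.1, k.2.2) (mem_triIndex.2 (mem_triIndex.1 hk).symm)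
    refine ⟨a₀, a₂, a₁, fun p hp => ?_⟩
    have hp' : p.swap ∈ ctri X Y (k.2.1, k.1, k.2.2) := by
      have himg : ctri X Y (k.2.1, k.1, k.2.2) = Prod.swap '' ctri Y X k := by
        rw [ctri_eq, ctri_eq]
        have hl : IsLinearMap ℝ (Prod.swap : ℝ × ℝ → ℝ × ℝ) := ⟨fun _ _ => rfl, fun _ _ => rfl⟩
        rw [hl.image_convexHull]
        congr 1
        ext p
        simp only [image_insert_eq, image_singleton, Prod.swap_prod_mk, mem_insert_iff,
          mem_singleton_iff]
        tauto
      rw [himg]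
      exact mem_image_of_mem _ hp
    rw [Function.comp_apply, h _ hp', Prod.fst_swap, Prod.snd_swap]
    ring

theorem nrm_swap (F : ℝ × ℝ → ℝ) : nrm (F ∘ Prod.swap) = nrm F := by
  simp only [nrm, Function.comp_apply]
  rw [integral_swap fun p => F p ^ 2]

end SDFEM

/-! ### Interchange of the variables -/

namespace SDFEM

section swap

theorem contDiffOn_pdy_nat {f : ℝ × ℝ → ℝ} {n : ℕ} (hf : ContDiffOn ℝ (n + 1 : ℕ) f OmegaBar) :
    ContDiffOn ℝ n (pdy f) OmegaBar := contDiffOn_pdy hf (by push_cast; rfl)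

theorem contDiffOn_pdx_nat {f : ℝ × ℝ → ℝ} {n : ℕ} (hf : ContDiffOn ℝ (n + 1 : ℕ) f OmegaBar) :
    ContDiffOn ℝ n (pdx f) OmegaBar := contDiffOn_pdx hf (by push_cast; rfl)

theorem iterate_pdx_congr {f g : ℝ × ℝ → ℝ} (h : EqOn f g OmegaBar) (i : ℕ) :
    EqOn (pdx^[i] f) (pdx^[i] g) OmegaBar := by
  induction i generalizing f g with
  | zero => exact h
  | succ i ih => exact ih (pdx_congr h)

theorem iterate_pdy_congr {f g : ℝ × ℝ → ℝ} (h : EqOn f g OmegaBar) (j : ℕ) :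
    EqOn (pdy^[j] f) (pdy^[j] g) OmegaBar := by
  induction j generalizing f g with
  | zero => exact h
  | succ j ih => exact ih (pdy_congr h)

theorem pdx_iterate_pdy {f : ℝ × ℝ → ℝ} (j : ℕ) (hf : ContDiffOn ℝ (j + 1 : ℕ) f OmegaBar) :
    EqOn (pdx (pdy^[j] f)) (pdy^[j] (pdx f)) OmegaBar := by
  induction j generalizing f with
  | zero => exact fun _ _ => rfl
  | succ j ih =>
    have h2 : ContDiffOn ℝ 2 f OmegaBar :=
      hf.of_le (by exact_mod_cast (show 2 ≤ j + 1 + 1 by omega))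
    exact (ih (contDiffOn_pdy_nat hf)).trans (iterate_pdy_congr (pdx_pdy_comm h2) j)

/-- Higher mixed derivatives commute on the closed square. -/
theorem iterate_pdx_iterate_pdy {f : ℝ × ℝ → ℝ} (i j : ℕ)
    (hf : ContDiffOn ℝ (i + j : ℕ) f OmegaBar) :
    EqOn (pdx^[i] (pdy^[j] f)) (pdy^[j] (pdx^[i] f)) OmegaBar := by
  induction i generalizing f with
  | zero => exact fun _ _ => rfl
  | succ i ih =>
    have h1 : ContDiffOn ℝ (i + j : ℕ) (pdx f) OmegaBar :=
      contDiffOn_pdx_nat (by rwa [show i + 1 + j = i + j + 1 by ring] at hf)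
    have h2 : ContDiffOn ℝ (j + 1 : ℕ) f OmegaBar :=
      hf.of_le (by exact_mod_cast (show j + 1 ≤ i + 1 + j by omega))
    exact (iterate_pdx_congr (pdx_iterate_pdy j h2) i).trans (ih h1)

theorem iterate_pdx_swap (f : ℝ × ℝ → ℝ) (i : ℕ) :
    pdx^[i] (f ∘ Prod.swap) = (pdy^[i] f) ∘ Prod.swap := by
  induction i generalizing f with
  | zero => rfl
  | succ i ih => exact ih (pdy f)

theorem iterate_pdy_swap (f : ℝ × ℝ → ℝ) (i : ℕ) :
    pdy^[i] (f ∘ Prod.swap) = (pdx^[i] f) ∘ Prod.swap := by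
  induction i generalizing f with
  | zero => rfl
  | succ i ih => exact ih (pdx f)

/-- The coefficients after interchanging the variables. -/
def Coeffs.swap (P : Coeffs) : Coeffs where
  b₁ := P.b₂ ∘ Prod.swap
  b₂ := P.b₁ ∘ Prod.swap
  c := P.c ∘ Prod.swap
  β₁ := P.β₂
  β₂ := P.β₁
  μ₀ := P.μ₀

variable {P : Coeffs} {ε : ℝ} {N : ℕ}

theorem Coeffs.Admissible.swap (hP : P.Admissible) : P.swap.Admissible where
  smooth_b₁ := contDiffOn_swap hP.smooth_b₂
  smooth_b₂ := contDiffOn_swap hP.smooth_b₁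
  cont_c := hP.cont_c.comp continuous_swap.continuousOn fun _ hp => swap_mem_OmegaBar.2 hp
  β₁_pos := hP.β₂_pos
  β₂_pos := hP.β₁_pos
  μ₀_pos := hP.μ₀_pos
  b₁_ge p hp := hP.b₂_ge _ (swap_mem_OmegaBar.2 hp)
  b₂_ge p hp := hP.b₁_ge _ (swap_mem_OmegaBar.2 hp)
  c_nonneg p hp := hP.c_nonneg _ (swap_mem_OmegaBar.2 hp)
  c_sub_div_ge p hp := by
    have := hP.c_sub_div_ge _ (swap_mem_OmegaBar.2 hp)
    rw [add_comm] at this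
    exact this

theorem MeshAssumption.swap (hM : MeshAssumption P ε N) : MeshAssumption P.swap ε N where
  four_le := hM.four_le
  even := hM.even
  ε_pos := hM.ε_pos
  ε_le := hM.ε_le
  transition_x := hM.transition_y
  transition_y := hM.transition_x

/-- Swapping reverses the order of the x- and y-derivatives, whereas the layer bounds fix one order;
commutation restores it, and this is where the smoothness enters. -/
theorem bound_swap {f : ℝ × ℝ → ℝ} {i j n : ℕ} (hij : i + j ≤ n)
    (hf : ContDiffOn ℝ n f OmegaBar) {p : ℝ × ℝ} (hp : p ∈ OmegaBar) :
    (pdx^[i] (pdy^[j] (f ∘ Prod.swap))) p = (pdx^[j] (pdy^[i] f)) p.swap := by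
  rw [iterate_pdy_swap, iterate_pdx_swap, Function.comp_apply]
  refine (iterate_pdx_iterate_pdy j i (hf.of_le ?_) (swap_mem_OmegaBar.2 hp)).symm
  exact_mod_cast (show j + i ≤ n by omega)

/-- E₁ and E₂ exchange their roles. Estimates proved for the x-derivative and the layer at x = 1
thereby apply to y. -/
theorem IsLayerDecomposition.swap {A : ℝ} {u S E₁ E₂ E₁₂ : ℝ × ℝ → ℝ}
    (h : IsLayerDecomposition P ε A u S E₁ E₂ E₁₂) :
    IsLayerDecomposition P.swap ε A (u ∘ Prod.swap) (S ∘ Prod.swap) (E₂ ∘ Prod.swap)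
      (E₁ ∘ Prod.swap) (E₁₂ ∘ Prod.swap) where
  smooth_S := contDiffOn_swap h.smooth_S
  smooth_E₁ := contDiffOn_swap h.smooth_E₂
  smooth_E₂ := contDiffOn_swap h.smooth_E₁
  smooth_E₁₂ := contDiffOn_swap h.smooth_E₁₂
  decomp p hp := by
    have := h.decomp _ (swap_mem_OmegaBar.2 hp)
    simp only [Function.comp_apply]
    linarith
  bound_S i j hij p hp := by
    rw [bound_swap hij (by exact_mod_cast h.smooth_S) hp]
    exact h.bound_S j i (by omega) _ (swap_mem_OmegaBar.2 hp)
  bound_E₁ i j hij p hp := by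
    rw [bound_swap hij (by exact_mod_cast h.smooth_E₂) hp]
    exact h.bound_E₂ j i (by omega) _ (swap_mem_OmegaBar.2 hp)
  bound_E₂ i j hij p hp := by
    rw [bound_swap hij (by exact_mod_cast h.smooth_E₁) hp]
    exact h.bound_E₁ j i (by omega) _ (swap_mem_OmegaBar.2 hp)
  bound_E₁₂ i j hij p hp := by
    rw [bound_swap hij (by exact_mod_cast h.smooth_E₁₂) hp, add_comm i j]
    have := h.bound_E₁₂ j i (by omega) _ (swap_mem_OmegaBar.2 hp)
    rw [add_comm (P.β₁ * _)] at this
    exact this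

end swap

/-! ### Interpolation errors on mesh cells -/

section cell

/-- The closed mesh rectangle that contains a mesh triangle. -/
def cell (X Y : ℕ → ℝ) (k : ℕ × ℕ × Bool) : Set (ℝ × ℝ) :=
  Icc (X k.1) (X (k.1 + 1)) ×ˢ Icc (Y k.2.1) (Y (k.2.1 + 1))

variable {N : ℕ} {X Y : ℕ → ℝ} {k : ℕ × ℕ × Bool} {w : ℝ × ℝ → ℝ}

theorem cell_subset (hX : IsGrid N X) (hY : IsGrid N Y) (hk : k ∈ triIndex N) :
    cell X Y k ⊆ OmegaBar := by
  obtain ⟨h1, h2⟩ := mem_triIndex.1 hk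
  exact prod_mono (Icc_subset_Icc (hX.mem h1.le).1 (hX.mem h1).2)
    (Icc_subset_Icc (hY.mem h2.le).1 (hY.mem h2).2)

theorem otri_subset_cell (hX : IsGrid N X) (hY : IsGrid N Y) (hk : k ∈ triIndex N) :
    otri X Y k ⊆ cell X Y k := by
  obtain ⟨h1, h2⟩ := mem_triIndex.1 hk
  intro p hp
  obtain ⟨b1, b2, b3, b4⟩ := otri_bounds hX hY h1 h2 hp
  exact ⟨⟨b1.le, b2.le⟩, ⟨b3.le, b4.le⟩⟩

theorem vertex_mem_cell (hX : IsGrid N X) (hY : IsGrid N Y) (hk : k ∈ triIndex N) :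
    (corner X k.1 k.2.2, corner Y k.2.1 k.2.2) ∈ cell X Y k ∧
    (corner X k.1 k.2.2 + leg X k.1 k.2.2, corner Y k.2.1 k.2.2) ∈ cell X Y k ∧
    (corner X k.1 k.2.2, corner Y k.2.1 k.2.2 + leg Y k.2.1 k.2.2) ∈ cell X Y k := by
  obtain ⟨h1, h2⟩ := mem_triIndex.1 hk
  rw [cell, ← uIcc_corner hX h1 k.2.2, ← uIcc_corner hY h2 k.2.2]
  exact ⟨⟨left_mem_uIcc, left_mem_uIcc⟩, ⟨right_mem_uIcc, left_mem_uIcc⟩,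
    ⟨left_mem_uIcc, right_mem_uIcc⟩⟩

/-- Bounds on the whole rectangle are required because the increments are taken along paths parallel
to the axes, which need not stay in the triangle. -/
theorem slopeX_err (hX : IsGrid N X) (hY : IsGrid N Y) (hk : k ∈ triIndex N)
    (hw : ContDiffOn ℝ 2 w OmegaBar) {M₁ M₂ : ℝ}
    (h₁ : ∀ q ∈ cell X Y k, |pdx (pdx w) q| ≤ M₁) (h₂ : ∀ q ∈ cell X Y k, |pdx (pdy w) q| ≤ M₂)
    {p : ℝ × ℝ} (hp : p ∈ cell X Y k) :
    |slopeX X Y w k - pdx w p| ≤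
      M₁ * (X (k.1 + 1) - X k.1) + M₂ * (Y (k.2.1 + 1) - Y k.2.1) := by
  obtain ⟨h1, h2⟩ := mem_triIndex.1 hk
  rw [← abs_leg hX h1 k.2.2, ← abs_leg hY h2 k.2.2]
  rw [cell, ← uIcc_corner hX h1 k.2.2, ← uIcc_corner hY h2 k.2.2] at hp h₁ h₂
  exact grad_fst_err hw (leg_ne_zero hX h1 _) (corner_mem hX h1 _) (corner_add_leg_mem hX h1 _)
    (corner_mem hY h2 _) (corner_add_leg_mem hY h2 _) (fun x hx y hy => h₁ _ ⟨hx, hy⟩)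
    (fun x hx y hy => h₂ _ ⟨hx, hy⟩) hp.1 hp.2

theorem abs_slopeX_le (hX : IsGrid N X) (hY : IsGrid N Y) (hk : k ∈ triIndex N)
    (hw : ContDiffOn ℝ 1 w OmegaBar) {M : ℝ} (h : ∀ q ∈ cell X Y k, |pdx w q| ≤ M) :
    |slopeX X Y w k| ≤ M := by
  obtain ⟨h1, h2⟩ := mem_triIndex.1 hk
  rw [cell, ← uIcc_corner hX h1 k.2.2, ← uIcc_corner hY h2 k.2.2] at h
  have := slope_fst_le hw (leg_ne_zero hX h1 k.2.2) (M := M) (α := 0) (corner_mem hX h1 k.2.2)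
    (corner_add_leg_mem hX h1 k.2.2) (corner_mem hY h2 k.2.2)
    (fun x hx => by rw [sub_zero]; exact h _ ⟨hx, left_mem_uIcc⟩)
  rwa [sub_zero] at this

/-- Meant for coarse cells, where a layer function is tiny but its derivative carries ε⁻¹: dividing
values by the step costs only a factor `N`. -/
theorem abs_slopeX_le_div (hX : IsGrid N X) (hY : IsGrid N Y) (hk : k ∈ triIndex N) {M : ℝ}
    (h : ∀ q ∈ cell X Y k, |w q| ≤ M) : |slopeX X Y w k| ≤ 2 * M / (X (k.1 + 1) - X k.1) := by
  obtain ⟨h1, h2⟩ := mem_triIndex.1 hk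
  obtain ⟨v0, v1, -⟩ := vertex_mem_cell hX hY hk
  rw [slopeX, abs_div, abs_leg hX h1]
  have := hX.lt _ h1
  refine div_le_div_of_nonneg_right ?_ (by linarith)
  refine (abs_sub _ _).trans ?_
  linarith [h _ v0, h _ v1]

theorem loc_err (hX : IsGrid N X) (hY : IsGrid N Y) (hk : k ∈ triIndex N)
    (hw : ContDiffOn ℝ 2 w OmegaBar) {M₁ M₂ M₃ : ℝ}
    (h₁ : ∀ q ∈ cell X Y k, |pdx (pdx w) q| ≤ M₁) (h₂ : ∀ q ∈ cell X Y k, |pdx (pdy w) q| ≤ M₂)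
    (h₃ : ∀ q ∈ cell X Y k, |pdy (pdy w) q| ≤ M₃) {p : ℝ × ℝ} (hp : p ∈ otri X Y k) :
    |loc X Y w k p - w p| ≤
      (M₁ * (X (k.1 + 1) - X k.1) + M₂ * (Y (k.2.1 + 1) - Y k.2.1)) * (X (k.1 + 1) - X k.1)
      + (M₂ * (X (k.1 + 1) - X k.1) + M₃ * (Y (k.2.1 + 1) - Y k.2.1))
        * (Y (k.2.1 + 1) - Y k.2.1) := by
  obtain ⟨h1, h2⟩ := mem_triIndex.1 hk
  rw [← abs_leg hX h1 k.2.2, ← abs_leg hY h2 k.2.2]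
  rw [cell, ← uIcc_corner hX h1 k.2.2, ← uIcc_corner hY h2 k.2.2] at h₁ h₂ h₃
  exact interp_err hw (leg_ne_zero hX h1 _) (leg_ne_zero hY h2 _) (corner_mem hX h1 _)
    (corner_add_leg_mem hX h1 _) (corner_mem hY h2 _) (corner_add_leg_mem hY h2 _)
    (fun x hx y hy => h₁ _ ⟨hx, hy⟩) (fun x hx y hy => h₂ _ ⟨hx, hy⟩)
    (fun x hx y hy => h₃ _ ⟨hx, hy⟩) hp

theorem loc_err_of_le (hX : IsGrid N X) (hY : IsGrid N Y) (hk : k ∈ triIndex N) {M : ℝ}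
    (h : ∀ q ∈ cell X Y k, |w q| ≤ M) {p : ℝ × ℝ} (hp : p ∈ otri X Y k) :
    |loc X Y w k p - w p| ≤ 2 * M := by
  obtain ⟨v0, v1, v2⟩ := vertex_mem_cell hX hY hk
  have h1 := abs_affInterp_le (h _ v0) (h _ v1) (h _ v2) hp
  have h2 := h p (otri_subset_cell hX hY hk hp)
  have h3 := abs_sub (loc X Y w k p) (w p)
  simp only [loc] at h3 ⊢
  linarith

theorem loc_swap (X Y : ℕ → ℝ) (w : ℝ × ℝ → ℝ) (k : ℕ × ℕ × Bool) (p : ℝ × ℝ) :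
    loc Y X (w ∘ Prod.swap) (k.2.1, k.1, k.2.2) p.swap = loc X Y w k p := by
  simp only [loc, affInterp, Function.comp_apply, Prod.swap_prod_mk, Prod.fst_swap, Prod.snd_swap]
  ring

end cell

end SDFEM

/-! ### Layer functions on the mesh; gradient errors of the components -/

namespace SDFEM

/-- The boundary layer function in the `x` direction. -/
noncomputable def expX (P : Coeffs) (ε x : ℝ) : ℝ := Real.exp (-(P.β₁ * (1 - x)) / ε)

/-- The size `N ^ (-5/2)` of the layer functions outside the layers. -/
noncomputable def tau (N : ℕ) : ℝ := Real.exp (-(5 / 2 * Real.log N))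

/-- The ratio `ln N / N`. -/
noncomputable def logDiv (N : ℕ) : ℝ := Real.log N / N

section basic

variable {P : Coeffs} {ε : ℝ} {N : ℕ}

theorem MeshAssumption.cast_pos (hM : MeshAssumption P ε N) : (0 : ℝ) < N := by
  exact_mod_cast (show 0 < N by have := hM.four_le; omega)

theorem MeshAssumption.one_le_log (hM : MeshAssumption P ε N) : 1 ≤ Real.log N := by
  rw [Real.le_log_iff_exp_le hM.cast_pos]
  have h1 := Real.exp_one_lt_d9
  have h2 : (4 : ℝ) ≤ N := by exact_mod_cast hM.four_le
  linarith

theorem MeshAssumption.inv_le_logDiv (hM : MeshAssumption P ε N) : 1 / (N : ℝ) ≤ logDiv N :=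
  div_le_div_of_nonneg_right hM.one_le_log hM.cast_pos.le

theorem MeshAssumption.logDiv_pos (hM : MeshAssumption P ε N) : 0 < logDiv N :=
  lt_of_lt_of_le (by have := hM.cast_pos; positivity) hM.inv_le_logDiv

theorem MeshAssumption.logDiv_le_one (hM : MeshAssumption P ε N) : logDiv N ≤ 1 := by
  rw [logDiv, div_le_one hM.cast_pos]
  exact (Real.log_le_sub_one_of_pos hM.cast_pos).trans (by linarith)

theorem tau_pos (N : ℕ) : 0 < tau N := Real.exp_pos _

theorem MeshAssumption.tau_mul_sq_le (hM : MeshAssumption P ε N) : tau N * (N : ℝ) ^ 2 ≤ 1 := by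
  have h : (N : ℝ) ^ 2 = Real.exp (2 * Real.log N) := by
    rw [mul_comm, Real.exp_mul, Real.exp_log hM.cast_pos]
    norm_cast
  rw [h, tau, ← Real.exp_add, Real.exp_le_one_iff]
  linarith [hM.one_le_log]

theorem MeshAssumption.tau_mul_le (hM : MeshAssumption P ε N) : tau N * N ≤ logDiv N := by
  refine le_trans ?_ hM.inv_le_logDiv
  rw [le_div_iff₀ hM.cast_pos]
  have := hM.tau_mul_sq_le
  linarith [sq (N : ℝ), mul_assoc (tau N) N N]

theorem MeshAssumption.tau_le (hM : MeshAssumption P ε N) : tau N ≤ logDiv N := by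
  refine le_trans ?_ hM.tau_mul_le
  refine le_mul_of_one_le_right (tau_pos N).le ?_
  exact_mod_cast (show 1 ≤ N by have := hM.four_le; omega)

theorem MeshAssumption.ε_le_logDiv (hM : MeshAssumption P ε N) : ε ≤ logDiv N :=
  hM.ε_le.trans (by rw [← one_div]; exact hM.inv_le_logDiv)

theorem MeshAssumption.ε_le_one (hM : MeshAssumption P ε N) : ε ≤ 1 :=
  hM.ε_le_logDiv.trans hM.logDiv_le_one

theorem meshX_half (hM : MeshAssumption P ε N) :
    meshX P ε N (N / 2) = 1 - transition P.β₁ ε N :=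
  node_half (by have := hM.four_le; omega) hM.even

theorem stepX_le (hM : MeshAssumption P ε N) (hP : P.Admissible) (i : ℕ) :
    meshX P ε N (i + 1) - meshX P ε N i ≤ 2 / N := by
  have hN := hM.cast_pos
  have h0 := transition_pos hP.β₁_pos hM.ε_pos hM.four_le
  have h1 := transition_le P.β₁ ε N
  rcases lt_or_ge i (N / 2) with h | h
  · rw [meshX, node_step_coarse h]
    exact div_le_div_of_nonneg_right (by linarith) hN.le
  · rw [meshX, node_step_fine (by have := hM.four_le; omega) hM.even h]
    exact div_le_div_of_nonneg_right (by linarith) hN.le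

theorem stepX_le_logDiv (hM : MeshAssumption P ε N) (hP : P.Admissible) (i : ℕ) :
    meshX P ε N (i + 1) - meshX P ε N i ≤ 2 * logDiv N := by
  refine (stepX_le hM hP i).trans ?_
  have := hM.inv_le_logDiv
  rw [show (2 : ℝ) / N = 2 * (1 / N) by ring]
  linarith

theorem stepX_coarse_ge (hM : MeshAssumption P ε N) {i : ℕ} (hi : i < N / 2) :
    1 / (N : ℝ) ≤ meshX P ε N (i + 1) - meshX P ε N i := by
  have h1 := transition_le P.β₁ ε N
  rw [meshX, node_step_coarse hi]
  exact div_le_div_of_nonneg_right (by linarith) hM.cast_pos.le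

theorem stepX_fine (hM : MeshAssumption P ε N) {i : ℕ} (hi : N / 2 ≤ i) :
    meshX P ε N (i + 1) - meshX P ε N i = 5 / P.β₁ * (ε * logDiv N) := by
  rw [meshX, node_step_fine (by have := hM.four_le; omega) hM.even hi, hM.transition_x, logDiv]
  ring

theorem expX_pos (P : Coeffs) (ε x : ℝ) : 0 < expX P ε x := Real.exp_pos _

theorem expX_mono (hM : MeshAssumption P ε N) (hP : P.Admissible) {x x' : ℝ} (h : x ≤ x') :
    expX P ε x ≤ expX P ε x' := by
  refine Real.exp_le_exp.2 (div_le_div_of_nonneg_right ?_ hM.ε_pos.le)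
  have := mul_le_mul_of_nonneg_left h hP.β₁_pos.le
  linarith

theorem expX_le_one (hM : MeshAssumption P ε N) (hP : P.Admissible) {x : ℝ} (h : x ≤ 1) :
    expX P ε x ≤ 1 := by
  refine (expX_mono hM hP h).trans_eq ?_
  simp [expX]

/-- The only place where the value (5/2)(ε/β₁) ln N of the transition parameter is converted into
the decay N^(-5/2). -/
theorem expX_transition (hM : MeshAssumption P ε N) (hP : P.Admissible) :
    expX P ε (1 - transition P.β₁ ε N) = tau N := by
  have := hP.β₁_pos.ne'
  have := hM.ε_pos.ne'
  rw [expX, tau, hM.transition_x]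
  congr 1
  field_simp
  ring

theorem expX_le_tau (hM : MeshAssumption P ε N) (hP : P.Admissible) {x : ℝ}
    (h : x ≤ 1 - transition P.β₁ ε N) : expX P ε x ≤ tau N :=
  (expX_mono hM hP h).trans_eq (expX_transition hM hP)

/-- The layer function varies by a bounded factor on a fine mesh interval. -/
theorem expX_le_of_fine (hM : MeshAssumption P ε N) (hP : P.Admissible) {i : ℕ} (hi : N / 2 ≤ i)
    {x x' : ℝ} (hx : meshX P ε N i ≤ x) (hx' : x' ≤ meshX P ε N (i + 1)) :
    expX P ε x' ≤ Real.exp 5 * expX P ε x := by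
  have hb := hP.β₁_pos
  have he := hM.ε_pos
  have hL := hM.logDiv_le_one
  have hs := stepX_fine hM hi
  have hd : x' - x ≤ 5 / P.β₁ * (ε * logDiv N) := by linarith
  -- A fine step is (5/β₁)εL with L ≤ 1, so the exponent changes by at most 5 over one step.
  have hd' : P.β₁ * (x' - x) ≤ 5 * ε := by
    calc P.β₁ * (x' - x) ≤ P.β₁ * (5 / P.β₁ * (ε * logDiv N)) :=
          mul_le_mul_of_nonneg_left hd hb.le
      _ = 5 * (ε * logDiv N) := by field_simp
      _ ≤ 5 * ε := by nlinarith
  rw [expX, expX, ← Real.exp_add]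
  refine Real.exp_le_exp.2 ?_
  rw [div_le_iff₀ he, add_mul, div_mul_cancel₀ _ he.ne']
  linarith

theorem le_of_mem_cell_coarse (hM : MeshAssumption P ε N) (hP : P.Admissible) {k : ℕ × ℕ × Bool}
    (hk : k.1 < N / 2) {q : ℝ × ℝ} (hq : q ∈ cell (meshX P ε N) (meshY P ε N) k) :
    q.1 ≤ 1 - transition P.β₁ ε N := by
  rw [← meshX_half hM]
  exact hq.1.2.trans ((hM.gridX hP).le (by omega) (Nat.div_le_self N 2))

end basic

section layers

variable {P : Coeffs} {ε A : ℝ} {N : ℕ} {u S E₁ E₂ E₁₂ : ℝ × ℝ → ℝ}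

theorem IsLayerDecomposition.abs_E₁₂_le (hd : IsLayerDecomposition P ε A u S E₁ E₂ E₁₂)
    {i j : ℕ} (hij : i + j ≤ 3) {p : ℝ × ℝ} (hp : p ∈ OmegaBar) :
    |(pdx^[i] (pdy^[j] E₁₂)) p| ≤
      A * (ε ^ (i + j))⁻¹ * (expX P ε p.1 * expX P.swap ε p.2) := by
  refine (hd.bound_E₁₂ i j hij p hp).trans_eq ?_
  rw [expX, expX, ← Real.exp_add]
  congr 2
  simp only [Coeffs.swap]
  ring

theorem IsLayerDecomposition.A_nonneg (hd : IsLayerDecomposition P ε A u S E₁ E₂ E₁₂) : 0 ≤ A :=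
  (abs_nonneg _).trans (hd.bound_S 0 0 (by norm_num) (0, 0) ⟨by simp, by simp⟩)

theorem IsLayerDecomposition.abs_E₁₂_le_fst (hd : IsLayerDecomposition P ε A u S E₁ E₂ E₁₂)
    (hM : MeshAssumption P ε N) (hP : P.Admissible)
    {i j : ℕ} (hij : i + j ≤ 3) {p : ℝ × ℝ} (hp : p ∈ OmegaBar) :
    |(pdx^[i] (pdy^[j] E₁₂)) p| ≤ A * (ε ^ (i + j))⁻¹ * expX P ε p.1 := by
  have hA := hd.A_nonneg
  have he := hM.ε_pos
  refine (hd.abs_E₁₂_le hij hp).trans (mul_le_mul_of_nonneg_left ?_ (by positivity))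
  exact mul_le_of_le_one_right (expX_pos _ _ _).le (expX_le_one hM.swap hP.swap hp.2.2)

theorem slopeX_S_err (hd : IsLayerDecomposition P ε A u S E₁ E₂ E₁₂)
    (hM : MeshAssumption P ε N) (hP : P.Admissible) {k : ℕ × ℕ × Bool} (hk : k ∈ triIndex N)
    {p : ℝ × ℝ} (hp : p ∈ cell (meshX P ε N) (meshY P ε N) k) :
    |slopeX (meshX P ε N) (meshY P ε N) S k - pdx S p| ≤ 4 * A * logDiv N := by
  have hX := hM.gridX hP
  have hY := hM.gridY hP
  have hA := hd.A_nonneg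
  have hs := cell_subset hX hY hk
  have h := slopeX_err hX hY hk hd.smooth_S (fun q hq => hd.bound_S 2 0 (by norm_num) q (hs hq))
    (fun q hq => hd.bound_S 1 1 (by norm_num) q (hs hq)) hp
  have h1 := mul_le_mul_of_nonneg_left (stepX_le_logDiv hM hP k.1) hA
  have h2 := mul_le_mul_of_nonneg_left (stepX_le_logDiv hM.swap hP.swap k.2.1) hA
  change A * (meshY P ε N (k.2.1 + 1) - meshY P ε N k.2.1) ≤ _ at h2
  linarith

/-- E₂ is regular in x. Only its mixed derivative carries ε⁻¹, and inside the layer the y-step εL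
compensates it; below the layer E₂ has x-derivative at most `A * tau N`. -/
theorem slopeX_E₂_err (hd : IsLayerDecomposition P ε A u S E₁ E₂ E₁₂)
    (hM : MeshAssumption P ε N) (hP : P.Admissible) {k : ℕ × ℕ × Bool} (hk : k ∈ triIndex N)
    {p : ℝ × ℝ} (hp : p ∈ cell (meshX P ε N) (meshY P ε N) k) :
    |slopeX (meshX P ε N) (meshY P ε N) E₂ k - pdx E₂ p| ≤ (2 + 5 / P.β₂) * A * logDiv N := by
  have hX := hM.gridX hP
  have hY := hM.gridY hP
  have hA := hd.A_nonneg
  have hb := hP.β₂_pos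
  have he := hM.ε_pos
  have hL := hM.logDiv_pos
  have hs := cell_subset hX hY hk
  have hβ : 0 ≤ 5 / P.β₂ * A * logDiv N := by positivity
  rcases lt_or_ge k.2.1 (N / 2) with h | h
  · have hb1 : ∀ q ∈ cell (meshX P ε N) (meshY P ε N) k, |pdx E₂ q| ≤ A * tau N := by
      intro q hq
      have h1 := hd.bound_E₂ 1 0 (by norm_num) q (hs hq)
      rw [pow_zero, inv_one, mul_one] at h1
      refine h1.trans (mul_le_mul_of_nonneg_left ?_ hA)
      exact expX_le_tau hM.swap hP.swap (le_of_mem_cell_coarse hM.swap hP.swap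
        (k := (k.2.1, k.1, k.2.2)) h (q := q.swap) ⟨hq.2, hq.1⟩)
    have h1 := abs_slopeX_le hX hY hk (hd.smooth_E₂.of_le (by norm_num)) hb1
    have h2 := hb1 p hp
    have h3 := mul_le_mul_of_nonneg_left hM.tau_le hA
    refine (abs_sub _ _).trans ?_
    linarith
  · have h' := slopeX_err hX hY hk (hd.smooth_E₂.of_le (by norm_num)) (M₁ := A) (M₂ := A * ε⁻¹)
      (fun q hq => by
        have h1 := hd.bound_E₂ 2 0 (by norm_num) q (hs hq)
        rw [pow_zero, inv_one, mul_one] at h1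
        exact h1.trans (mul_le_of_le_one_right hA (expX_le_one hM.swap hP.swap (hs hq).2.2)))
      (fun q hq => by
        have h1 := hd.bound_E₂ 1 1 (by norm_num) q (hs hq)
        rw [pow_one] at h1
        exact h1.trans (mul_le_of_le_one_right (by positivity)
          (expX_le_one hM.swap hP.swap (hs hq).2.2))) hp
    have h1 := mul_le_mul_of_nonneg_left (stepX_le_logDiv hM hP k.1) hA
    have h2 : meshY P ε N (k.2.1 + 1) - meshY P ε N k.2.1 = 5 / P.β₂ * (ε * logDiv N) :=
      stepX_fine hM.swap h
    rw [h2] at h'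
    have h3 : A * ε⁻¹ * (5 / P.β₂ * (ε * logDiv N)) = 5 / P.β₂ * A * logDiv N := by field_simp
    linarith

/-- The coarse mesh does not resolve the layer, so slope and derivative are bounded separately. The
slope is of order N · `tau`; the derivative keeps its exponential, whose integrals gain powers of ε
later. Applied to E₁ and E₁₂. -/
theorem slopeX_coarse_err (hM : MeshAssumption P ε N) (hP : P.Admissible) {k : ℕ × ℕ × Bool}
    (hk : k ∈ triIndex N) (hkc : k.1 < N / 2) (hA : 0 ≤ A) {E : ℝ × ℝ → ℝ}
    (h0 : ∀ q ∈ OmegaBar, |E q| ≤ A * expX P ε q.1)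
    (h1 : ∀ q ∈ OmegaBar, |pdx E q| ≤ A * ε⁻¹ * expX P ε q.1)
    {p : ℝ × ℝ} (hp : p ∈ cell (meshX P ε N) (meshY P ε N) k) :
    |slopeX (meshX P ε N) (meshY P ε N) E k - pdx E p| ≤
      2 * A * logDiv N + A * ε⁻¹ * expX P ε p.1 := by
  have hX := hM.gridX hP
  have hY := hM.gridY hP
  have hs := cell_subset hX hY hk
  have hN := hM.cast_pos
  have a1 := abs_slopeX_le_div hX hY hk (M := A * tau N) (w := E) (fun q hq =>
    (h0 q (hs hq)).trans (mul_le_mul_of_nonneg_left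
      (expX_le_tau hM hP (le_of_mem_cell_coarse hM hP hkc hq)) hA))
  have a2 : 2 * (A * tau N) / (meshX P ε N (k.1 + 1) - meshX P ε N k.1) ≤
      2 * (A * tau N) / (1 / N) := by
    have := tau_pos N
    exact div_le_div_of_nonneg_left (by positivity) (by positivity) (stepX_coarse_ge hM hkc)
  have a3 : 2 * (A * tau N) / (1 / N) = 2 * A * (tau N * N) := by field_simp
  have a4 := mul_le_mul_of_nonneg_left hM.tau_mul_le (by positivity : 0 ≤ 2 * A)
  have a5 := h1 p (hs hp)
  refine (abs_sub _ _).trans ?_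
  linarith

/-- First order only: ε⁻² against the x-step εL, and ε⁻¹ against the y-step L. Too weak on the whole
layer, it serves the two rows where the pairing fails. -/
theorem slopeX_E₁_fine_err (hd : IsLayerDecomposition P ε A u S E₁ E₂ E₁₂)
    (hM : MeshAssumption P ε N) (hP : P.Admissible) {k : ℕ × ℕ × Bool} (hk : k ∈ triIndex N)
    (hkf : N / 2 ≤ k.1) {p : ℝ × ℝ} (hp : p ∈ cell (meshX P ε N) (meshY P ε N) k) :
    |slopeX (meshX P ε N) (meshY P ε N) E₁ k - pdx E₁ p| ≤
      (5 / P.β₁ + 2) * A * ε⁻¹ * logDiv N := by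
  have hX := hM.gridX hP
  have hY := hM.gridY hP
  have hA := hd.A_nonneg
  have he := hM.ε_pos
  have hs := cell_subset hX hY hk
  have h' := slopeX_err hX hY hk (hd.smooth_E₁.of_le (by norm_num)) (M₁ := A * (ε ^ 2)⁻¹)
      (M₂ := A * ε⁻¹)
      (fun q hq => (hd.bound_E₁ 2 0 (by norm_num) q (hs hq)).trans (mul_le_of_le_one_right
        (by positivity) (expX_le_one hM hP (hs hq).1.2)))
      (fun q hq => by
        have h1 := hd.bound_E₁ 1 1 (by norm_num) q (hs hq)
        rw [pow_one] at h1
        exact h1.trans (mul_le_of_le_one_right (by positivity)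
          (expX_le_one hM hP (hs hq).1.2))) hp
  rw [stepX_fine hM hkf] at h'
  have h2 := mul_le_mul_of_nonneg_left (stepX_le_logDiv hM.swap hP.swap k.2.1)
    (by positivity : 0 ≤ A * ε⁻¹)
  change A * ε⁻¹ * (meshY P ε N (k.2.1 + 1) - meshY P ε N k.2.1) ≤ _ at h2
  have h3 : A * (ε ^ 2)⁻¹ * (5 / P.β₁ * (ε * logDiv N)) = 5 / P.β₁ * A * ε⁻¹ * logDiv N := by
    field_simp
  linarith

/-- The mesh is coarse in y here; the smallness comes from the decay of the y-factor. -/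
theorem slopeX_E₁₂_side_err (hd : IsLayerDecomposition P ε A u S E₁ E₂ E₁₂)
    (hM : MeshAssumption P ε N) (hP : P.Admissible) {k : ℕ × ℕ × Bool} (hk : k ∈ triIndex N)
    (hky : k.2.1 < N / 2) {p : ℝ × ℝ} (hp : p ∈ cell (meshX P ε N) (meshY P ε N) k) :
    |slopeX (meshX P ε N) (meshY P ε N) E₁₂ k - pdx E₁₂ p| ≤ 2 * A * ε⁻¹ * tau N := by
  have hX := hM.gridX hP
  have hY := hM.gridY hP
  have hA := hd.A_nonneg
  have he := hM.ε_pos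
  have hs := cell_subset hX hY hk
  have hb1 : ∀ q ∈ cell (meshX P ε N) (meshY P ε N) k, |pdx E₁₂ q| ≤ A * ε⁻¹ * tau N := by
    intro q hq
    have h1 := hd.abs_E₁₂_le (i := 1) (j := 0) (by norm_num) (hs hq)
    rw [add_zero, pow_one] at h1
    refine h1.trans (mul_le_mul_of_nonneg_left ?_ (by positivity))
    refine (mul_le_of_le_one_left (expX_pos _ _ _).le (expX_le_one hM hP (hs hq).1.2)).trans ?_
    exact expX_le_tau hM.swap hP.swap (le_of_mem_cell_coarse hM.swap hP.swap
        (k := (k.2.1, k.1, k.2.2)) hky (q := q.swap) ⟨hq.2, hq.1⟩)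
  have h1 := abs_slopeX_le hX hY hk (hd.smooth_E₁₂.of_le (by norm_num)) hb1
  have h2 := hb1 p hp
  refine (abs_sub _ _).trans ?_
  linarith

/-- The exponential in x is retained, since its L² norm supplies a factor ε^(1/2) that a bound by 1
would lose up to a logarithm. -/
theorem slopeX_E₁₂_corner_err (hd : IsLayerDecomposition P ε A u S E₁ E₂ E₁₂)
    (hM : MeshAssumption P ε N) (hP : P.Admissible) {k : ℕ × ℕ × Bool} (hk : k ∈ triIndex N)
    (hkx : N / 2 ≤ k.1) (hky : N / 2 ≤ k.2.1) {p : ℝ × ℝ}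
    (hp : p ∈ cell (meshX P ε N) (meshY P ε N) k) :
    |slopeX (meshX P ε N) (meshY P ε N) E₁₂ k - pdx E₁₂ p| ≤
      (5 / P.β₁ + 5 / P.β₂) * Real.exp 5 * A * ε⁻¹ * logDiv N * expX P ε p.1 := by
  have hX := hM.gridX hP
  have hY := hM.gridY hP
  have hA := hd.A_nonneg
  have he := hM.ε_pos
  have hs := cell_subset hX hY hk
  have hb : ∀ q ∈ cell (meshX P ε N) (meshY P ε N) k, ∀ i j : ℕ, i + j = 2 →
      |(pdx^[i] (pdy^[j] E₁₂)) q| ≤ A * (ε ^ 2)⁻¹ * (Real.exp 5 * expX P ε p.1) := by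
    intro q hq i j hij
    have h1 := hd.abs_E₁₂_le_fst hM hP (i := i) (j := j) (by omega) (hs hq)
    rw [hij] at h1
    exact h1.trans (mul_le_mul_of_nonneg_left (expX_le_of_fine hM hP hkx hp.1.1 hq.1.2)
      (by positivity))
  have h' := slopeX_err hX hY hk (hd.smooth_E₁₂.of_le (by norm_num))
    (fun q hq => hb q hq 2 0 rfl) (fun q hq => hb q hq 1 1 rfl) hp
  have h2 : meshY P ε N (k.2.1 + 1) - meshY P ε N k.2.1 = 5 / P.β₂ * (ε * logDiv N) :=
    stepX_fine hM.swap hky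
  rw [stepX_fine hM hkx, h2] at h'
  refine h'.trans_eq ?_
  field_simp

theorem slopeX_decomp (hd : IsLayerDecomposition P ε A u S E₁ E₂ E₁₂) {X Y : ℕ → ℝ}
    (hX : IsGrid N X) (hY : IsGrid N Y) {k : ℕ × ℕ × Bool} (hk : k ∈ triIndex N) :
    slopeX X Y u k = slopeX X Y S k + slopeX X Y E₁ k + slopeX X Y E₂ k + slopeX X Y E₁₂ k := by
  obtain ⟨v0, v1, -⟩ := vertex_mem_cell hX hY hk
  have hs := cell_subset hX hY hk
  simp only [slopeX]
  rw [hd.decomp _ (hs v0), hd.decomp _ (hs v1)]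
  ring

theorem loc_decomp (hd : IsLayerDecomposition P ε A u S E₁ E₂ E₁₂) {X Y : ℕ → ℝ}
    (hX : IsGrid N X) (hY : IsGrid N Y) {k : ℕ × ℕ × Bool} (hk : k ∈ triIndex N) (p : ℝ × ℝ) :
    loc X Y u k p = loc X Y S k p + loc X Y E₁ k p + loc X Y E₂ k p + loc X Y E₁₂ k p := by
  obtain ⟨v0, v1, v2⟩ := vertex_mem_cell hX hY hk
  have hs := cell_subset hX hY hk
  simp only [loc, affInterp]
  rw [hd.decomp _ (hs v0), hd.decomp _ (hs v1), hd.decomp _ (hs v2)]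
  ring

theorem IsLayerDecomposition.eqOn (hd : IsLayerDecomposition P ε A u S E₁ E₂ E₁₂) :
    EqOn u (S + E₁ + E₂ + E₁₂) OmegaBar := fun p hp => hd.decomp p hp

theorem IsLayerDecomposition.contDiffOn (hd : IsLayerDecomposition P ε A u S E₁ E₂ E₁₂) :
    ContDiffOn ℝ 2 u OmegaBar :=
  (((hd.smooth_S.add (hd.smooth_E₁.of_le (by norm_num))).add
    (hd.smooth_E₂.of_le (by norm_num))).add (hd.smooth_E₁₂.of_le (by norm_num))).congr hd.eqOn

theorem pdx_add_four {a b c d : ℝ × ℝ → ℝ} (ha : ContDiffOn ℝ 1 a OmegaBar)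
    (hb : ContDiffOn ℝ 1 b OmegaBar) (hc : ContDiffOn ℝ 1 c OmegaBar)
    (hd : ContDiffOn ℝ 1 d OmegaBar) :
    EqOn (pdx (a + b + c + d)) (pdx a + pdx b + pdx c + pdx d) OmegaBar := by
  have hab : ContDiffOn ℝ 1 (a + b) OmegaBar := ha.add hb
  have habc : ContDiffOn ℝ 1 (a + b + c) OmegaBar := hab.add hc
  intro p hp
  rw [pdx_add habc hd hp, Pi.add_apply, pdx_add hab hc hp, Pi.add_apply, pdx_add ha hb hp]
  rfl

theorem IsLayerDecomposition.pdx_eq (hd : IsLayerDecomposition P ε A u S E₁ E₂ E₁₂) :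
    EqOn (pdx u) (pdx S + pdx E₁ + pdx E₂ + pdx E₁₂) OmegaBar :=
  (pdx_congr hd.eqOn).trans (pdx_add_four (hd.smooth_S.of_le (by norm_num))
    (hd.smooth_E₁.of_le (by norm_num)) (hd.smooth_E₂.of_le (by norm_num))
    (hd.smooth_E₁₂.of_le (by norm_num)))

theorem IsLayerDecomposition.pdx_pdx_eq (hd : IsLayerDecomposition P ε A u S E₁ E₂ E₁₂) :
    EqOn (pdx (pdx u)) (pdx (pdx S) + pdx (pdx E₁) + pdx (pdx E₂) + pdx (pdx E₁₂)) OmegaBar :=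
  (pdx_congr hd.pdx_eq).trans (pdx_add_four (contDiffOn_pdx hd.smooth_S (by norm_num))
    (contDiffOn_pdx hd.smooth_E₁ (by norm_num)) (contDiffOn_pdx hd.smooth_E₂ (by norm_num))
    (contDiffOn_pdx hd.smooth_E₁₂ (by norm_num)))

end layers

end SDFEM

/-! ### Pointwise errors of the interpolant and of its gradient -/

namespace SDFEM

section layers

variable {P : Coeffs} {ε A : ℝ} {N : ℕ} {u S E₁ E₂ E₁₂ : ℝ × ℝ → ℝ}

theorem meshX_half_lt_iff (hM : MeshAssumption P ε N) (hP : P.Admissible) {k : ℕ × ℕ × Bool}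
    (hk : k ∈ triIndex N) {p : ℝ × ℝ} (hp : p ∈ otri (meshX P ε N) (meshY P ε N) k) :
    N / 2 ≤ k.1 ↔ 1 - transition P.β₁ ε N < p.1 := by
  obtain ⟨h1, h2⟩ := mem_triIndex.1 hk
  have hX := hM.gridX hP
  obtain ⟨b1, b2, -, -⟩ := otri_bounds hX (hM.gridY hP) h1 h2 hp
  have hi := lt_half_iff hM hX h1 b1 b2
  constructor
  · intro h
    rw [← meshX_half hM]
    exact (hX.le h h1.le).trans_lt b1
  · intro h
    by_contra hc
    have := hi.1 (by omega)
    linarith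

/-- The part of the gradient error that does not need a superclose estimate. -/
theorem grad_err_pointwise (hd : IsLayerDecomposition P ε A u S E₁ E₂ E₁₂)
    (hM : MeshAssumption P ε N) (hP : P.Admissible) {k : ℕ × ℕ × Bool} (hk : k ∈ triIndex N)
    {p : ℝ × ℝ} (hp : p ∈ otri (meshX P ε N) (meshY P ε N) k) :
    |slopeX (meshX P ε N) (meshY P ε N) u k - pdx u p
      - {q : ℝ × ℝ | meshX P ε N (N / 2) < q.1}.indicator
        (fun q => slopeX (meshX P ε N) (meshY P ε N) E₁ k - pdx E₁ q) p| ≤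
      (10 + 5 / P.β₂) * A * logDiv N
      + 2 * A * ε⁻¹ * (Ioo 0 (1 - transition P.β₁ ε N)).indicator (expX P ε) p.1
      + (5 / P.β₁ + 5 / P.β₂) * Real.exp 5 * A * ε⁻¹ * logDiv N *
        ((Ioo 0 1).indicator (expX P ε) p.1 *
          (Ioo (1 - transition P.β₂ ε N) 1).indicator (fun _ => 1) p.2)
      + 2 * A * ε⁻¹ * tau N * (Ioo (1 - transition P.β₁ ε N) 1).indicator (fun _ => 1) p.1 := by
  have hX := hM.gridX hP
  have hY := hM.gridY hP
  have hA := hd.A_nonneg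
  have he := hM.ε_pos
  have hL := hM.logDiv_pos
  have hτ := tau_pos N
  have hb1 := hP.β₁_pos
  have hb2 := hP.β₂_pos
  have hΩ := otri_subset_Omega hX hY hk hp
  have hpc := otri_subset_cell hX hY hk hp
  have eS := slopeX_S_err hd hM hP hk hpc
  have e2 := slopeX_E₂_err hd hM hP hk hpc
  have hfine := meshX_half_lt_iff hM hP hk hp
  have hfineY : N / 2 ≤ k.2.1 ↔ 1 - transition P.β₂ ε N < p.2 :=
    meshX_half_lt_iff hM.swap hP.swap (k := (k.2.1, k.1, k.2.2))
      (mem_triIndex.2 (mem_triIndex.1 hk).symm) (swap_mem_otri.2 hp)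
  rw [slopeX_decomp hd hX hY hk, hd.pdx_eq (Omega_subset_OmegaBar hΩ)]
  simp only [Pi.add_apply]
  have hex : 0 ≤ expX P ε p.1 := (expX_pos _ _ _).le
  have i1 : 0 ≤ (Ioo 0 1).indicator (expX P ε) p.1 :=
    indicator_nonneg (fun _ _ => (expX_pos _ _ _).le) _
  have i2 : 0 ≤ (Ioo (1 - transition P.β₂ ε N) 1).indicator (fun _ => (1 : ℝ)) p.2 :=
    indicator_nonneg (fun _ _ => zero_le_one) _
  have i3 : 0 ≤ (Ioo (1 - transition P.β₁ ε N) 1).indicator (fun _ => (1 : ℝ)) p.1 :=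
    indicator_nonneg (fun _ _ => zero_le_one) _
  have i4 : 0 ≤ (Ioo 0 (1 - transition P.β₁ ε N)).indicator (expX P ε) p.1 :=
    indicator_nonneg (fun _ _ => (expX_pos _ _ _).le) _
  have j3 : 0 ≤ (5 / P.β₁ + 5 / P.β₂) * Real.exp 5 * A * ε⁻¹ * logDiv N *
        ((Ioo 0 1).indicator (expX P ε) p.1 *
          (Ioo (1 - transition P.β₂ ε N) 1).indicator (fun _ => 1) p.2) := by positivity
  have j4 : 0 ≤ 2 * A * ε⁻¹ * tau N *
      (Ioo (1 - transition P.β₁ ε N) 1).indicator (fun _ => 1) p.1 := by positivity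
  have j2 : 0 ≤ 2 * A * ε⁻¹ * (Ioo 0 (1 - transition P.β₁ ε N)).indicator (expX P ε) p.1 := by
    positivity
  have j1 : 0 ≤ A * logDiv N := by positivity
  -- In coarse columns E₁ and E₁₂ are both unresolved, and the coefficient 10 is 4 from S, 2 from E₂
  -- and 2 from each of these. In fine columns the E₁ part is precisely what is subtracted.
  rcases lt_or_ge k.1 (N / 2) with hk1 | hk1
  · have hx : p.1 < 1 - transition P.β₁ ε N := by
      have := (lt_half_iff hM hX (mem_triIndex.1 hk).1 (otri_bounds hX hY (mem_triIndex.1 hk).1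
        (mem_triIndex.1 hk).2 hp).1 (otri_bounds hX hY (mem_triIndex.1 hk).1
        (mem_triIndex.1 hk).2 hp).2.1).1 hk1
      exact this
    rw [indicator_of_notMem (s := {q : ℝ × ℝ | meshX P ε N (N / 2) < q.1}) (fun h => by
      rw [mem_ofPred_eq, meshX_half hM] at h; linarith)]
    rw [indicator_of_mem (show p.1 ∈ Ioo 0 (1 - transition P.β₁ ε N) from ⟨hΩ.1.1, hx⟩)] at j2 ⊢
    have c1 := slopeX_coarse_err (E := E₁) hM hP hk hk1 hA
      (fun q hq => by
        have := hd.bound_E₁ 0 0 (by norm_num) q hq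
        rwa [pow_zero, inv_one, mul_one] at this)
      (fun q hq => by
        have := hd.bound_E₁ 1 0 (by norm_num) q hq
        rwa [pow_one] at this) hpc
    have c2 := slopeX_coarse_err (E := E₁₂) hM hP hk hk1 hA
      (fun q hq => by
        have := hd.abs_E₁₂_le_fst hM hP (i := 0) (j := 0) (by norm_num) hq
        rwa [pow_zero, inv_one, mul_one] at this)
      (fun q hq => by
        have := hd.abs_E₁₂_le_fst hM hP (i := 1) (j := 0) (by norm_num) hq
        rwa [pow_one] at this) hpc
    rw [abs_le] at eS e2 c1 c2 ⊢
    constructor <;> linarith [eS.1, eS.2, e2.1, e2.2, c1.1, c1.2, c2.1, c2.2]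
  · have hx := hfine.1 hk1
    rw [indicator_of_mem (s := {q : ℝ × ℝ | meshX P ε N (N / 2) < q.1}) (by
      rw [mem_ofPred_eq, meshX_half hM]; exact hx)]
    rw [indicator_of_mem (show p.1 ∈ Ioo (1 - transition P.β₁ ε N) 1 from ⟨hx, hΩ.1.2⟩)] at j4 ⊢
    rcases lt_or_ge k.2.1 (N / 2) with hk2 | hk2
    · have c := slopeX_E₁₂_side_err hd hM hP hk hk2 hpc
      rw [abs_le] at eS e2 c ⊢
      constructor <;> linarith [eS.1, eS.2, e2.1, e2.2, c.1, c.2]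
    · have c := slopeX_E₁₂_corner_err hd hM hP hk hk1 hk2 hpc
      have hy := hfineY.1 hk2
      rw [indicator_of_mem (show p.1 ∈ Ioo (0 : ℝ) 1 from hΩ.1), indicator_of_mem
        (show p.2 ∈ Ioo (1 - transition P.β₂ ε N) 1 from ⟨hy, hΩ.2.2⟩), mul_one] at j3 ⊢
      rw [abs_le] at eS e2 c ⊢
      constructor <;> linarith [eS.1, eS.2, e2.1, e2.2, c.1, c.2]

theorem loc_S_err (hd : IsLayerDecomposition P ε A u S E₁ E₂ E₁₂)
    (hM : MeshAssumption P ε N) (hP : P.Admissible) {k : ℕ × ℕ × Bool} (hk : k ∈ triIndex N)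
    {p : ℝ × ℝ} (hp : p ∈ otri (meshX P ε N) (meshY P ε N) k) :
    |loc (meshX P ε N) (meshY P ε N) S k p - S p| ≤ 16 * A / (N : ℝ) ^ 2 := by
  have hX := hM.gridX hP
  have hY := hM.gridY hP
  have hA := hd.A_nonneg
  have hs := cell_subset hX hY hk
  have h := loc_err hX hY hk hd.smooth_S (fun q hq => hd.bound_S 2 0 (by norm_num) q (hs hq))
    (fun q hq => hd.bound_S 1 1 (by norm_num) q (hs hq))
    (fun q hq => hd.bound_S 0 2 (by norm_num) q (hs hq)) hp
  have g1 := sub_nonneg.2 (hX.lt _ (mem_triIndex.1 hk).1).le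
  have g2 := sub_nonneg.2 (hY.lt _ (mem_triIndex.1 hk).2).le
  have s1 := stepX_le hM hP k.1
  have s2 : meshY P ε N (k.2.1 + 1) - meshY P ε N k.2.1 ≤ 2 / N := stepX_le hM.swap hP.swap k.2.1
  refine h.trans ?_
  have hN := hM.cast_pos
  calc _ ≤ (A * (2 / N) + A * (2 / N)) * (2 / N) + (A * (2 / N) + A * (2 / N)) * (2 / (N : ℝ)) := by
        gcongr
    _ = 16 * A / (N : ℝ) ^ 2 := by field_simp; ring

/-- Left of the layer both function and interpolant are at most `A * tau N`; inside it the second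
derivatives ε⁻² are balanced by the square of the fine step. -/
theorem loc_E₁_err (hd : IsLayerDecomposition P ε A u S E₁ E₂ E₁₂)
    (hM : MeshAssumption P ε N) (hP : P.Admissible) {k : ℕ × ℕ × Bool} (hk : k ∈ triIndex N)
    {p : ℝ × ℝ} (hp : p ∈ otri (meshX P ε N) (meshY P ε N) k) :
    |loc (meshX P ε N) (meshY P ε N) E₁ k p - E₁ p| ≤ 2 * A * tau N +
      (Ici (1 - transition P.β₁ ε N)).indicator (fun _ => (5 / P.β₁ + 2) ^ 2 * A * logDiv N ^ 2)
        p.1 := by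
  have hX := hM.gridX hP
  have hY := hM.gridY hP
  have hA := hd.A_nonneg
  have he := hM.ε_pos
  have hL := hM.logDiv_pos
  have hb1 := hP.β₁_pos
  have hs := cell_subset hX hY hk
  rcases lt_or_ge k.1 (N / 2) with hk1 | hk1
  · have h := loc_err_of_le hX hY hk (M := A * tau N) (w := E₁) (fun q hq => by
      have := hd.bound_E₁ 0 0 (by norm_num) q (hs hq)
      rw [pow_zero, inv_one, mul_one] at this
      exact this.trans (mul_le_mul_of_nonneg_left
        (expX_le_tau hM hP (le_of_mem_cell_coarse hM hP hk1 hq)) hA)) hp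
    have h0 : 0 ≤ (Ici (1 - transition P.β₁ ε N)).indicator
      (fun _ => (5 / P.β₁ + 2) ^ 2 * A * logDiv N ^ 2) p.1 :=
      indicator_nonneg (fun _ _ => by positivity) _
    linarith
  · have hx := (meshX_half_lt_iff hM hP hk hp).1 hk1
    rw [indicator_of_mem (show p.1 ∈ Ici (1 - transition P.β₁ ε N) from hx.le)]
    have h := loc_err hX hY hk (hd.smooth_E₁.of_le (by norm_num)) (M₁ := A * (ε ^ 2)⁻¹)
      (M₂ := A * ε⁻¹) (M₃ := A)
      (fun q hq => (hd.bound_E₁ 2 0 (by norm_num) q (hs hq)).trans (mul_le_of_le_one_right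
        (by positivity) (expX_le_one hM hP (hs hq).1.2)))
      (fun q hq => by
        have h1 := hd.bound_E₁ 1 1 (by norm_num) q (hs hq)
        rw [pow_one] at h1
        exact h1.trans (mul_le_of_le_one_right (by positivity) (expX_le_one hM hP (hs hq).1.2)))
      (fun q hq => by
        have h1 := hd.bound_E₁ 0 2 (by norm_num) q (hs hq)
        rw [pow_zero, inv_one, mul_one] at h1
        exact h1.trans (mul_le_of_le_one_right hA (expX_le_one hM hP (hs hq).1.2))) hp
    rw [stepX_fine hM hk1] at h
    have g2 := sub_nonneg.2 (hY.lt _ (mem_triIndex.1 hk).2).le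
    have s2 : meshY P ε N (k.2.1 + 1) - meshY P ε N k.2.1 ≤ 2 * logDiv N :=
      stepX_le_logDiv hM.swap hP.swap k.2.1
    have hτ : 0 ≤ 2 * A * tau N := by have := tau_pos N; positivity
    refine (h.trans ?_).trans (le_add_of_nonneg_left hτ)
    calc _ ≤ (A * (ε ^ 2)⁻¹ * (5 / P.β₁ * (ε * logDiv N)) + A * ε⁻¹ * (2 * logDiv N))
          * (5 / P.β₁ * (ε * logDiv N)) + (A * ε⁻¹ * (5 / P.β₁ * (ε * logDiv N))
          + A * (2 * logDiv N)) * (2 * logDiv N) := by gcongr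
      _ = (5 / P.β₁ + 2) ^ 2 * A * logDiv N ^ 2 := by field_simp

theorem loc_E₁₂_err (hd : IsLayerDecomposition P ε A u S E₁ E₂ E₁₂)
    (hM : MeshAssumption P ε N) (hP : P.Admissible) {k : ℕ × ℕ × Bool} (hk : k ∈ triIndex N)
    {p : ℝ × ℝ} (hp : p ∈ otri (meshX P ε N) (meshY P ε N) k) :
    |loc (meshX P ε N) (meshY P ε N) E₁₂ k p - E₁₂ p| ≤ 2 * A * tau N +
      (Ici (1 - transition P.β₁ ε N)).indicator
        (fun _ => (5 / P.β₁ + 5 / P.β₂) ^ 2 * A * logDiv N ^ 2) p.1 := by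
  have hX := hM.gridX hP
  have hY := hM.gridY hP
  have hA := hd.A_nonneg
  have he := hM.ε_pos
  have hL := hM.logDiv_pos
  have hb1 := hP.β₁_pos
  have hb2 := hP.β₂_pos
  have hs := cell_subset hX hY hk
  have h0 : 0 ≤ (Ici (1 - transition P.β₁ ε N)).indicator
      (fun _ => (5 / P.β₁ + 5 / P.β₂) ^ 2 * A * logDiv N ^ 2) p.1 :=
      indicator_nonneg (fun _ _ => by positivity) _
  have hval : (∀ q ∈ cell (meshX P ε N) (meshY P ε N) k,
      expX P ε q.1 * expX P.swap ε q.2 ≤ tau N) →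
      |loc (meshX P ε N) (meshY P ε N) E₁₂ k p - E₁₂ p| ≤ 2 * (A * tau N) := fun hq =>
    loc_err_of_le hX hY hk (fun q hqc => by
      have := hd.abs_E₁₂_le (i := 0) (j := 0) (by norm_num) (hs hqc)
      rw [pow_zero, inv_one, mul_one] at this
      exact this.trans (mul_le_mul_of_nonneg_left (hq q hqc) hA)) hp
  rcases lt_or_ge k.1 (N / 2) with hk1 | hk1
  · have := hval fun q hq => (mul_le_of_le_one_right (expX_pos _ _ _).le
      (expX_le_one hM.swap hP.swap (hs hq).2.2)).trans
      (expX_le_tau hM hP (le_of_mem_cell_coarse hM hP hk1 hq))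
    linarith
  rcases lt_or_ge k.2.1 (N / 2) with hk2 | hk2
  · have := hval fun q hq => (mul_le_of_le_one_left (expX_pos _ _ _).le
      (expX_le_one hM hP (hs hq).1.2)).trans
      (expX_le_tau hM.swap hP.swap (le_of_mem_cell_coarse hM.swap hP.swap
        (k := (k.2.1, k.1, k.2.2)) hk2 (q := q.swap) ⟨hq.2, hq.1⟩))
    linarith
  · have hx := (meshX_half_lt_iff hM hP hk hp).1 hk1
    rw [indicator_of_mem (show p.1 ∈ Ici (1 - transition P.β₁ ε N) from hx.le)]
    have hb : ∀ q ∈ cell (meshX P ε N) (meshY P ε N) k, ∀ i j : ℕ, i + j = 2 →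
        |(pdx^[i] (pdy^[j] E₁₂)) q| ≤ A * (ε ^ 2)⁻¹ := by
      intro q hq i j hij
      have h1 := hd.abs_E₁₂_le_fst hM hP (i := i) (j := j) (by omega) (hs hq)
      rw [hij] at h1
      exact h1.trans (mul_le_of_le_one_right (by positivity) (expX_le_one hM hP (hs hq).1.2))
    have h := loc_err hX hY hk (hd.smooth_E₁₂.of_le (by norm_num)) (fun q hq => hb q hq 2 0 rfl)
      (fun q hq => hb q hq 1 1 rfl) (fun q hq => hb q hq 0 2 rfl) hp
    have h2 : meshY P ε N (k.2.1 + 1) - meshY P ε N k.2.1 = 5 / P.β₂ * (ε * logDiv N) :=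
      stepX_fine hM.swap hk2
    rw [stepX_fine hM hk1, h2] at h
    have hτ : 0 ≤ 2 * A * tau N := by have := tau_pos N; positivity
    refine (h.trans (le_of_eq ?_)).trans (le_add_of_nonneg_left hτ)
    field_simp

/-- Pointwise interpolation error. -/
theorem loc_err_pointwise (hd : IsLayerDecomposition P ε A u S E₁ E₂ E₁₂)
    (hM : MeshAssumption P ε N) (hP : P.Admissible) {k : ℕ × ℕ × Bool} (hk : k ∈ triIndex N)
    {p : ℝ × ℝ} (hp : p ∈ otri (meshX P ε N) (meshY P ε N) k) :
    |loc (meshX P ε N) (meshY P ε N) u k p - u p| ≤ 22 * A / (N : ℝ) ^ 2 +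
      ((5 / P.β₁ + 2) ^ 2 + (5 / P.β₂ + 2) ^ 2 + (5 / P.β₁ + 5 / P.β₂) ^ 2) * A * logDiv N ^ 2 *
        (1 - chi P ε N p) := by
  have hX := hM.gridX hP
  have hY := hM.gridY hP
  have hA := hd.A_nonneg
  have hN := hM.cast_pos
  have hb1 := hP.β₁_pos
  have hb2 := hP.β₂_pos
  have hΩ := otri_subset_Omega hX hY hk hp
  have eS := loc_S_err hd hM hP hk hp
  have e1 := loc_E₁_err hd hM hP hk hp
  have e2 := loc_E₁_err hd.swap hM.swap hP.swap (k := (k.2.1, k.1, k.2.2))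
    (mem_triIndex.2 (mem_triIndex.1 hk).symm) (p := p.swap) (swap_mem_otri.2 hp)
  change |loc (meshY P ε N) (meshX P ε N) (E₂ ∘ Prod.swap) (k.2.1, k.1, k.2.2) p.swap - E₂ p| ≤
    2 * A * tau N + (Ici (1 - transition P.β₂ ε N)).indicator
      (fun _ => (5 / P.β₂ + 2) ^ 2 * A * logDiv N ^ 2) p.2 at e2
  rw [loc_swap] at e2
  have e3 := loc_E₁₂_err hd hM hP hk hp
  have hτ : A * tau N ≤ A / (N : ℝ) ^ 2 := by
    rw [le_div_iff₀ (by positivity), mul_assoc]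
    exact mul_le_of_le_one_right hA hM.tau_mul_sq_le
  have hi : ∀ c : ℝ, 0 ≤ c → ∀ β x : ℝ, (1 - chi P ε N p = 1 ∨ x < 1 - transition β ε N) →
      (Ici (1 - transition β ε N)).indicator (fun _ => c) x ≤ c * (1 - chi P ε N p) := by
    intro c hc β x h
    rcases h with h | h
    · rw [h, mul_one]
      exact indicator_le_self' (fun _ _ => hc) x
    · rw [indicator_of_notMem (show x ∉ Ici (1 - transition β ε N) from not_le.2 h)]
      exact mul_nonneg hc (by have := chi_le_one (P := P) (ε := ε) (N := N) p; linarith)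
  have hcases : 1 - chi P ε N p = 1 ∨
      (p.1 < 1 - transition P.β₁ ε N ∧ p.2 < 1 - transition P.β₂ ε N) := by
    by_cases h : p ∈ coarse P ε N
    · exact Or.inr h
    · left; simp [chi, h]
  have i1 := hi ((5 / P.β₁ + 2) ^ 2 * A * logDiv N ^ 2) (by positivity) P.β₁ p.1
    (hcases.imp id And.left)
  have i2 := hi ((5 / P.β₂ + 2) ^ 2 * A * logDiv N ^ 2) (by positivity) P.β₂ p.2
    (hcases.imp id And.right)
  have i3 := hi ((5 / P.β₁ + 5 / P.β₂) ^ 2 * A * logDiv N ^ 2) (by positivity) P.β₁ p.1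
    (hcases.imp id And.left)
  -- 16 comes from S, and 2 from each of the three layer parts, for which `tau N` is at most N⁻².
  have hs : 22 * A / (N : ℝ) ^ 2 = 16 * A / (N : ℝ) ^ 2 + 6 * (A / (N : ℝ) ^ 2) := by ring
  rw [loc_decomp hd hX hY hk, hd.decomp _ (Omega_subset_OmegaBar hΩ), hs]
  rw [abs_le] at eS e1 e2 e3 ⊢
  constructor <;> linarith [eS.1, eS.2, e1.1, e1.2, e2.1, e2.2, e3.1, e3.2]

end layers

end SDFEM

/-! ### Comparison of the occurring powers with the rate -/

namespace SDFEM

/-- The asserted order of convergence. -/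
noncomputable def rate (ε : ℝ) (N : ℕ) : ℝ :=
  (Real.sqrt ε / N + 1 / (N * Real.sqrt N)) * Real.sqrt (Real.log N) ^ 3

section rate

variable {P : Coeffs} {ε : ℝ} {N : ℕ}

theorem tau_eq (hM : MeshAssumption P ε N) : tau N = 1 / Real.sqrt N ^ 5 := by
  have h : Real.sqrt N = Real.exp (Real.log N / 2) := by
    rw [Real.exp_half, Real.exp_log hM.cast_pos]
  rw [tau, h, ← Real.exp_nat_mul, one_div, ← Real.exp_neg]
  congr 1
  push_cast
  ring

theorem logDiv_eq (hM : MeshAssumption P ε N) :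
    logDiv N = Real.sqrt (Real.log N) ^ 2 / Real.sqrt N ^ 2 := by
  rw [Real.sq_sqrt (zero_le_one.trans hM.one_le_log), Real.sq_sqrt hM.cast_pos.le, logDiv]

theorem rate_eq (hM : MeshAssumption P ε N) : rate ε N =
    (Real.sqrt ε / Real.sqrt N ^ 2 + 1 / Real.sqrt N ^ 3) * Real.sqrt (Real.log N) ^ 3 := by
  have := Real.sq_sqrt hM.cast_pos.le
  rw [rate, ← this, Real.sqrt_sq (Real.sqrt_nonneg _)]
  congr 3

theorem rate_pos (hM : MeshAssumption P ε N) : 0 < rate ε N := by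
  have := Real.sqrt_pos.2 hM.cast_pos
  have := Real.sqrt_pos.2 hM.ε_pos
  have := Real.sqrt_pos.2 (zero_lt_one.trans_le hM.one_le_log)
  rw [rate_eq hM]
  positivity

theorem one_le_sqrt_log (hM : MeshAssumption P ε N) : 1 ≤ Real.sqrt (Real.log N) := by
  rw [← Real.sqrt_one]
  exact Real.sqrt_le_sqrt hM.one_le_log

theorem sqrt_log_sq_le (hM : MeshAssumption P ε N) :
    Real.sqrt (Real.log N) ^ 2 ≤ 2 * Real.sqrt N := by
  rw [Real.sq_sqrt (zero_le_one.trans hM.one_le_log)]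
  have h := Real.log_le_sub_one_of_pos (Real.sqrt_pos.2 hM.cast_pos)
  rw [Real.log_sqrt hM.cast_pos.le] at h
  linarith

/-- The left side is the first summand of the rate, ε^(1/2)N⁻¹ ln^(3/2) N. -/
theorem sqrt_mul_logDiv_le (hM : MeshAssumption P ε N) :
    Real.sqrt ε * logDiv N * Real.sqrt (Real.log N) ≤ rate ε N := by
  have h1 := Real.sqrt_pos.2 hM.cast_pos
  have h3 := one_le_sqrt_log hM
  rw [rate_eq hM, logDiv_eq hM, add_mul]
  have : 0 ≤ 1 / Real.sqrt N ^ 3 * Real.sqrt (Real.log N) ^ 3 := by positivity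
  refine le_trans (le_of_eq ?_) (le_add_of_nonneg_right this)
  ring

/-- The left side is the second summand of the rate, N^(-3/2) ln^(3/2) N. -/
theorem logDiv_div_le (hM : MeshAssumption P ε N) :
    logDiv N * Real.sqrt (Real.log N) / Real.sqrt N ≤ rate ε N := by
  have h1 := Real.sqrt_pos.2 hM.cast_pos
  have h3 := one_le_sqrt_log hM
  rw [rate_eq hM, logDiv_eq hM, add_mul]
  have : 0 ≤ Real.sqrt ε / Real.sqrt N ^ 2 * Real.sqrt (Real.log N) ^ 3 := by positivity
  refine le_trans (le_of_eq ?_) (le_add_of_nonneg_left this)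
  field_simp

/-- One of the two factors `logDiv N` is spent as 2N^(-1/2), by ln N ≤ 2N^(1/2). -/
theorem logDiv_sq_le (hM : MeshAssumption P ε N) :
    logDiv N ^ 2 * Real.sqrt (Real.log N) ≤ 2 * rate ε N := by
  have h1 := Real.sqrt_pos.2 hM.cast_pos
  have h4 := sqrt_log_sq_le hM
  have hl := hM.logDiv_pos
  have : logDiv N ≤ 2 / Real.sqrt N := by
    rw [logDiv_eq hM, div_le_div_iff₀ (by positivity) h1]
    nlinarith
  calc logDiv N ^ 2 * Real.sqrt (Real.log N) = logDiv N * (logDiv N * Real.sqrt (Real.log N)) := by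
        ring
    _ ≤ 2 / Real.sqrt N * (logDiv N * Real.sqrt (Real.log N)) := by gcongr
    _ = 2 * (logDiv N * Real.sqrt (Real.log N) / Real.sqrt N) := by ring
    _ ≤ _ := by gcongr; exact logDiv_div_le hM

theorem inv_cube_mul_le (hM : MeshAssumption P ε N) :
    Real.sqrt (Real.log N) / Real.sqrt N ^ 3 ≤ rate ε N := by
  have h1 := Real.sqrt_pos.2 hM.cast_pos
  have h3 := one_le_sqrt_log hM
  refine le_trans ?_ (logDiv_div_le hM)
  rw [logDiv_eq hM]
  have : Real.sqrt (Real.log N) ≤ Real.sqrt (Real.log N) ^ 3 :=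
    le_self_pow₀ h3 (by norm_num)
  calc _ ≤ Real.sqrt (Real.log N) ^ 3 / Real.sqrt N ^ 3 := by gcongr
    _ = _ := by field_simp

theorem inv_cube_le (hM : MeshAssumption P ε N) : 1 / Real.sqrt N ^ 3 ≤ rate ε N := by
  have h1 := Real.sqrt_pos.2 hM.cast_pos
  exact (div_le_div_of_nonneg_right (one_le_sqrt_log hM) (by positivity)).trans
    (inv_cube_mul_le hM)

theorem one_le_sqrt_cast (hM : MeshAssumption P ε N) : 1 ≤ Real.sqrt N := by
  rw [← Real.sqrt_one]
  exact Real.sqrt_le_sqrt (by have := hM.four_le; norm_cast; omega)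

theorem tau_mul_sqrt_log_le (hM : MeshAssumption P ε N) :
    tau N * Real.sqrt (Real.log N) ≤ rate ε N := by
  have h1 := one_le_sqrt_cast hM
  refine le_trans ?_ (inv_cube_mul_le hM)
  rw [tau_eq hM, one_div_mul_eq_div]
  exact div_le_div_of_nonneg_left (by positivity) (by positivity)
    (pow_le_pow_right₀ h1 (by norm_num))

/-- N · N^(-5/2) = N^(-3/2): the stabilization term needs this, and it leaves no room in the
exponent 5/2 apart from logarithms. -/
theorem tau_mul_cast_le (hM : MeshAssumption P ε N) : tau N * N ≤ rate ε N := by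
  have h1 := Real.sqrt_pos.2 hM.cast_pos
  refine le_trans (le_of_eq ?_) (inv_cube_le hM)
  rw [tau_eq hM, ← Real.sq_sqrt hM.cast_pos.le, Real.sqrt_sq h1.le]
  field_simp

theorem tau_le_rate (hM : MeshAssumption P ε N) : tau N ≤ rate ε N :=
  (le_mul_of_one_le_right (tau_pos N).le (one_le_sqrt_log hM)).trans (tau_mul_sqrt_log_le hM)

theorem inv_sq_le_rate (hM : MeshAssumption P ε N) : 1 / (N : ℝ) ^ 2 ≤ rate ε N := by
  have h1 := one_le_sqrt_cast hM
  refine le_trans ?_ (inv_cube_le hM)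
  rw [← Real.sq_sqrt hM.cast_pos.le, Real.sqrt_sq (by positivity), ← pow_mul]
  exact div_le_div_of_nonneg_left (by positivity) (by positivity)
    (pow_le_pow_right₀ h1 (by norm_num))

theorem sqrt_transition (hM : MeshAssumption P ε N) (hP : P.Admissible) :
    Real.sqrt (transition P.β₁ ε N) =
      Real.sqrt (5 / 2 / P.β₁) * (Real.sqrt ε * Real.sqrt (Real.log N)) := by
  have := hP.β₁_pos
  have h2 := hM.ε_pos
  rw [hM.transition_x, ← Real.sqrt_mul h2.le, ← Real.sqrt_mul (by positivity)]
  congr 1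
  ring

theorem expX_eq (P : Coeffs) (ε : ℝ) :
    expX P ε = fun x => Real.exp (-(P.β₁ / ε * (1 - x))) := by
  ext x
  rw [expX]
  congr 1
  ring

theorem nrm1_expX_le (hM : MeshAssumption P ε N) (hP : P.Admissible) {c : ℝ} (hc : 0 ≤ c)
    (hc1 : c ≤ 1) : nrm1 ((Ioo 0 c).indicator (expX P ε)) ≤
      expX P ε c * (Real.sqrt ε / Real.sqrt (2 * P.β₁)) := by
  have hb := hP.β₁_pos
  have he := hM.ε_pos
  have h := nrm1_exp_le (div_pos hb he) hc hc1
  rw [expX_eq]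
  refine h.trans (le_of_eq ?_)
  rw [← mul_div_assoc, Real.sqrt_div (by positivity)]
  have := Real.sqrt_pos.2 he
  field_simp

theorem nrm_fst (φ : ℝ → ℝ) : nrm (fun p => φ p.1) = nrm1 φ := by
  have := nrm_prod φ fun _ => 1
  simpa [nrm1_one] using this

theorem continuous_expX (P : Coeffs) (ε : ℝ) : Continuous (expX P ε) := by
  unfold expX
  fun_prop

end rate

end SDFEM

/-! ### The diffusion term -/

namespace SDFEM

section stiffness

variable {P : Coeffs} {ε A : ℝ} {N : ℕ} {u S E₁ E₂ E₁₂ v : ℝ × ℝ → ℝ}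

theorem Bd.abs {F : ℝ × ℝ → ℝ} (hF : Bd F) : Bd (fun p => |F p|) := hF.norm

theorem nrm_abs (F : ℝ × ℝ → ℝ) : nrm (fun p => |F p|) = nrm F := by
  simp only [nrm, sq_abs]

theorem nrm1_layer_le (hM : MeshAssumption P ε N) (hP : P.Admissible) :
    nrm1 ((Ioo (1 - transition P.β₁ ε N) 1).indicator fun _ => 1) ≤
      Real.sqrt (5 / 2 / P.β₁) * (Real.sqrt ε * Real.sqrt (Real.log N)) := by
  have h := nrm1_indicator_Ioo_le (a := 1 - transition P.β₁ ε N) (b := 1)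
    (by have := transition_pos hP.β₁_pos hM.ε_pos hM.four_le; linarith)
  rwa [sub_sub_cancel, sqrt_transition hM hP] at h

/-- The gradient error without the part that needs a superclose estimate. -/
noncomputable def gradErr (P : Coeffs) (ε : ℝ) (N : ℕ) (u E₁ : ℝ × ℝ → ℝ) (p : ℝ × ℝ) : ℝ :=
  stepFn N (meshX P ε N) (meshY P ε N) (slopeX (meshX P ε N) (meshY P ε N) u) p - pdx u p
    - {q : ℝ × ℝ | meshX P ε N (N / 2) < q.1}.indicator
      (fun q => stepFn N (meshX P ε N) (meshY P ε N) (slopeX (meshX P ε N) (meshY P ε N) E₁) q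
        - pdx E₁ q) p

-- Up to constants the four contributions are ε^(1/2)L from the resolved parts, ε^(1/2)ε⁻¹ · `tau`
-- ε^(1/2) = `tau` from the exponentials left of the layer, ε^(1/2)ε⁻¹L · ε^(1/2)(ε ln N)^(1/2) =
-- ε^(1/2)L(ln N)^(1/2) from the corner, and `tau` (ln N)^(1/2) from the side layer. All powers ε⁻¹
-- are cancelled by the sizes of the supports or the L² norms of the exponentials.
set_option maxHeartbeats 1000000 in
theorem sqrt_mul_nrm_gradErr_le (hd : IsLayerDecomposition P ε A u S E₁ E₂ E₁₂)
    (hM : MeshAssumption P ε N) (hP : P.Admissible) :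
    Real.sqrt ε * nrm (gradErr P ε N u E₁) ≤
      ((10 + 5 / P.β₂) * A + 2 * A / Real.sqrt (2 * P.β₁)
        + (5 / P.β₁ + 5 / P.β₂) * Real.exp 5 * A / Real.sqrt (2 * P.β₁) *
          Real.sqrt (5 / 2 / P.β₂) + 2 * A * Real.sqrt (5 / 2 / P.β₁)) * rate ε N := by
  have hX := hM.gridX hP
  have hY := hM.gridY hP
  have hA := hd.A_nonneg
  have he := hM.ε_pos
  have hL := hM.logDiv_pos
  have hτ := tau_pos N
  have hb1 := hP.β₁_pos
  have hb2 := hP.β₂_pos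
  have hl := one_le_sqrt_log hM
  have hse := Real.sqrt_pos.2 he
  have hc0 := transition_pos hP.β₁_pos hM.ε_pos hM.four_le
  have hc1 := transition_le P.β₁ ε N
  have cE := continuous_expX P ε
  have bd2 : Bd fun p => (Ioo 0 (1 - transition P.β₁ ε N)).indicator (expX P ε) p.1 :=
    bd_fst_indicator cE measurableSet_Ioo
  have bd3 : Bd fun p => (Ioo 0 1).indicator (expX P ε) p.1 *
      (Ioo (1 - transition P.β₂ ε N) 1).indicator (fun _ => (1 : ℝ)) p.2 :=
    (bd_fst_indicator cE measurableSet_Ioo).mul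
      (bd_snd_indicator continuous_const measurableSet_Ioo)
  have bd4 : Bd fun p => (Ioo (1 - transition P.β₁ ε N) 1).indicator (fun _ => (1 : ℝ)) p.1 :=
    bd_fst_indicator continuous_const measurableSet_Ioo
  have b1 := bd_const ((10 + 5 / P.β₂) * A * logDiv N)
  have b2 := bd2.const_mul (2 * A * ε⁻¹)
  have b3 := bd3.const_mul ((5 / P.β₁ + 5 / P.β₂) * Real.exp 5 * A * ε⁻¹ * logDiv N)
  have b4 := bd4.const_mul (2 * A * ε⁻¹ * tau N)
  have hn := nrm_mono (F := gradErr P ε N u E₁) (((b1.add b2).add b3).add b4)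
    (ae_of_otri hX hY fun k hk p hp => by
      have h := grad_err_pointwise hd hM hP hk hp
      rw [gradErr, stepFn_eq hX hY _ hk hp]
      have : {q : ℝ × ℝ | meshX P ε N (N / 2) < q.1}.indicator
          (fun q => stepFn N (meshX P ε N) (meshY P ε N)
            (slopeX (meshX P ε N) (meshY P ε N) E₁) q - pdx E₁ q) p =
          {q : ℝ × ℝ | meshX P ε N (N / 2) < q.1}.indicator
          (fun q => slopeX (meshX P ε N) (meshY P ε N) E₁ k - pdx E₁ q) p := by
        rw [indicator_apply, indicator_apply, stepFn_eq hX hY _ hk hp]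
      rw [this]
      exact h)
  have n2 : nrm (fun p => (Ioo 0 (1 - transition P.β₁ ε N)).indicator (expX P ε) p.1) ≤
      tau N * (Real.sqrt ε / Real.sqrt (2 * P.β₁)) := by
    have := nrm1_expX_le hM hP (c := 1 - transition P.β₁ ε N) (by linarith) (by linarith)
    rwa [expX_transition hM hP, ← nrm_fst] at this
  have n3 : nrm (fun p => (Ioo 0 1).indicator (expX P ε) p.1 *
      (Ioo (1 - transition P.β₂ ε N) 1).indicator (fun _ => (1 : ℝ)) p.2) ≤
      Real.sqrt ε / Real.sqrt (2 * P.β₁) *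
        (Real.sqrt (5 / 2 / P.β₂) * (Real.sqrt ε * Real.sqrt (Real.log N))) := by
    rw [nrm_prod]
    have h1 := nrm1_expX_le hM hP (c := 1) zero_le_one le_rfl
    have h2 := nrm1_layer_le hM.swap hP.swap
    change nrm1 ((Ioo (1 - transition P.β₂ ε N) 1).indicator fun _ => 1) ≤
      Real.sqrt (5 / 2 / P.β₂) * (Real.sqrt ε * Real.sqrt (Real.log N)) at h2
    refine mul_le_mul (h1.trans (mul_le_of_le_one_left (by positivity)
      (expX_le_one hM hP le_rfl))) h2 (nrm1_nonneg _) (by positivity)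
  have n4 : nrm (fun p => (Ioo (1 - transition P.β₁ ε N) 1).indicator (fun _ => (1 : ℝ)) p.1) ≤
      Real.sqrt (5 / 2 / P.β₁) * (Real.sqrt ε * Real.sqrt (Real.log N)) := by
    rw [nrm_fst]
    exact nrm1_layer_le hM hP
  have hs := hn.trans ((nrm_add_le ((b1.add b2).add b3) b4).trans (add_le_add_left
    ((nrm_add_le (b1.add b2) b3).trans (add_le_add_left (nrm_add_le b1 b2) _)) _))
  rw [nrm_const, nrm_const_mul, nrm_const_mul, nrm_const_mul, abs_of_nonneg (by positivity),
    abs_of_nonneg (by positivity), abs_of_nonneg (by positivity), abs_of_nonneg (by positivity)]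
    at hs
  have hee : Real.sqrt ε * Real.sqrt ε = ε := Real.mul_self_sqrt he.le
  set e := Real.sqrt ε with hedef
  set l := Real.sqrt (Real.log N)
  have r1 : e * logDiv N ≤ rate ε N :=
    (le_mul_of_one_le_right (by positivity) hl).trans (sqrt_mul_logDiv_le hM)
  have r2 := tau_le_rate hM
  have r3 := sqrt_mul_logDiv_le hM
  have r4 := tau_mul_sqrt_log_le hM
  calc e * nrm (gradErr P ε N u E₁) ≤ e * ((10 + 5 / P.β₂) * A * logDiv N
        + 2 * A * ε⁻¹ * (tau N * (e / Real.sqrt (2 * P.β₁)))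
        + (5 / P.β₁ + 5 / P.β₂) * Real.exp 5 * A * ε⁻¹ * logDiv N *
          (e / Real.sqrt (2 * P.β₁) * (Real.sqrt (5 / 2 / P.β₂) * (e * l)))
        + 2 * A * ε⁻¹ * tau N * (Real.sqrt (5 / 2 / P.β₁) * (e * l))) := by
        refine mul_le_mul_of_nonneg_left (hs.trans ?_) hse.le
        gcongr
    _ = (10 + 5 / P.β₂) * A * (e * logDiv N) + 2 * A / Real.sqrt (2 * P.β₁) * tau N
        + (5 / P.β₁ + 5 / P.β₂) * Real.exp 5 * A / Real.sqrt (2 * P.β₁) *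
          Real.sqrt (5 / 2 / P.β₂) * (e * logDiv N * l)
        + 2 * A * Real.sqrt (5 / 2 / P.β₁) * (tau N * l) := by
        rw [← hee]
        field_simp
    _ ≤ (10 + 5 / P.β₂) * A * rate ε N + 2 * A / Real.sqrt (2 * P.β₁) * rate ε N
        + (5 / P.β₁ + 5 / P.β₂) * Real.exp 5 * A / Real.sqrt (2 * P.β₁) *
          Real.sqrt (5 / 2 / P.β₂) * rate ε N
        + 2 * A * Real.sqrt (5 / 2 / P.β₁) * rate ε N := by
        gcongr
    _ = _ := by ring

/-- The superclose part of the gradient error. -/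
theorem exists_superclose_bound (hP : P.Admissible) (A : ℝ) : ∃ K : ℝ, 0 ≤ K ∧
    ∀ (ε : ℝ) (N : ℕ) (u S E₁ E₂ E₁₂ v : ℝ × ℝ → ℝ), MeshAssumption P ε N →
      IsLayerDecomposition P ε A u S E₁ E₂ E₁₂ → IsPL N (meshX P ε N) (meshY P ε N) v →
      (∀ p ∈ frontier Omega, v p = 0) →
      Real.sqrt ε * |∫ p in Omega, {q : ℝ × ℝ | meshX P ε N (N / 2) < q.1}.indicator
        (fun q => stepFn N (meshX P ε N) (meshY P ε N)
          (slopeX (meshX P ε N) (meshY P ε N) E₁) q - pdx E₁ q) p * pdx v p| ≤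
        K * rate ε N * nrm (pdx v) := by
  have hb1 := hP.β₁_pos
  set a := 5 / P.β₁ / 2 with ha
  have ha0 : 0 < a := by positivity
  -- The constant is fixed before any decomposition is given, and only a decomposition forces `A` to
  -- be nonnegative; hence the absolute values.
  refine ⟨(2 * a ^ 2 + 2 * ((a + 2) * a + (a + 2) * 2)) * |A| * Real.sqrt (5 / 2 / P.β₁) * 2
    + (5 / P.β₁ + 2) * |A| * Real.sqrt (5 / 2 / P.β₁) * 2, by positivity, ?_⟩
  intro ε N u S E₁ E₂ E₁₂ v hM hd hv h0
  have hX := hM.gridX hP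
  have hY := hM.gridY hP
  have hA := hd.A_nonneg
  rw [abs_of_nonneg hA]
  have he := hM.ε_pos
  have hL := hM.logDiv_pos
  have hl := one_le_sqrt_log hM
  have hN := hM.four_le
  have hNc := hM.cast_pos
  obtain ⟨m, hm⟩ := hM.even
  have hm2 : N / 2 = m := by omega
  set L := logDiv N with hLdef
  -- Third derivatives of sizes ε⁻³, ε⁻², ε⁻¹ meet two steps each, of order εL in x and at most 2L
  -- in y; every product is ε⁻¹L² up to a constant.
  set Q₁ := (2 * a ^ 2 + 2 * ((a + 2) * a + (a + 2) * 2)) * A * ε⁻¹ * L ^ 2 with hQ₁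
  set Q₂ := (5 / P.β₁ + 2) * A * ε⁻¹ * L with hQ₂
  have q1 : 0 ≤ Q₁ := by positivity
  have q2 : 0 ≤ Q₂ := by positivity
  have key := superclose_sum hX hY (hd.smooth_E₁.of_le (by norm_num)) hv h0 (M := N / 2)
    (by omega) q1 q2
    (fun i j hMi hi hj hjM => by
      have hmem : ∀ x ∈ Icc (meshX P ε N i) (meshX P ε N (i + 1)), ∀ y ∈ Icc (0 : ℝ) 1,
          (x, y) ∈ OmegaBar := fun x hx y hy =>
        ⟨⟨(hX.mem hi.le).1.trans hx.1, hx.2.trans (hX.mem (Nat.succ_le_of_lt hi)).2⟩, hy⟩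
      have hbd : ∀ x ∈ Icc (meshX P ε N i) (meshX P ε N (i + 1)), ∀ y ∈ Icc (0 : ℝ) 1,
          ∀ r s : ℕ, r + s ≤ 3 → |(pdx^[r] (pdy^[s] E₁)) (x, y)| ≤ A * (ε ^ r)⁻¹ :=
        fun x hx y hy r s hrs => (hd.bound_E₁ r s hrs _ (hmem x hx y hy)).trans
          (mul_le_of_le_one_right (by positivity) (expX_le_one hM hP (hmem x hx y hy).1.2))
      refine abs_gradDefect_add_le hX hY hd.smooth_E₁ hi hj ?_ (fun x hx y hy =>
        hbd x hx y hy 3 0 (by norm_num)) (fun x hx y hy => hbd x hx y hy 2 1 (by norm_num))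
        (fun x hx y hy => hbd x hx y hy 1 2 (by norm_num)) ?_
      -- Since `j + 1 ≠ N / 2`, the steps `j` and `j + 1` lie on the same side of the transition
      -- line.
      · rcases lt_or_ge (j + 1) (N / 2) with h | h
        · exact (node_step_coarse h).trans (node_step_coarse (by omega)).symm
        · exact (node_step_fine (by omega) hM.even h).trans
            (node_step_fine (by omega) hM.even (by omega)).symm
      · have g2 := sub_nonneg.2 (hY.lt j (by omega)).le
        have s2 : meshY P ε N (j + 1) - meshY P ε N j ≤ 2 * L :=
          stepX_le_logDiv hM.swap hP.swap j
        have hs : (meshX P ε N (i + 1) - meshX P ε N i) / 2 = a * (ε * L) := by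
          rw [stepX_fine hM hMi, ha]
          ring
        rw [hs, pow_one]
        calc _ ≤ 2 * (A * (ε ^ 3)⁻¹ * (a * (ε * L)) ^ 2) + 2 * ((A * (ε ^ 3)⁻¹ * (a * (ε * L))
              + A * (ε ^ 2)⁻¹ * (2 * L)) * (a * (ε * L)) + (A * (ε ^ 2)⁻¹ * (a * (ε * L))
              + A * ε⁻¹ * (2 * L)) * (2 * L)) := by gcongr
          _ = Q₁ := by rw [hQ₁]; field_simp)
    (fun k hk hMk => abs_gradDefect_le hX hY hk fun p hp =>
      slopeX_E₁_fine_err hd hM hP hk hMk (otri_subset_cell hX hY hk hp))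
  set D₁ := {p : ℝ × ℝ | meshX P ε N (N / 2) < p.1}
  set D₂ := {p : ℝ × ℝ | meshX P ε N (N / 2) < p.1 ∧ meshY P ε N (N / 2 - 1) < p.2 ∧
    p.2 < meshY P ε N (N / 2 + 1)}
  have mD₁ : MeasurableSet D₁ := measurableSet_lt measurable_const measurable_fst
  have mD₂ : MeasurableSet D₂ := mD₁.inter
    ((measurableSet_lt measurable_const measurable_snd).inter
      (measurableSet_lt measurable_snd measurable_const))
  have bW₁ := (bd_const Q₁).indicator mD₁
  have bW₂ := (bd_const Q₂).indicator mD₂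
  -- The height of the exceptional rows; its square root is the factor N^(-1/2) that compensates the
  -- first order bound `Q₂`.
  have hb : meshY P ε N (N / 2 + 1) - meshY P ε N (N / 2 - 1) ≤ 4 / N := by
    have h1 : meshY P ε N (N / 2 + 1) - meshY P ε N (N / 2) ≤ 2 / N :=
      stepX_le hM.swap hP.swap (N / 2)
    have h2 : meshY P ε N (N / 2 - 1 + 1) - meshY P ε N (N / 2 - 1) ≤ 2 / N :=
      stepX_le hM.swap hP.swap (N / 2 - 1)
    rw [Nat.sub_add_cancel (by omega)] at h2
    have : (4 : ℝ) / N = 2 / N + 2 / N := by ring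
    linarith
  have c4 : Real.sqrt (4 / N) = 2 / Real.sqrt N := by
    rw [Real.sqrt_div (by norm_num), show (4 : ℝ) = 2 ^ 2 by norm_num,
      Real.sqrt_sq (by norm_num)]
  have ind1 : Bd fun p => (Ioo (1 - transition P.β₁ ε N) 1).indicator (fun _ => (1 : ℝ)) p.1 :=
    bd_fst_indicator continuous_const measurableSet_Ioo
  have ind2 : Bd fun p => (Ioo (meshY P ε N (N / 2 - 1)) (meshY P ε N (N / 2 + 1))).indicator
      (fun _ => (1 : ℝ)) p.2 := bd_snd_indicator continuous_const measurableSet_Ioo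
  have nD₁ : nrm (D₁.indicator fun _ => Q₁) ≤
      Q₁ * (Real.sqrt (5 / 2 / P.β₁) * (Real.sqrt ε * Real.sqrt (Real.log N))) := by
    have h1 : nrm (D₁.indicator fun _ => Q₁) ≤ nrm fun p => Q₁ *
        (Ioo (1 - transition P.β₁ ε N) 1).indicator (fun _ => (1 : ℝ)) p.1 := by
      refine nrm_mono (ind1.const_mul _) ?_
      filter_upwards [ae_mem_Omega] with p hp
      by_cases h : p ∈ D₁
      · have h' : meshX P ε N (N / 2) < p.1 := h
        rw [meshX_half hM] at h'
        rw [indicator_of_mem h, indicator_of_mem (show p.1 ∈ Ioo _ _ from ⟨h', hp.1.2⟩),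
          abs_of_nonneg q1, mul_one]
      · rw [indicator_of_notMem h, abs_zero]
        exact mul_nonneg q1 (indicator_nonneg (fun _ _ => zero_le_one) _)
    refine h1.trans ?_
    rw [nrm_const_mul, abs_of_nonneg q1, nrm_fst]
    exact mul_le_mul_of_nonneg_left (nrm1_layer_le hM hP) q1
  have nD₂ : nrm (D₂.indicator fun _ => Q₂) ≤
      Q₂ * ((Real.sqrt (5 / 2 / P.β₁) * (Real.sqrt ε * Real.sqrt (Real.log N))) *
        (2 / Real.sqrt N)) := by
    have h1 : nrm (D₂.indicator fun _ => Q₂) ≤ nrm fun p => Q₂ *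
        ((Ioo (1 - transition P.β₁ ε N) 1).indicator (fun _ => (1 : ℝ)) p.1 *
        (Ioo (meshY P ε N (N / 2 - 1)) (meshY P ε N (N / 2 + 1))).indicator
          (fun _ => (1 : ℝ)) p.2) := by
      refine nrm_mono ((ind1.mul ind2).const_mul _) ?_
      filter_upwards [ae_mem_Omega] with p hp
      by_cases h : p ∈ D₂
      · have hD : p ∈ D₂ := h
        obtain ⟨h', h''⟩ : meshX P ε N (N / 2) < p.1 ∧ meshY P ε N (N / 2 - 1) < p.2 ∧
          p.2 < meshY P ε N (N / 2 + 1) := h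
        rw [meshX_half hM] at h'
        rw [indicator_of_mem hD, indicator_of_mem (show p.1 ∈ Ioo _ _ from ⟨h', hp.1.2⟩),
          indicator_of_mem (show p.2 ∈ Ioo _ _ from h''), abs_of_nonneg q2, mul_one, mul_one]
      · rw [indicator_of_notMem h, abs_zero]
        exact mul_nonneg q2 (mul_nonneg (indicator_nonneg (fun _ _ => zero_le_one) _)
          (indicator_nonneg (fun _ _ => zero_le_one) _))
    refine h1.trans ?_
    rw [nrm_const_mul, abs_of_nonneg q2, nrm_prod, ← c4]
    refine mul_le_mul_of_nonneg_left (mul_le_mul (nrm1_layer_le hM hP)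
      ((nrm1_indicator_Ioo_le (hY.le (by omega) (by omega))).trans (Real.sqrt_le_sqrt hb))
      (nrm1_nonneg _) (by positivity)) q2
  have hpc := hv.pc1 hX hY
  have hcs := (le_abs_self _).trans (abs_integral_mul_le (bW₁.add bW₂) hpc.bdx.abs)
  rw [nrm_abs] at hcs
  have hfin := key.trans (hcs.trans (mul_le_mul_of_nonneg_right
    ((nrm_add_le bW₁ bW₂).trans (add_le_add nD₁ nD₂)) (nrm_nonneg _)))
  have hse := Real.sqrt_pos.2 he
  have hsn := Real.sqrt_pos.2 hNc
  have hee : Real.sqrt ε * Real.sqrt ε = ε := Real.mul_self_sqrt he.le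
  have r1 := logDiv_sq_le hM
  have r2 := logDiv_div_le hM
  have hnv := nrm_nonneg (pdx v)
  refine (mul_le_mul_of_nonneg_left hfin hse.le).trans ?_
  set e := Real.sqrt ε
  set l := Real.sqrt (Real.log N)
  rw [← mul_assoc]
  refine mul_le_mul_of_nonneg_right ?_ hnv
  calc _ = (2 * a ^ 2 + 2 * ((a + 2) * a + (a + 2) * 2)) * A * Real.sqrt (5 / 2 / P.β₁) *
          (L ^ 2 * l) + (5 / P.β₁ + 2) * A * Real.sqrt (5 / 2 / P.β₁) * 2 *
          (L * l / Real.sqrt N) := by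
        rw [hQ₁, hQ₂, ← hee]
        field_simp
    _ ≤ (2 * a ^ 2 + 2 * ((a + 2) * a + (a + 2) * 2)) * A * Real.sqrt (5 / 2 / P.β₁) *
          (2 * rate ε N) + (5 / P.β₁ + 2) * A * Real.sqrt (5 / 2 / P.β₁) * 2 *
          rate ε N := by gcongr
    _ = _ := by ring

theorem exists_stiffness_bound_fst (hP : P.Admissible) (A : ℝ) : ∃ K : ℝ, 0 ≤ K ∧
    ∀ (ε : ℝ) (N : ℕ) (u S E₁ E₂ E₁₂ v : ℝ × ℝ → ℝ), MeshAssumption P ε N →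
      IsLayerDecomposition P ε A u S E₁ E₂ E₁₂ → IsPL N (meshX P ε N) (meshY P ε N) v →
      (∀ p ∈ frontier Omega, v p = 0) →
      Real.sqrt ε * |∫ p in Omega, (stepFn N (meshX P ε N) (meshY P ε N)
          (slopeX (meshX P ε N) (meshY P ε N) u) p - pdx u p) * pdx v p| ≤
        K * rate ε N * nrm (pdx v) := by
  obtain ⟨K, hK, h⟩ := exists_superclose_bound hP A
  have hb1 := hP.β₁_pos
  have hb2 := hP.β₂_pos
  refine ⟨(10 + 5 / P.β₂) * |A| + 2 * |A| / Real.sqrt (2 * P.β₁)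
        + (5 / P.β₁ + 5 / P.β₂) * Real.exp 5 * |A| / Real.sqrt (2 * P.β₁) *
          Real.sqrt (5 / 2 / P.β₂) + 2 * |A| * Real.sqrt (5 / 2 / P.β₁) + K, by positivity, ?_⟩
  intro ε N u S E₁ E₂ E₁₂ v hM hd hv h0
  have hX := hM.gridX hP
  have hY := hM.gridY hP
  have hI := h ε N u S E₁ E₂ E₁₂ v hM hd hv h0
  have hG := sqrt_mul_nrm_gradErr_le hd hM hP
  rw [abs_of_nonneg hd.A_nonneg]
  have hpc := hv.pc1 hX hY
  have bu : Bd (pdx u) := bd_of_continuousOn (continuousOn_pdx (hd.contDiffOn.of_le (by norm_num)))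
  have bE : Bd (pdx E₁) :=
    bd_of_continuousOn (continuousOn_pdx (hd.smooth_E₁.of_le (by norm_num)))
  have mD : MeasurableSet {q : ℝ × ℝ | meshX P ε N (N / 2) < q.1} :=
    measurableSet_lt measurable_const measurable_fst
  have bI := ((bd_stepFn (N := N) (X := meshX P ε N) (Y := meshY P ε N)
    (slopeX (meshX P ε N) (meshY P ε N) E₁)).sub bE).indicator mD
  have bG : Bd (gradErr P ε N u E₁) := ((bd_stepFn _).sub bu).sub bI
  have hsplit : ∫ p in Omega, (stepFn N (meshX P ε N) (meshY P ε N)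
      (slopeX (meshX P ε N) (meshY P ε N) u) p - pdx u p) * pdx v p =
      (∫ p in Omega, gradErr P ε N u E₁ p * pdx v p) +
      ∫ p in Omega, {q : ℝ × ℝ | meshX P ε N (N / 2) < q.1}.indicator
        (fun q => stepFn N (meshX P ε N) (meshY P ε N)
          (slopeX (meshX P ε N) (meshY P ε N) E₁) q - pdx E₁ q) p * pdx v p := by
    rw [← integral_add (bG.mul hpc.bdx).integrable (bI.mul hpc.bdx).integrable]
    refine integral_congr_ae (Filter.Eventually.of_forall fun p => ?_)
    simp only [gradErr]
    ring
  have hse := Real.sqrt_nonneg ε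
  have hcs := abs_integral_mul_le bG hpc.bdx
  rw [hsplit]
  calc _ ≤ Real.sqrt ε * (nrm (gradErr P ε N u E₁) * nrm (pdx v) + |∫ p in Omega,
      {q : ℝ × ℝ | meshX P ε N (N / 2) < q.1}.indicator (fun q => stepFn N (meshX P ε N)
        (meshY P ε N) (slopeX (meshX P ε N) (meshY P ε N) E₁) q - pdx E₁ q) p * pdx v p|) :=
        mul_le_mul_of_nonneg_left ((abs_add_le _ _).trans (by linarith)) hse
    _ ≤ _ := by
        rw [mul_add, ← mul_assoc, add_mul _ K, add_mul _ _ (nrm (pdx v))]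
        exact add_le_add (mul_le_mul_of_nonneg_right hG (nrm_nonneg _)) hI

end stiffness

end SDFEM

/-! ### The setting of the error analysis, and bounds on the coarse region -/

namespace SDFEM

/-- A function with a layer decomposition, its nodal interpolant and a discrete test function. -/
structure ErrorSetting (P : Coeffs) (ε A : ℝ) (N : ℕ) (u uI v : ℝ × ℝ → ℝ) : Prop where
  mesh : MeshAssumption P ε N
  layers : HasLayerDecomposition P ε A u
  interp : IsPL N (meshX P ε N) (meshY P ε N) uI
  nodal : ∀ i j, i ≤ N → j ≤ N →
    uI (meshX P ε N i, meshY P ε N j) = u (meshX P ε N i, meshY P ε N j)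
  test : IsPL N (meshX P ε N) (meshY P ε N) v
  boundary : ∀ p ∈ frontier Omega, v p = 0

theorem ErrorSetting.swap {P : Coeffs} {ε A : ℝ} {N : ℕ} {u uI v : ℝ × ℝ → ℝ}
    (h : ErrorSetting P ε A N u uI v) :
    ErrorSetting P.swap ε A N (u ∘ Prod.swap) (uI ∘ Prod.swap) (v ∘ Prod.swap) where
  mesh := h.mesh.swap
  layers := by
    obtain ⟨S, E₁, E₂, E₁₂, hd⟩ := h.layers
    exact ⟨_, _, _, _, hd.swap⟩
  interp := h.interp.swap
  nodal i j hi hj := h.nodal j i hj hi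
  test := h.test.swap
  boundary p hp := h.boundary _ (by
    rw [mem_frontier_Omega] at hp ⊢
    exact ⟨swap_mem_OmegaBar.2 hp.1, by simp only [Prod.fst_swap, Prod.snd_swap]; tauto⟩)

section nodal

variable {P : Coeffs} {ε A : ℝ} {N : ℕ} {u uI v : ℝ × ℝ → ℝ}

theorem ErrorSetting.nodal_cell (h : ErrorSetting P ε A N u uI v) {k : ℕ × ℕ × Bool}
    (hk : k ∈ triIndex N) :
    (let X := meshX P ε N; let Y := meshY P ε N
     uI (corner X k.1 k.2.2, corner Y k.2.1 k.2.2) = u (corner X k.1 k.2.2, corner Y k.2.1 k.2.2) ∧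
     uI (corner X k.1 k.2.2 + leg X k.1 k.2.2, corner Y k.2.1 k.2.2) =
       u (corner X k.1 k.2.2 + leg X k.1 k.2.2, corner Y k.2.1 k.2.2) ∧
     uI (corner X k.1 k.2.2, corner Y k.2.1 k.2.2 + leg Y k.2.1 k.2.2) =
       u (corner X k.1 k.2.2, corner Y k.2.1 k.2.2 + leg Y k.2.1 k.2.2)) := by
  obtain ⟨h1, h2⟩ := mem_triIndex.1 hk
  obtain ⟨i, j, _ | _⟩ := k <;>
  · simp only [corner, leg, cond, add_sub_cancel] at *
    exact ⟨h.nodal _ _ (by omega) (by omega), h.nodal _ _ (by omega) (by omega),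
      h.nodal _ _ (by omega) (by omega)⟩

theorem ErrorSetting.slopeX_eq (h : ErrorSetting P ε A N u uI v) {k : ℕ × ℕ × Bool}
    (hk : k ∈ triIndex N) :
    slopeX (meshX P ε N) (meshY P ε N) uI k = slopeX (meshX P ε N) (meshY P ε N) u k := by
  obtain ⟨h0, h1, -⟩ := h.nodal_cell hk
  rw [slopeX, slopeX, h0, h1]

theorem ErrorSetting.loc_eq (h : ErrorSetting P ε A N u uI v) {k : ℕ × ℕ × Bool}
    (hk : k ∈ triIndex N) (p : ℝ × ℝ) :
    loc (meshX P ε N) (meshY P ε N) uI k p = loc (meshX P ε N) (meshY P ε N) u k p := by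
  obtain ⟨h0, h1, h2⟩ := h.nodal_cell hk
  rw [loc, loc, affInterp, affInterp, h0, h1, h2]

theorem ErrorSetting.contDiffOn (h : ErrorSetting P ε A N u uI v) :
    ContDiffOn ℝ 2 u OmegaBar := by
  obtain ⟨S, E₁, E₂, E₁₂, hd⟩ := h.layers
  exact hd.contDiffOn

theorem ErrorSetting.A_nonneg (h : ErrorSetting P ε A N u uI v) : 0 ≤ A := by
  obtain ⟨S, E₁, E₂, E₁₂, hd⟩ := h.layers
  exact hd.A_nonneg

theorem ErrorSetting.pc1_u (h : ErrorSetting P ε A N u uI v) (hP : P.Admissible) :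
    PC1 N (meshX P ε N) (meshY P ε N) u :=
  pc1_of_contDiffOn (h.mesh.gridX hP) (h.mesh.gridY hP) (h.contDiffOn.of_le (by norm_num))

theorem ErrorSetting.pc1_uI (h : ErrorSetting P ε A N u uI v) (hP : P.Admissible) :
    PC1 N (meshX P ε N) (meshY P ε N) uI :=
  h.interp.pc1 (h.mesh.gridX hP) (h.mesh.gridY hP)

theorem ErrorSetting.pc1_v (h : ErrorSetting P ε A N u uI v) (hP : P.Admissible) :
    PC1 N (meshX P ε N) (meshY P ε N) v :=
  h.test.pc1 (h.mesh.gridX hP) (h.mesh.gridY hP)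

end nodal

theorem exists_stiffness_bound_pdx {P : Coeffs} (hP : P.Admissible) (A : ℝ) : ∃ K : ℝ, 0 ≤ K ∧
    ∀ (ε : ℝ) (N : ℕ) (u uI v : ℝ × ℝ → ℝ), ErrorSetting P ε A N u uI v →
      Real.sqrt ε * |∫ p in Omega, (pdx uI p - pdx u p) * pdx v p| ≤
        K * rate ε N * nrm (pdx v) := by
  obtain ⟨K, hK, h⟩ := exists_stiffness_bound_fst hP A
  refine ⟨K, hK, fun ε N u uI v hs => ?_⟩
  obtain ⟨S, E₁, E₂, E₁₂, hd⟩ := hs.layers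
  have hX := hs.mesh.gridX hP
  have hY := hs.mesh.gridY hP
  refine le_trans (le_of_eq ?_) (h ε N u S E₁ E₂ E₁₂ v hs.mesh hd hs.test hs.boundary)
  congr 2
  refine integral_congr_ae (ae_of_otri hX hY fun k hk p hp => ?_)
  simp only
  rw [hs.interp.pdx_eq hX hY hk hp, stepFn_eq hX hY _ hk hp, hs.slopeX_eq hk]

theorem exists_stiffness_bound_pdy {P : Coeffs} (hP : P.Admissible) (A : ℝ) : ∃ K : ℝ, 0 ≤ K ∧
    ∀ (ε : ℝ) (N : ℕ) (u uI v : ℝ × ℝ → ℝ), ErrorSetting P ε A N u uI v →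
      Real.sqrt ε * |∫ p in Omega, (pdy uI p - pdy u p) * pdy v p| ≤
        K * rate ε N * nrm (pdy v) := by
  obtain ⟨K, hK, h⟩ := exists_stiffness_bound_pdx hP.swap A
  refine ⟨K, hK, fun ε N u uI v hs => ?_⟩
  have h1 := h ε N _ _ _ hs.swap
  have h2 : nrm (pdx (v ∘ Prod.swap)) = nrm (pdy v) := nrm_swap (pdy v)
  have h3 := integral_swap fun p => (pdy uI p - pdy u p) * pdy v p
  rw [h2] at h1
  rw [← h3]
  exact h1

section pointwise

variable {P : Coeffs} {ε A : ℝ} {N : ℕ} {u uI v : ℝ × ℝ → ℝ}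

/-- Constant in the interpolation error in the layers. -/
noncomputable def layerConst (P : Coeffs) (A : ℝ) : ℝ :=
  ((5 / P.β₁ + 2) ^ 2 + (5 / P.β₂ + 2) ^ 2 + (5 / P.β₁ + 5 / P.β₂) ^ 2) * A

theorem ErrorSetting.abs_err_le (h : ErrorSetting P ε A N u uI v) (hP : P.Admissible)
    {k : ℕ × ℕ × Bool} (hk : k ∈ triIndex N) {p : ℝ × ℝ}
    (hp : p ∈ otri (meshX P ε N) (meshY P ε N) k) : |(uI - u) p| ≤
      22 * A / (N : ℝ) ^ 2 + layerConst P A * logDiv N ^ 2 * (1 - chi P ε N p) := by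
  obtain ⟨S, E₁, E₂, E₁₂, hd⟩ := h.layers
  rw [Pi.sub_apply, h.interp.eq_loc (h.mesh.gridX hP) (h.mesh.gridY hP) hk hp, h.loc_eq hk]
  exact loc_err_pointwise hd h.mesh hP hk hp

theorem ErrorSetting.ae_err (h : ErrorSetting P ε A N u uI v) (hP : P.Admissible) :
    ∀ᵐ p ∂(volume.restrict Omega), |(uI - u) p| ≤
      22 * A / (N : ℝ) ^ 2 + layerConst P A * logDiv N ^ 2 * (1 - chi P ε N p) :=
  ae_of_otri (h.mesh.gridX hP) (h.mesh.gridY hP) fun _ hk _ hp => h.abs_err_le hP hk hp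

/-- Up to a null set the layers are covered by two strips, of widths proportional to ε ln N. -/
theorem nrm_one_sub_chi_le (hM : MeshAssumption P ε N) (hP : P.Admissible) :
    nrm (fun p => 1 - chi P ε N p) ≤ (Real.sqrt (5 / 2 / P.β₁) + Real.sqrt (5 / 2 / P.β₂)) *
      (Real.sqrt ε * Real.sqrt (Real.log N)) := by
  have b1 : Bd fun p => (Ioo (1 - transition P.β₁ ε N) 1).indicator (fun _ => (1 : ℝ)) p.1 :=
    bd_fst_indicator continuous_const measurableSet_Ioo
  have b2 : Bd fun p => (Ioo (1 - transition P.β₂ ε N) 1).indicator (fun _ => (1 : ℝ)) p.2 :=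
    bd_snd_indicator continuous_const measurableSet_Ioo
  have h1 := nrm1_layer_le hM hP
  have h2 := nrm1_layer_le hM.swap hP.swap
  change nrm1 ((Ioo (1 - transition P.β₂ ε N) 1).indicator fun _ => 1) ≤
      Real.sqrt (5 / 2 / P.β₂) * (Real.sqrt ε * Real.sqrt (Real.log N)) at h2
  have h2' : nrm (fun p => (Ioo (1 - transition P.β₂ ε N) 1).indicator (fun _ => (1 : ℝ)) p.2) =
      nrm1 ((Ioo (1 - transition P.β₂ ε N) 1).indicator fun _ => 1) := by
    rw [← nrm_fst, ← nrm_swap]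
    rfl
  rw [← nrm_fst] at h1
  rw [← h2'] at h2
  have hX := hM.gridX hP
  have hY := hM.gridY hP
  have hn := nrm_mono (F := fun p => 1 - chi P ε N p) (b1.add b2)
    (ae_of_otri hX hY fun k hk p hp => by
      have hΩ := otri_subset_Omega hX hY hk hp
      have hx := meshX_half_lt_iff hM hP hk hp
      have hy : N / 2 ≤ k.2.1 ↔ 1 - transition P.β₂ ε N < p.2 :=
        meshX_half_lt_iff hM.swap hP.swap (k := (k.2.1, k.1, k.2.2))
          (mem_triIndex.2 (mem_triIndex.1 hk).symm) (swap_mem_otri.2 hp)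
      have i1 : 0 ≤ (Ioo (1 - transition P.β₁ ε N) 1).indicator (fun _ => (1 : ℝ)) p.1 :=
        indicator_nonneg (fun _ _ => zero_le_one) _
      have i2 : 0 ≤ (Ioo (1 - transition P.β₂ ε N) 1).indicator (fun _ => (1 : ℝ)) p.2 :=
        indicator_nonneg (fun _ _ => zero_le_one) _
      obtain ⟨m1, m2⟩ := mem_triIndex.1 hk
      obtain ⟨o1, o2, o3, o4⟩ := otri_bounds hX hY m1 m2 hp
      rw [abs_of_nonneg (by have := chi_le_one (P := P) (ε := ε) (N := N) p; linarith)]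
      have hc0 := chi_nonneg (P := P) (ε := ε) (N := N) p
      rcases lt_or_ge k.1 (N / 2) with a | a
      · rcases lt_or_ge k.2.1 (N / 2) with b | b
        · have hc : p ∈ coarse P ε N := ⟨(lt_half_iff hM hX m1 o1 o2).1 a,
            (lt_half_iff hM.swap hY m2 o3 o4).1 b⟩
          have : chi P ε N p = 1 := indicator_of_mem hc _
          linarith
        · rw [indicator_of_mem (show p.2 ∈ Ioo _ _ from ⟨hy.1 b, hΩ.2.2⟩)]
          linarith
      · rw [indicator_of_mem (show p.1 ∈ Ioo _ _ from ⟨hx.1 a, hΩ.1.2⟩)]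
        linarith)
  rw [add_mul]
  exact hn.trans ((nrm_add_le b1 b2).trans (add_le_add h1 h2))

theorem ErrorSetting.pdx_err_coarse (h : ErrorSetting P ε A N u uI v) (hP : P.Admissible)
    {k : ℕ × ℕ × Bool} (hk : k ∈ triIndex N) {p : ℝ × ℝ}
    (hp : p ∈ otri (meshX P ε N) (meshY P ε N) k) (hc : p ∈ coarse P ε N) :
    |pdx uI p - pdx u p| ≤ (10 + 5 / P.β₂) * A * logDiv N + 2 * A * (ε⁻¹ * expX P ε p.1) := by
  obtain ⟨S, E₁, E₂, E₁₂, hd⟩ := h.layers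
  have hX := h.mesh.gridX hP
  have hY := h.mesh.gridY hP
  have hΩ := otri_subset_Omega hX hY hk hp
  have g := grad_err_pointwise hd h.mesh hP hk hp
  have c1 : p.1 < 1 - transition P.β₁ ε N := hc.1
  have c2 : p.2 < 1 - transition P.β₂ ε N := hc.2
  rw [indicator_of_notMem (s := {q : ℝ × ℝ | meshX P ε N (N / 2) < q.1}) (by
      rw [mem_ofPred_eq, meshX_half h.mesh]; exact not_lt.2 c1.le),
    indicator_of_mem (show p.1 ∈ Ioo 0 (1 - transition P.β₁ ε N) from ⟨hΩ.1.1, c1⟩),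
    indicator_of_notMem (show p.2 ∉ Ioo (1 - transition P.β₂ ε N) 1 from fun h' =>
      absurd h'.1 (not_lt.2 c2.le)),
    indicator_of_notMem (show p.1 ∉ Ioo (1 - transition P.β₁ ε N) 1 from fun h' =>
      absurd h'.1 (not_lt.2 c1.le)), sub_zero, mul_zero, mul_zero, mul_zero, add_zero, add_zero]
    at g
  rw [h.interp.pdx_eq hX hY hk hp, h.slopeX_eq hk, ← mul_assoc]
  exact g

/-- S and E₂ have bounded second x-derivative and contribute ε, which is at most L by the assumption
ε ≤ N⁻¹; E₁ and E₁₂ contribute ε · ε⁻² times the exponential. -/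
theorem ErrorSetting.abs_pdx_pdx_le (h : ErrorSetting P ε A N u uI v) (hP : P.Admissible)
    {p : ℝ × ℝ} (hp : p ∈ OmegaBar) :
    ε * |pdx (pdx u) p| ≤ 2 * A * logDiv N + 2 * A * (ε⁻¹ * expX P ε p.1) := by
  obtain ⟨S, E₁, E₂, E₁₂, hd⟩ := h.layers
  have he := h.mesh.ε_pos
  have hA := h.A_nonneg
  have e1 := hd.bound_S 2 0 (by norm_num) p hp
  have e2 := hd.bound_E₁ 2 0 (by norm_num) p hp
  have e3 := hd.bound_E₂ 2 0 (by norm_num) p hp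
  have e4 := hd.abs_E₁₂_le_fst h.mesh hP (i := 2) (j := 0) (by norm_num) hp
  have e3' : |(pdx^[2] (pdy^[0] E₂)) p| ≤ A := by
    refine e3.trans ?_
    rw [pow_zero, inv_one, mul_one]
    exact mul_le_of_le_one_right hA (expX_le_one h.mesh.swap hP.swap hp.2.2)
  have hsum : |pdx (pdx u) p| ≤ 2 * A + 2 * A * (ε ^ 2)⁻¹ * expX P ε p.1 := by
    rw [hd.pdx_pdx_eq hp]
    have t : ∀ a b c d : ℝ, |a + b + c + d| ≤ |a| + |b| + |c| + |d| := fun a b c d =>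
      (abs_add_le _ _).trans (add_le_add_left ((abs_add_le _ _).trans
        (add_le_add_left (abs_add_le _ _) _)) _)
    refine (t _ _ _ _).trans ?_
    have : |(pdx^[2] (pdy^[0] E₁)) p| ≤ A * (ε ^ 2)⁻¹ * expX P ε p.1 := e2
    have e4' : |(pdx^[2] (pdy^[0] E₁₂)) p| ≤ A * (ε ^ 2)⁻¹ * expX P ε p.1 := e4
    simp only [Function.iterate_succ, Function.iterate_zero, Function.comp_apply, id] at *
    linarith
  calc ε * |pdx (pdx u) p| ≤ ε * (2 * A + 2 * A * (ε ^ 2)⁻¹ * expX P ε p.1) := by gcongr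
    _ = 2 * A * ε + 2 * A * (ε⁻¹ * expX P ε p.1) := by field_simp
    _ ≤ _ := by have := h.mesh.ε_le_logDiv; gcongr

/-- Coarse steps are at least 1/N in both directions, so the inverse estimate loses N⁴ in the
square; 23² = 529 exceeds its constant 512. -/
theorem ErrorSetting.abs_pdx_le_inverse (h : ErrorSetting P ε A N u uI v) (hP : P.Admissible)
    {k : ℕ × ℕ × Bool} (hk : k ∈ triIndex N) {p : ℝ × ℝ}
    (hp : p ∈ otri (meshX P ε N) (meshY P ε N) k) (hc : p ∈ coarse P ε N) :
    |pdx v p| ≤ 23 * (N : ℝ) ^ 2 * nrm v := by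
  have hX := h.mesh.gridX hP
  have hY := h.mesh.gridY hP
  have hN := h.mesh.cast_pos
  obtain ⟨m1, m2⟩ := mem_triIndex.1 hk
  obtain ⟨o1, o2, o3, o4⟩ := otri_bounds hX hY m1 m2 hp
  have k1 := (lt_half_iff h.mesh hX m1 o1 o2).2 hc.1
  have k2 := (lt_half_iff h.mesh.swap hY m2 o3 o4).2 hc.2
  have s1 := stepX_coarse_ge h.mesh k1
  have s2 : 1 / (N : ℝ) ≤ meshY P ε N (k.2.1 + 1) - meshY P ε N k.2.1 :=
    stepX_coarse_ge h.mesh.swap k2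
  have hi := inverse_estimate_fst hX hY h.test hk
  rw [h.test.pdx_eq hX hY hk hp]
  set s := slopeX (meshX P ε N) (meshY P ε N) v k
  have hn := nrm_nonneg v
  have h1 : s ^ 2 * (1 / (N : ℝ)) ^ 3 * (1 / (N : ℝ)) ≤ 512 * nrm v ^ 2 := by
    refine le_trans ?_ hi
    have : 0 < 1 / (N : ℝ) := by positivity
    gcongr
    exact mul_nonneg (sq_nonneg _) (pow_nonneg (this.le.trans s1) _)
  have h2 : s ^ 2 ≤ 512 * nrm v ^ 2 * (N : ℝ) ^ 4 := by
    have : s ^ 2 * (1 / (N : ℝ)) ^ 3 * (1 / (N : ℝ)) = s ^ 2 / (N : ℝ) ^ 4 := by field_simp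
    rwa [this, div_le_iff₀ (by positivity)] at h1
  refine abs_le_of_sq_le_sq (h2.trans ?_) (by positivity)
  have : 0 ≤ nrm v ^ 2 * (N : ℝ) ^ 4 := by positivity
  nlinarith

end pointwise

end SDFEM

/-! ### The convection and reaction terms -/

namespace SDFEM

/-- A common bound for the coefficients. -/
theorem exists_coeff_bound {P : Coeffs} (hP : P.Admissible) : ∃ B : ℝ, 0 ≤ B ∧ ∀ p ∈ OmegaBar,
    |P.b₁ p| ≤ B ∧ |P.b₂ p| ≤ B ∧ |P.c p| ≤ B ∧ |P.c p - (pdx P.b₁ p + pdy P.b₂ p)| ≤ B := by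
  have key : ∀ g : ℝ × ℝ → ℝ, ContinuousOn g OmegaBar → ∃ B, ∀ p ∈ OmegaBar, |g p| ≤ B :=
    fun g hg => isCompact_OmegaBar.exists_bound_of_continuousOn hg
  obtain ⟨B₁, h₁⟩ := key _ hP.smooth_b₁.continuousOn
  obtain ⟨B₂, h₂⟩ := key _ hP.smooth_b₂.continuousOn
  obtain ⟨B₃, h₃⟩ := key _ hP.cont_c
  obtain ⟨B₄, h₄⟩ := key _ (hP.cont_c.sub
    ((continuousOn_pdx hP.smooth_b₁).add (continuousOn_pdy hP.smooth_b₂)))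
  have a1 := le_abs_self B₁
  have a2 := le_abs_self B₂
  have a3 := le_abs_self B₃
  have a4 := le_abs_self B₄
  have n1 := abs_nonneg B₁
  have n2 := abs_nonneg B₂
  have n3 := abs_nonneg B₃
  have n4 := abs_nonneg B₄
  refine ⟨|B₁| + |B₂| + |B₃| + |B₄|, by positivity, fun p hp => ⟨?_, ?_, ?_, ?_⟩⟩
  · linarith [h₁ p hp]
  · linarith [h₂ p hp]
  · linarith [h₃ p hp]
  · exact (h₄ p hp).trans (by linarith)

section norms

variable {P : Coeffs} {ε A Cstar : ℝ} {N : ℕ} {u uI v : ℝ × ℝ → ℝ}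

theorem sdNorm_sq (hM : MeshAssumption P ε N) (hP : P.Admissible) (hC : 0 ≤ Cstar)
    (hv : IsPL N (meshX P ε N) (meshY P ε N) v) : sdNorm P ε N Cstar v ^ 2 =
      ε * (nrm (pdx v) ^ 2 + nrm (pdy v) ^ 2) + P.μ₀ * nrm v ^ 2
      + Cstar * (N : ℝ)⁻¹ * nrm (fun p => chi P ε N p * P.conv v p) ^ 2 := by
  rw [sdNorm, Real.sq_sqrt (sdSq_nonneg hM hP hC hv), sdSq_eq hM hP Cstar hv]

theorem sqrt_mul_le_of_sq {a x y : ℝ} (ha : 0 ≤ a) (hy : 0 ≤ y) (h : a * x ^ 2 ≤ y ^ 2) :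
    Real.sqrt a * x ≤ y := by
  refine le_of_abs_le (abs_le_of_sq_le_sq ?_ hy)
  rwa [mul_pow, Real.sq_sqrt ha]

theorem sdNorm_nonneg : 0 ≤ sdNorm P ε N Cstar v := Real.sqrt_nonneg _

/-- On the coarse region the streamline derivative costs only N^(1/2), against ε^(-1/2) for the full
gradient. This advantage of the stabilized norm is what the convection and stabilization estimates
exploit. -/
theorem sqrt_mul_nrm_le_sdNorm (hM : MeshAssumption P ε N) (hP : P.Admissible) (hC : 0 < Cstar)
    (hv : IsPL N (meshX P ε N) (meshY P ε N) v) :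
    Real.sqrt ε * nrm (pdx v) ≤ sdNorm P ε N Cstar v ∧
    Real.sqrt ε * nrm (pdy v) ≤ sdNorm P ε N Cstar v ∧
    nrm v ≤ sdNorm P ε N Cstar v / Real.sqrt P.μ₀ ∧
    nrm (fun p => chi P ε N p * P.conv v p) ≤
      Real.sqrt N * sdNorm P ε N Cstar v / Real.sqrt Cstar := by
  have h := sdNorm_sq hM hP hC.le hv
  have he := hM.ε_pos
  have hμ := hP.μ₀_pos
  have hN := hM.cast_pos
  have t1 : 0 ≤ ε * nrm (pdx v) ^ 2 := by positivity
  have t2 : 0 ≤ ε * nrm (pdy v) ^ 2 := by positivity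
  have t3 : 0 ≤ P.μ₀ * nrm v ^ 2 := by positivity
  have t4 : 0 ≤ Cstar * (N : ℝ)⁻¹ * nrm (fun p => chi P ε N p * P.conv v p) ^ 2 := by positivity
  refine ⟨sqrt_mul_le_of_sq he.le sdNorm_nonneg (by linarith),
    sqrt_mul_le_of_sq he.le sdNorm_nonneg (by linarith), ?_, ?_⟩
  · rw [le_div_iff₀ (Real.sqrt_pos.2 hμ), mul_comm]
    exact sqrt_mul_le_of_sq hμ.le sdNorm_nonneg (by linarith)
  · have := sqrt_mul_le_of_sq (by positivity) (sdNorm_nonneg (P := P) (ε := ε) (N := N)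
      (Cstar := Cstar) (v := v)) (show Cstar * (N : ℝ)⁻¹ *
        nrm (fun p => chi P ε N p * P.conv v p) ^ 2 ≤ _ by linarith)
    rw [Real.sqrt_mul hC.le, Real.sqrt_inv] at this
    have s1 := Real.sqrt_pos.2 hN
    rw [le_div_iff₀ (Real.sqrt_pos.2 hC)]
    calc _ = Real.sqrt N * (Real.sqrt Cstar * (Real.sqrt N)⁻¹ *
          nrm fun p => chi P ε N p * P.conv v p) := by field_simp
      _ ≤ _ := mul_le_mul_of_nonneg_left this s1.le

theorem nrm_conv_le {X Y : ℕ → ℝ} (hv : PC1 N X Y v) {B : ℝ} (hB : 0 ≤ B)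
    (h : ∀ p ∈ OmegaBar, |P.b₁ p| ≤ B ∧ |P.b₂ p| ≤ B) :
    nrm (P.conv v) ≤ B * (nrm (pdx v) + nrm (pdy v)) := by
  have h1 := nrm_mono (F := P.conv v) ((hv.bdx.abs.const_mul B).add (hv.bdy.abs.const_mul B)) (by
    filter_upwards [ae_mem_Omega] with p hp
    obtain ⟨b1, b2⟩ := h p (Omega_subset_OmegaBar hp)
    refine (abs_add_le _ _).trans (add_le_add ?_ ?_)
    · rw [abs_mul]; exact mul_le_mul_of_nonneg_right b1 (abs_nonneg _)
    · rw [abs_mul]; exact mul_le_mul_of_nonneg_right b2 (abs_nonneg _))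
  refine h1.trans ((nrm_add_le (hv.bdx.abs.const_mul B) (hv.bdy.abs.const_mul B)).trans ?_)
  rw [nrm_const_mul, nrm_const_mul, abs_of_nonneg hB, nrm_abs, nrm_abs, mul_add]

theorem layerConst_nonneg (hA : 0 ≤ A) : 0 ≤ layerConst P A := by
  unfold layerConst
  positivity

theorem bd_one_sub_chi : Bd fun p => 1 - chi P ε N p := (bd_const 1).sub bd_chi

/-- Sum of the square roots of the layer widths, up to scaling. -/
noncomputable def widthConst (P : Coeffs) : ℝ :=
  Real.sqrt (5 / 2 / P.β₁) + Real.sqrt (5 / 2 / P.β₂)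

theorem widthConst_nonneg : 0 ≤ widthConst P :=
  add_nonneg (Real.sqrt_nonneg _) (Real.sqrt_nonneg _)

theorem ErrorSetting.bd_err (h : ErrorSetting P ε A N u uI v) (hP : P.Admissible) :
    Bd (uI - u) := ((h.pc1_uI hP).sub (h.mesh.gridX hP) (h.mesh.gridY hP) (h.pc1_u hP)).bd

theorem inv_sq_le_logDiv_sq (hM : MeshAssumption P ε N) : 1 / (N : ℝ) ^ 2 ≤ logDiv N ^ 2 := by
  have := pow_le_pow_left₀ (by have := hM.cast_pos; positivity) hM.inv_le_logDiv 2
  rwa [div_pow, one_pow] at this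

theorem ErrorSetting.nrm_err_le (h : ErrorSetting P ε A N u uI v) (hP : P.Admissible) :
    nrm (uI - u) ≤ (22 * A + 2 * (layerConst P A * widthConst P)) * rate ε N := by
  have hA := h.A_nonneg
  have hM := h.mesh
  have hN := hM.cast_pos
  have hK := layerConst_nonneg (P := P) hA
  have hW := widthConst_nonneg (P := P)
  have b1 := bd_const (22 * A / (N : ℝ) ^ 2)
  have b2 := (bd_one_sub_chi (P := P) (ε := ε) (N := N)).const_mul (layerConst P A * logDiv N ^ 2)
  refine (nrm_mono (b1.add b2) (h.ae_err hP)).trans ((nrm_add_le b1 b2).trans ?_)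
  rw [nrm_const, nrm_const_mul, abs_of_nonneg (by positivity), abs_of_nonneg (by positivity)]
  have hn : nrm (fun p => 1 - chi P ε N p) ≤ widthConst P *
      (Real.sqrt ε * Real.sqrt (Real.log N)) := nrm_one_sub_chi_le hM hP
  have he1 : Real.sqrt ε ≤ 1 := by
    rw [← Real.sqrt_one]
    exact Real.sqrt_le_sqrt hM.ε_le_one
  calc _ ≤ 22 * A / (N : ℝ) ^ 2 + layerConst P A * logDiv N ^ 2 * (widthConst P *
        (1 * Real.sqrt (Real.log N))) := by
        refine add_le_add le_rfl (mul_le_mul_of_nonneg_left (hn.trans ?_) (by positivity))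
        gcongr
    _ = 22 * A * (1 / (N : ℝ) ^ 2) + layerConst P A * widthConst P *
        (logDiv N ^ 2 * Real.sqrt (Real.log N)) := by ring
    _ ≤ 22 * A * rate ε N + layerConst P A * widthConst P * (2 * rate ε N) := by
        have := inv_sq_le_rate hM
        have := logDiv_sq_le hM
        gcongr
    _ = _ := by ring

/-- On the coarse region an error N⁻² meets the cost N^(1/2). In the layers the error L² meets the
cost ε^(-1/2), and the L² norm (ε ln N)^(1/2) of the indicator of the layers makes up for it. -/
theorem ErrorSetting.abs_integral_err_mul_conv_le (h : ErrorSetting P ε A N u uI v)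
    (hP : P.Admissible) (hC : 0 < Cstar) {B : ℝ} (hB : 0 ≤ B)
    (hb : ∀ p ∈ OmegaBar, |P.b₁ p| ≤ B ∧ |P.b₂ p| ≤ B) :
    |∫ p in Omega, (uI - u) p * P.conv v p| ≤ (22 * A / Real.sqrt Cstar +
      4 * ((22 * A + layerConst P A) * widthConst P * B)) * rate ε N * sdNorm P ε N Cstar v := by
  have hA := h.A_nonneg
  have hM := h.mesh
  have hN := hM.cast_pos
  have hK := layerConst_nonneg (P := P) hA
  have hW := widthConst_nonneg (P := P)
  have hpv := h.pc1_v hP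
  have bη := h.bd_err hP
  have bc := bd_conv hP hpv
  have bχ := bd_chi (P := P) (ε := ε) (N := N)
  have bχ' := bd_one_sub_chi (P := P) (ε := ε) (N := N)
  obtain ⟨g1, g2, -, g4⟩ := sqrt_mul_nrm_le_sdNorm hM hP hC h.test
  -- An indicator equals its square, so on the coarse part each of the two factors receives its own
  -- copy.
  have hsplit : ∫ p in Omega, (uI - u) p * P.conv v p =
      (∫ p in Omega, (chi P ε N p * (uI - u) p) * (chi P ε N p * P.conv v p)) +
      ∫ p in Omega, ((1 - chi P ε N p) * (uI - u) p) * P.conv v p := by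
    rw [← integral_add ((bχ.mul bη).mul (bχ.mul bc)).integrable ((bχ'.mul bη).mul bc).integrable]
    refine integral_congr_ae (Filter.Eventually.of_forall fun p => ?_)
    simp only
    linear_combination (-(uI - u) p * P.conv v p) * chi_mul_self (P := P) (ε := ε) (N := N) p
  have i1 := abs_integral_mul_le (bχ.mul bη) (bχ.mul bc)
  have i2 := abs_integral_mul_le (bχ'.mul bη) bc
  have n1 : nrm (fun p => chi P ε N p * (uI - u) p) ≤ 22 * A / (N : ℝ) ^ 2 := by
    refine (nrm_le_const (c := 22 * A / (N : ℝ) ^ 2) ?_).trans (abs_of_nonneg (by positivity)).le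
    filter_upwards [h.ae_err hP] with p hp
    have h0 : 0 ≤ 22 * A / (N : ℝ) ^ 2 := by positivity
    by_cases hc : p ∈ coarse P ε N
    · have : chi P ε N p = 1 := indicator_of_mem hc _
      rw [this, sub_self, mul_zero, add_zero] at hp
      rwa [this, one_mul]
    · have : chi P ε N p = 0 := indicator_of_notMem hc _
      rwa [this, zero_mul, abs_zero]
  have n2 : nrm (fun p => (1 - chi P ε N p) * (uI - u) p) ≤
      (22 * A + layerConst P A) * logDiv N ^ 2 * (widthConst P *
      (Real.sqrt ε * Real.sqrt (Real.log N))) := by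
    have hn : nrm (fun p => 1 - chi P ε N p) ≤ widthConst P *
      (Real.sqrt ε * Real.sqrt (Real.log N)) := nrm_one_sub_chi_le hM hP
    refine (nrm_mono (bχ'.const_mul ((22 * A + layerConst P A) * logDiv N ^ 2)) ?_).trans ?_
    · filter_upwards [h.ae_err hP] with p hp
      have c1 := chi_le_one (P := P) (ε := ε) (N := N) p
      have c0 := chi_nonneg (P := P) (ε := ε) (N := N) p
      rw [abs_mul, abs_of_nonneg (by linarith), mul_comm]
      refine mul_le_mul_of_nonneg_right (hp.trans ?_) (by linarith)
      have e1 : 22 * A / (N : ℝ) ^ 2 ≤ 22 * A * logDiv N ^ 2 := by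
        rw [div_eq_mul_one_div]
        exact mul_le_mul_of_nonneg_left (inv_sq_le_logDiv_sq hM) (by positivity)
      have e2 : layerConst P A * logDiv N ^ 2 * (1 - chi P ε N p) ≤
          layerConst P A * logDiv N ^ 2 :=
        mul_le_of_le_one_right (by positivity) (by linarith)
      linarith
    · rw [nrm_const_mul, abs_of_nonneg (by positivity)]
      exact mul_le_mul_of_nonneg_left hn (by positivity)
  have n3 := nrm_conv_le hpv hB hb
  rw [hsplit]
  have hsn := Real.sqrt_pos.2 hN
  have hsC := Real.sqrt_pos.2 hC
  have hnv := sdNorm_nonneg (P := P) (ε := ε) (N := N) (Cstar := Cstar) (v := v)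
  have r1 := inv_cube_le hM
  have r2 := logDiv_sq_le hM
  set nv := sdNorm P ε N Cstar v
  have hl := one_le_sqrt_log hM
  calc _ ≤ 22 * A / (N : ℝ) ^ 2 * (Real.sqrt N * nv / Real.sqrt Cstar) +
        (22 * A + layerConst P A) * logDiv N ^ 2 * (widthConst P *
        (Real.sqrt ε * Real.sqrt (Real.log N))) * (B * (nrm (pdx v) + nrm (pdy v))) := by
        refine (abs_add_le _ _).trans (add_le_add (i1.trans ?_) (i2.trans ?_))
        · exact mul_le_mul n1 g4 (nrm_nonneg _) (by positivity)
        · exact mul_le_mul n2 n3 (nrm_nonneg _) (by positivity)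
    _ = 22 * A / Real.sqrt Cstar * (1 / Real.sqrt N ^ 3) * nv +
        (22 * A + layerConst P A) * widthConst P * B * (logDiv N ^ 2 * Real.sqrt (Real.log N)) *
        (Real.sqrt ε * nrm (pdx v) + Real.sqrt ε * nrm (pdy v)) := by
        have hn2 : (N : ℝ) ^ 2 = Real.sqrt N ^ 4 := by
          rw [show (4 : ℕ) = 2 * 2 from rfl, pow_mul, Real.sq_sqrt hN.le]
        rw [hn2]
        field_simp
    _ ≤ 22 * A / Real.sqrt Cstar * rate ε N * nv +
        (22 * A + layerConst P A) * widthConst P * B * (2 * rate ε N) * (nv + nv) := by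
        gcongr
        · exact add_nonneg (mul_nonneg (Real.sqrt_nonneg _) (nrm_nonneg _))
            (mul_nonneg (Real.sqrt_nonneg _) (nrm_nonneg _))
        · exact mul_nonneg (by positivity) (mul_nonneg zero_le_two (rate_pos hM).le)
    _ = _ := by ring

end norms

end SDFEM

/-! ### The stabilization term -/

namespace SDFEM

section residual

variable {P : Coeffs} {ε A Cstar B : ℝ} {N : ℕ} {u uI v : ℝ × ℝ → ℝ}

/-- The residual of the interpolant on the coarse part of the mesh. -/
noncomputable def residual (P : Coeffs) (ε : ℝ) (u uI : ℝ × ℝ → ℝ) (p : ℝ × ℝ) : ℝ :=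
  ε * lap u p + P.conv (uI - u) p + P.c p * (uI - u) p

/-- Constant in the regular part of the residual. -/
noncomputable def residualConst (P : Coeffs) (A B : ℝ) : ℝ :=
  4 * A + B * ((20 + 5 / P.β₁ + 5 / P.β₂) * A) + B * (22 * A)

theorem ErrorSetting.abs_residual_le (h : ErrorSetting P ε A N u uI v) (hP : P.Admissible)
    (hB : 0 ≤ B) (hb : ∀ p ∈ OmegaBar, |P.b₁ p| ≤ B ∧ |P.b₂ p| ≤ B ∧ |P.c p| ≤ B)
    {k : ℕ × ℕ × Bool} (hk : k ∈ triIndex N) {p : ℝ × ℝ}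
    (hp : p ∈ otri (meshX P ε N) (meshY P ε N) k) (hc : p ∈ coarse P ε N) :
    |residual P ε u uI p| ≤ residualConst P A B * logDiv N +
      (2 * A + B * (2 * A)) * (ε⁻¹ * expX P ε p.1) +
      (2 * A + B * (2 * A)) * (ε⁻¹ * expX P.swap ε p.2) := by
  have hX := h.mesh.gridX hP
  have hY := h.mesh.gridY hP
  have hA := h.A_nonneg
  have he := h.mesh.ε_pos
  have hΩ := Omega_subset_OmegaBar (otri_subset_Omega hX hY hk hp)
  have hk' : (k.2.1, k.1, k.2.2) ∈ triIndex N := mem_triIndex.2 (mem_triIndex.1 hk).symm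
  obtain ⟨b1, b2, b3⟩ := hb p hΩ
  have x1 := h.pdx_err_coarse hP hk hp hc
  have y1 := h.swap.pdx_err_coarse hP.swap hk' (p := p.swap) (swap_mem_otri.2 hp) hc.symm
  change |pdy uI p - pdy u p| ≤
    (10 + 5 / P.β₁) * A * logDiv N + 2 * A * (ε⁻¹ * expX P.swap ε p.2) at y1
  have x2 := h.abs_pdx_pdx_le hP hΩ
  have y2 := h.swap.abs_pdx_pdx_le hP.swap (swap_mem_OmegaBar.2 hΩ)
  change ε * |pdy (pdy u) p| ≤
    2 * A * logDiv N + 2 * A * (ε⁻¹ * expX P.swap ε p.2) at y2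
  have z := h.abs_err_le hP hk hp
  rw [show chi P ε N p = 1 from indicator_of_mem hc _, sub_self, mul_zero, add_zero] at z
  have hL := h.mesh.logDiv_pos
  have z' : |(uI - u) p| ≤ 22 * A * logDiv N := by
    refine z.trans ?_
    rw [div_eq_mul_one_div]
    refine mul_le_mul_of_nonneg_left ((inv_sq_le_logDiv_sq h.mesh).trans ?_) (by positivity)
    nlinarith [h.mesh.logDiv_le_one]
  rw [residual, lap, Coeffs.conv, (h.pc1_uI hP).pdx_sub hX hY (h.pc1_u hP) hk hp,
    (h.pc1_uI hP).pdy_sub hX hY (h.pc1_u hP) hk hp]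
  have t1 : |P.b₁ p * (pdx uI p - pdx u p)| ≤
      B * ((10 + 5 / P.β₂) * A * logDiv N + 2 * A * (ε⁻¹ * expX P ε p.1)) := by
    rw [abs_mul]; exact mul_le_mul b1 x1 (abs_nonneg _) hB
  have t2 : |P.b₂ p * (pdy uI p - pdy u p)| ≤
      B * ((10 + 5 / P.β₁) * A * logDiv N + 2 * A * (ε⁻¹ * expX P.swap ε p.2)) := by
    rw [abs_mul]; exact mul_le_mul b2 y1 (abs_nonneg _) hB
  have t3 : |P.c p * (uI - u) p| ≤ B * (22 * A * logDiv N) := by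
    rw [abs_mul]; exact mul_le_mul b3 z' (abs_nonneg _) hB
  have t4 : |ε * pdx (pdx u) p| ≤ 2 * A * logDiv N + 2 * A * (ε⁻¹ * expX P ε p.1) := by
    rwa [abs_mul, abs_of_pos he]
  have t5 : |ε * pdy (pdy u) p| ≤ 2 * A * logDiv N + 2 * A * (ε⁻¹ * expX P.swap ε p.2) := by
    rwa [abs_mul, abs_of_pos he]
  rw [residualConst]
  rw [abs_le] at *
  constructor <;> linarith [t1.1, t1.2, t2.1, t2.2, t3.1, t3.2, t4.1, t4.2, t5.1, t5.2]

theorem integral_expX_coarse_le (hM : MeshAssumption P ε N) (hP : P.Admissible) :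
    ∫ p in Omega, (Ioo 0 (1 - transition P.β₁ ε N)).indicator (expX P ε) p.1 ≤
      tau N * (ε / P.β₁) := by
  have hc0 := transition_pos hP.β₁_pos hM.ε_pos hM.four_le
  have hc1 := transition_le P.β₁ ε N
  have h := integral_exp_Omega_le (div_pos hP.β₁_pos hM.ε_pos)
    (c := 1 - transition P.β₁ ε N) (by linarith) (by linarith)
  have e : Real.exp (-(P.β₁ / ε * (1 - (1 - transition P.β₁ ε N)))) = tau N := by
    rw [← expX_transition hM hP, expX_eq]
  rw [e, ← expX_eq] at h
  exact h.trans (le_of_eq (by rw [div_div_eq_mul_div, mul_div_assoc]))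

theorem ErrorSetting.abs_conv_le_inverse (h : ErrorSetting P ε A N u uI v) (hP : P.Admissible)
    (hB : 0 ≤ B) (hb : ∀ p ∈ OmegaBar, |P.b₁ p| ≤ B ∧ |P.b₂ p| ≤ B ∧ |P.c p| ≤ B)
    {k : ℕ × ℕ × Bool} (hk : k ∈ triIndex N) {p : ℝ × ℝ}
    (hp : p ∈ otri (meshX P ε N) (meshY P ε N) k) (hc : p ∈ coarse P ε N) :
    |P.conv v p| ≤ 46 * B * (N : ℝ) ^ 2 * nrm v := by
  have hΩ := Omega_subset_OmegaBar (otri_subset_Omega (h.mesh.gridX hP) (h.mesh.gridY hP) hk hp)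
  obtain ⟨b1, b2, -⟩ := hb p hΩ
  have x1 := h.abs_pdx_le_inverse hP hk hp hc
  have y1 := h.swap.abs_pdx_le_inverse hP.swap (k := (k.2.1, k.1, k.2.2))
    (mem_triIndex.2 (mem_triIndex.1 hk).symm) (p := p.swap) (swap_mem_otri.2 hp) hc.symm
  rw [nrm_swap] at y1
  change |pdy v p| ≤ _ at y1
  have t1 : |P.b₁ p * pdx v p| ≤ B * (23 * (N : ℝ) ^ 2 * nrm v) := by
    rw [abs_mul]; exact mul_le_mul b1 x1 (abs_nonneg _) hB
  have t2 : |P.b₂ p * pdy v p| ≤ B * (23 * (N : ℝ) ^ 2 * nrm v) := by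
    rw [abs_mul]; exact mul_le_mul b2 y1 (abs_nonneg _) hB
  refine (abs_add_le _ _).trans ((add_le_add t1 t2).trans (le_of_eq ?_))
  ring

/-- Cauchy–Schwarz for the regular part. The layer part ε⁻¹ `expX` has L¹ norm at most `tau`/β₁ on
the coarse region, uniformly in ε, and is paired with the maximum of b·∇v; its L² norm would retain
ε^(-1/2). -/
theorem ErrorSetting.abs_integral_residual_le (h : ErrorSetting P ε A N u uI v)
    (hP : P.Admissible) (hB : 0 ≤ B)
    (hb : ∀ p ∈ OmegaBar, |P.b₁ p| ≤ B ∧ |P.b₂ p| ≤ B ∧ |P.c p| ≤ B) :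
    |∫ p in Omega, chi P ε N p * (residual P ε u uI p * P.conv v p)| ≤
      residualConst P A B * logDiv N * nrm (fun p => chi P ε N p * P.conv v p) +
      (2 * A + B * (2 * A)) * (46 * B) * (1 / P.β₁ + 1 / P.β₂) *
        ((N : ℝ) ^ 2 * tau N * nrm v) := by
  have hX := h.mesh.gridX hP
  have hY := h.mesh.gridY hP
  have hA := h.A_nonneg
  have hM := h.mesh
  have he := hM.ε_pos
  have hL := hM.logDiv_pos
  have hb1 := hP.β₁_pos
  have hb2 := hP.β₂_pos
  have hτ := tau_pos N
  have hnv := nrm_nonneg v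
  have hpv := h.pc1_v hP
  have bc := (bd_chi (P := P) (ε := ε) (N := N)).mul (bd_conv hP hpv)
  have bx : Bd fun p => (Ioo 0 (1 - transition P.β₁ ε N)).indicator (expX P ε) p.1 :=
    bd_fst_indicator (continuous_expX P ε) measurableSet_Ioo
  have byy : Bd fun p => (Ioo 0 (1 - transition P.β₂ ε N)).indicator (expX P.swap ε) p.2 :=
    bd_snd_indicator (continuous_expX P.swap ε) measurableSet_Ioo
  have ix := integral_expX_coarse_le hM hP
  have iy : ∫ p in Omega, (Ioo 0 (1 - transition P.β₂ ε N)).indicator (expX P.swap ε) p.2 ≤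
      tau N * (ε / P.β₂) := by
    rw [← integral_swap]
    exact integral_expX_coarse_le hM.swap hP.swap
  have hr0 : 0 ≤ residualConst P A B := by unfold residualConst; positivity
  set K₀ := residualConst P A B * logDiv N with hK₀
  set M := (2 * A + B * (2 * A)) * ε⁻¹ * (46 * B * (N : ℝ) ^ 2 * nrm v) with hMdef
  have hM0 : 0 ≤ M := by positivity
  have hK0 : 0 ≤ K₀ := by positivity
  have B1 := bc.abs.const_mul K₀
  have B2 := bx.const_mul M
  have B3 := byy.const_mul M
  have hae : ∀ᵐ p ∂(volume.restrict Omega),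
      ‖chi P ε N p * (residual P ε u uI p * P.conv v p)‖ ≤ K₀ * |chi P ε N p * P.conv v p| +
        M * (Ioo 0 (1 - transition P.β₁ ε N)).indicator (expX P ε) p.1 +
        M * (Ioo 0 (1 - transition P.β₂ ε N)).indicator (expX P.swap ε) p.2 := by
    refine ae_of_otri hX hY fun k hk p hp => ?_
    have hΩ := otri_subset_Omega hX hY hk hp
    rw [Real.norm_eq_abs]
    by_cases hc : p ∈ coarse P ε N
    · have hr := h.abs_residual_le hP hB hb hk hp hc
      have hi := h.abs_conv_le_inverse hP hB hb hk hp hc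
      rw [show chi P ε N p = 1 from indicator_of_mem hc _, one_mul, one_mul,
        indicator_of_mem (show p.1 ∈ Ioo 0 (1 - transition P.β₁ ε N) from ⟨hΩ.1.1, hc.1⟩),
        indicator_of_mem (show p.2 ∈ Ioo 0 (1 - transition P.β₂ ε N) from ⟨hΩ.2.1, hc.2⟩),
        abs_mul]
      have ex := (expX_pos P ε p.1).le
      have ey := (expX_pos P.swap ε p.2).le
      have hcv := abs_nonneg (P.conv v p)
      calc _ ≤ (K₀ + (2 * A + B * (2 * A)) * (ε⁻¹ * expX P ε p.1) +
            (2 * A + B * (2 * A)) * (ε⁻¹ * expX P.swap ε p.2)) * |P.conv v p| :=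
            mul_le_mul_of_nonneg_right hr hcv
        _ = K₀ * |P.conv v p| + (2 * A + B * (2 * A)) * (ε⁻¹ * expX P ε p.1) * |P.conv v p| +
            (2 * A + B * (2 * A)) * (ε⁻¹ * expX P.swap ε p.2) * |P.conv v p| := by ring
        _ ≤ K₀ * |P.conv v p| + (2 * A + B * (2 * A)) * (ε⁻¹ * expX P ε p.1) *
              (46 * B * (N : ℝ) ^ 2 * nrm v) +
            (2 * A + B * (2 * A)) * (ε⁻¹ * expX P.swap ε p.2) *
              (46 * B * (N : ℝ) ^ 2 * nrm v) := by gcongr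
        _ = _ := by rw [hMdef]; ring
    · rw [show chi P ε N p = 0 from indicator_of_notMem hc _, zero_mul, zero_mul, abs_zero,
        mul_zero, zero_add]
      exact add_nonneg (mul_nonneg hM0 (indicator_nonneg (fun _ _ => (expX_pos _ _ _).le) _))
        (mul_nonneg hM0 (indicator_nonneg (fun _ _ => (expX_pos _ _ _).le) _))
  have hint := norm_integral_le_of_norm_le ((B1.add B2).add B3).integrable hae
  rw [Real.norm_eq_abs, integral_add (B1.add B2).integrable B3.integrable,
    integral_add B1.integrable B2.integrable, integral_const_mul, integral_const_mul,
    integral_const_mul] at hint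
  have hL1 : ∫ p in Omega, |chi P ε N p * P.conv v p| ≤
      nrm (fun p => chi P ε N p * P.conv v p) := by
    have := (le_abs_self _).trans (abs_integral_mul_le bc.abs (bd_const 1))
    simpa only [mul_one, nrm_abs, nrm_const, abs_one] using this
  refine hint.trans ?_
  calc _ ≤ K₀ * nrm (fun p => chi P ε N p * P.conv v p) + M * (tau N * (ε / P.β₁)) +
        M * (tau N * (ε / P.β₂)) := by gcongr
    _ = _ := by rw [hMdef]; field_simp; ring

/-- The factor N⁻¹ of the stabilization parameter leaves L N^(-1/2) from the regular part, after the
cost N^(1/2) of b·∇v, and N `tau` from the layer part, after the inverse estimate. -/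
theorem ErrorSetting.stabilization_le (h : ErrorSetting P ε A N u uI v)
    (hP : P.Admissible) (hC : 0 < Cstar) (hB : 0 ≤ B)
    (hb : ∀ p ∈ OmegaBar, |P.b₁ p| ≤ B ∧ |P.b₂ p| ≤ B ∧ |P.c p| ≤ B) :
    |Cstar * (N : ℝ)⁻¹ * ∫ p in Omega, chi P ε N p * (residual P ε u uI p * P.conv v p)| ≤
      (residualConst P A B * Real.sqrt Cstar +
      (2 * A + B * (2 * A)) * (46 * B) * (1 / P.β₁ + 1 / P.β₂) * Cstar / Real.sqrt P.μ₀)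
        * rate ε N * sdNorm P ε N Cstar v := by
  have hA := h.A_nonneg
  have hM := h.mesh
  have hN := hM.cast_pos
  have hL := hM.logDiv_pos
  have hb1 := hP.β₁_pos
  have hb2 := hP.β₂_pos
  have hτ := tau_pos N
  have hr0 : 0 ≤ residualConst P A B := by unfold residualConst; positivity
  obtain ⟨-, -, g3, g4⟩ := sqrt_mul_nrm_le_sdNorm hM hP hC h.test
  have hi := h.abs_integral_residual_le hP hB hb
  have hnv := sdNorm_nonneg (P := P) (ε := ε) (N := N) (Cstar := Cstar) (v := v)
  have hsC := Real.sqrt_pos.2 hC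
  have hsn := Real.sqrt_pos.2 hN
  have hsm := Real.sqrt_pos.2 hP.μ₀_pos
  have r1 : logDiv N / Real.sqrt N ≤ rate ε N :=
    (div_le_div_of_nonneg_right (le_mul_of_one_le_right hL.le (one_le_sqrt_log hM)) hsn.le).trans
      (logDiv_div_le hM)
  have r2 := tau_mul_cast_le hM
  set nv := sdNorm P ε N Cstar v
  rw [abs_mul, abs_of_pos (by positivity)]
  set G := (2 * A + B * (2 * A)) * (46 * B) * (1 / P.β₁ + 1 / P.β₂) with hG
  have hG0 : 0 ≤ G := by positivity
  calc _ ≤ Cstar * (N : ℝ)⁻¹ * (residualConst P A B * logDiv N *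
        (Real.sqrt N * nv / Real.sqrt Cstar) + G * ((N : ℝ) ^ 2 * tau N *
        (nv / Real.sqrt P.μ₀))) := by
        refine mul_le_mul_of_nonneg_left (hi.trans ?_) (by positivity)
        gcongr
    _ = residualConst P A B * Real.sqrt Cstar * (logDiv N / Real.sqrt N) * nv +
        G * Cstar / Real.sqrt P.μ₀ * (tau N * N) * nv := by
        have e1 : Cstar / Real.sqrt Cstar = Real.sqrt Cstar := Real.div_sqrt
        have e2 : (N : ℝ)⁻¹ * Real.sqrt N = 1 / Real.sqrt N := by
          rw [inv_mul_eq_div, Real.sqrt_div_self, one_div]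
        have e3 : (N : ℝ)⁻¹ * (N : ℝ) ^ 2 = N := by field_simp
        calc _ = residualConst P A B * (Cstar / Real.sqrt Cstar) * (logDiv N *
              ((N : ℝ)⁻¹ * Real.sqrt N)) * nv + G * Cstar / Real.sqrt P.μ₀ *
              (tau N * ((N : ℝ)⁻¹ * (N : ℝ) ^ 2)) * nv := by ring
          _ = _ := by rw [e1, e2, e3, mul_one_div]
    _ ≤ residualConst P A B * Real.sqrt Cstar * rate ε N * nv +
        G * Cstar / Real.sqrt P.μ₀ * rate ε N * nv := by gcongr
    _ = _ := by ring

end residual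

end SDFEM

/-! ### Boundary values of piecewise linear functions -/

namespace SDFEM

section boundary

variable {N : ℕ} {X Y : ℕ → ℝ} {w : ℝ × ℝ → ℝ}

/-- A function affine on a convex set that vanishes at two points vanishes on the segment between
them. Vertical segments suffice; the horizontal sides follow by swapping. -/
theorem IsPL.eq_zero_of_mem_edge (hw : IsPL N X Y w) {k : ℕ × ℕ × Bool} (hk : k ∈ triIndex N)
    {x y y₁ y₂ : ℝ} (h₁ : (x, y₁) ∈ ctri X Y k) (h₂ : (x, y₂) ∈ ctri X Y k) (z₁ : w (x, y₁) = 0)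
    (z₂ : w (x, y₂) = 0) (h12 : y₁ ≤ y₂) (hy : y ∈ Icc y₁ y₂) : w (x, y) = 0 := by
  obtain ⟨a₀, a₁, a₂, h⟩ := hw.affine k hk
  rw [← segment_eq_Icc h12] at hy
  obtain ⟨s, t, hs, ht, hst, rfl⟩ := hy
  have hmem : (x, s • y₁ + t • y₂) ∈ ctri X Y k := by
    have hc : Convex ℝ (ctri X Y k) := by rw [ctri_eq]; exact convex_convexHull ℝ _
    have := hc h₁ h₂ hs ht hst
    rwa [Prod.smul_mk, Prod.smul_mk, Prod.mk_add_mk, ← add_smul, hst, one_smul] at this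
  rw [h _ h₁] at z₁
  rw [h _ h₂] at z₂
  rw [h _ hmem]
  simp only [smul_eq_mul] at *
  linear_combination s * z₁ + t * z₂ + (a₀ + a₁ * x) * (-hst)

theorem IsPL.eq_zero_left_right (hX : IsGrid N X) (hY : IsGrid N Y) (hN : 0 < N)
    (hw : IsPL N X Y w)
    (h0 : ∀ i j, i ≤ N → j ≤ N → (X i, Y j) ∈ frontier Omega → w (X i, Y j) = 0)
    {x y : ℝ} (hx : x = 0 ∨ x = 1) (hy : y ∈ Icc (0 : ℝ) 1) : w (x, y) = 0 := by
  obtain ⟨j, hj, hy1, hy2⟩ := hY.exists_cell hy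
  have hf : ∀ i j, i ≤ N → j ≤ N → X i = 0 ∨ X i = 1 → w (X i, Y j) = 0 := fun i j hi hj h =>
    h0 i j hi hj (mem_frontier_Omega.2 ⟨⟨hX.mem hi, hY.mem hj⟩, by tauto⟩)
  rcases hx with rfl | rfl
  -- The left edge of a cell belongs to its lower triangle and the right edge to its upper one.
  · have h := hw.eq_zero_of_mem_edge (k := (0, j, false)) (mem_triIndex.2 ⟨hN, hj⟩)
      (subset_convexHull ℝ _ (by simp)) (subset_convexHull ℝ _ (by simp))
      (hf 0 j (by omega) (by omega) (Or.inl hX.zero))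
      (hf 0 (j + 1) (by omega) (by omega) (Or.inl hX.zero)) (hY.lt j hj).le ⟨hy1, hy2⟩
    rwa [hX.zero] at h
  · obtain ⟨m, rfl⟩ : ∃ m, N = m + 1 := ⟨N - 1, by omega⟩
    rw [← hX.last]
    exact hw.eq_zero_of_mem_edge (k := (m, j, true)) (mem_triIndex.2 ⟨by simp, hj⟩)
      (subset_convexHull ℝ _ (by simp)) (subset_convexHull ℝ _ (by simp))
      (hf (m + 1) j (by omega) (by omega) (Or.inr hX.last))
      (hf (m + 1) (j + 1) (by omega) (by omega) (Or.inr hX.last)) (hY.lt j hj).le ⟨hy1, hy2⟩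

/-- A piecewise linear function that vanishes at the boundary nodes vanishes on the boundary. -/
theorem IsPL.eq_zero_of_mem_frontier (hX : IsGrid N X) (hY : IsGrid N Y) (hN : 0 < N)
    (hw : IsPL N X Y w)
    (h0 : ∀ i j, i ≤ N → j ≤ N → (X i, Y j) ∈ frontier Omega → w (X i, Y j) = 0)
    {p : ℝ × ℝ} (hp : p ∈ frontier Omega) : w p = 0 := by
  obtain ⟨hpΩ, h⟩ := mem_frontier_Omega.1 hp
  have hs : ∀ i j, i ≤ N → j ≤ N → (Y i, X j) ∈ frontier Omega →
      (w ∘ Prod.swap) (Y i, X j) = 0 := fun i j hi hj hm => h0 j i hj hi (by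
    rw [mem_frontier_Omega] at hm ⊢
    exact ⟨swap_mem_OmegaBar.2 hm.1, by tauto⟩)
  rcases (show (p.1 = 0 ∨ p.1 = 1) ∨ (p.2 = 0 ∨ p.2 = 1) by tauto) with h | h
  · exact hw.eq_zero_left_right hX hY hN h0 h hpΩ.2
  · exact hw.swap.eq_zero_left_right hY hX hN hs h hpΩ.1

end boundary

/-! ### Linearity of the form and the error equation -/

section identity

variable {P : Coeffs} {ε A Cstar : ℝ} {N : ℕ} {f u uI uN v : ℝ × ℝ → ℝ}

theorem aSD_sub (hM : MeshAssumption P ε N) (hP : P.Admissible) {w w' : ℝ × ℝ → ℝ}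
    (hw : IsPL N (meshX P ε N) (meshY P ε N) w) (hw' : IsPL N (meshX P ε N) (meshY P ε N) w')
    (hv : IsPL N (meshX P ε N) (meshY P ε N) v) :
    aSD P ε N Cstar (w - w') v = aSD P ε N Cstar w v - aSD P ε N Cstar w' v := by
  have hX := hM.gridX hP
  have hY := hM.gridY hP
  have pw := hw.pc1 hX hY
  have pw' := hw'.pc1 hX hY
  have pv := hv.pc1 hX hY
  have bc := bd_c hP
  have bχ := bd_chi (P := P) (ε := ε) (N := N)
  have a1 : ∀ {g : ℝ × ℝ → ℝ}, PC1 N (meshX P ε N) (meshY P ε N) g → Integrable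
      (fun p => pdx g p * pdx v p + pdy g p * pdy v p) (volume.restrict Omega) := fun hg =>
    ((hg.bdx.mul pv.bdx).add (hg.bdy.mul pv.bdy)).integrable
  have a2 : ∀ {g : ℝ × ℝ → ℝ}, PC1 N (meshX P ε N) (meshY P ε N) g → Integrable
      (fun p => (P.conv g p + P.c p * g p) * v p) (volume.restrict Omega) := fun hg =>
    (((bd_conv hP hg).add (bc.mul hg.bd)).mul pv.bd).integrable
  have a3 : ∀ {g : ℝ × ℝ → ℝ}, PC1 N (meshX P ε N) (meshY P ε N) g → Integrable
      (fun p => chi P ε N p * ((P.conv g p + P.c p * g p) * P.conv v p))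
      (volume.restrict Omega) := fun hg =>
    (bχ.mul (((bd_conv hP hg).add (bc.mul hg.bd)).mul (bd_conv hP pv))).integrable
  have e1 : ∫ p in Omega, (pdx (w - w') p * pdx v p + pdy (w - w') p * pdy v p) =
      (∫ p in Omega, (pdx w p * pdx v p + pdy w p * pdy v p)) -
      ∫ p in Omega, (pdx w' p * pdx v p + pdy w' p * pdy v p) := by
    rw [← integral_sub (a1 pw) (a1 pw')]
    refine integral_congr_ae (ae_of_otri hX hY fun k hk p hp => ?_)
    simp only
    rw [pw.pdx_sub hX hY pw' hk hp, pw.pdy_sub hX hY pw' hk hp]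
    ring
  have e2 : ∫ p in Omega, (P.conv (w - w') p + P.c p * (w - w') p) * v p =
      (∫ p in Omega, (P.conv w p + P.c p * w p) * v p) -
      ∫ p in Omega, (P.conv w' p + P.c p * w' p) * v p := by
    rw [← integral_sub (a2 pw) (a2 pw')]
    refine integral_congr_ae (ae_of_otri hX hY fun k hk p hp => ?_)
    simp only [Coeffs.conv, Pi.sub_apply]
    rw [pw.pdx_sub hX hY pw' hk hp, pw.pdy_sub hX hY pw' hk hp]
    ring
  have e3 : ∫ p in Omega, chi P ε N p *
        ((P.conv (w - w') p + P.c p * (w - w') p) * P.conv v p) =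
      (∫ p in Omega, chi P ε N p * ((P.conv w p + P.c p * w p) * P.conv v p)) -
      ∫ p in Omega, chi P ε N p * ((P.conv w' p + P.c p * w' p) * P.conv v p) := by
    rw [← integral_sub (a3 pw) (a3 pw')]
    refine integral_congr_ae (ae_of_otri hX hY fun k hk p hp => ?_)
    simp only [Coeffs.conv, Pi.sub_apply]
    rw [pw.pdx_sub hX hY pw' hk hp, pw.pdy_sub hX hY pw' hk hp]
    ring
  rw [aSD_eq hM hP Cstar (hw.sub hw') hv, aSD_eq hM hP Cstar hw hv, aSD_eq hM hP Cstar hw' hv,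
    e1, e2, e3]
  ring

theorem bd_lap (hu : ContDiffOn ℝ 2 u OmegaBar) : Bd (lap u) :=
  (bd_of_continuousOn (continuousOn_pdx (contDiffOn_pdx hu (m := 1) (by norm_num)))).add
    (bd_of_continuousOn (continuousOn_pdy (contDiffOn_pdy hu (m := 1) (by norm_num))))

/-- Green's formula, from the vanishing of `v` on the boundary. It needs `u` to be C² up to the
boundary, which the decomposition supplies and the notion of solution alone does not. -/
theorem integral_lap_mul {X Y : ℕ → ℝ} (hX : IsGrid N X) (hY : IsGrid N Y)
    (hu : ContDiffOn ℝ 2 u OmegaBar) (hv : PC1 N X Y v) (h0 : ∀ p ∈ frontier Omega, v p = 0) :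
    ∫ p in Omega, lap u p * v p = -∫ p in Omega, (pdx u p * pdx v p + pdy u p * pdy v p) := by
  have hu1 := pc1_of_contDiffOn hX hY (hu.of_le (by norm_num))
  have px := pc1_of_contDiffOn hX hY (contDiffOn_pdx hu (m := 1) (by norm_num))
  have py := pc1_of_contDiffOn hX hY (contDiffOn_pdy hu (m := 1) (by norm_num))
  have e1 := (px.mul hX hY hv).integral_pdx_eq_zero hX hY fun p hp => by simp [h0 p hp]
  have e2 := (py.mul hX hY hv).integral_pdy_eq_zero hX hY fun p hp => by simp [h0 p hp]
  have i1 : Integrable (fun p => lap u p * v p) (volume.restrict Omega) :=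
    ((bd_lap hu).mul hv.bd).integrable
  have i2 : Integrable (fun p => pdx u p * pdx v p + pdy u p * pdy v p)
      (volume.restrict Omega) := ((hu1.bdx.mul hv.bdx).add (hu1.bdy.mul hv.bdy)).integrable
  have key : (∫ p in Omega, (lap u p * v p + (pdx u p * pdx v p + pdy u p * pdy v p))) = 0 := by
    rw [← add_zero (0 : ℝ), ← congrArg₂ (· + ·) e1 e2, ← integral_add
      (px.mul hX hY hv).bdx.integrable (py.mul hX hY hv).bdy.integrable]
    refine integral_congr_ae (ae_of_otri hX hY fun k hk p hp => ?_)
    simp only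
    rw [px.pdx_mul hX hY hv hk hp, py.pdy_mul hX hY hv hk hp, lap]
    ring
  rw [integral_add i1 i2] at key
  linarith

/-- The error equation. -/
theorem ErrorSetting.aSD_error (h : ErrorSetting P ε A N u uI v) (hP : P.Admissible)
    (hf : ContinuousOn f OmegaBar) (hu : IsSolution P ε f u)
    (hN : IsSDFEMSolution P ε N Cstar f uN) (hmem : MemVN P ε N v) (hv : v = uI - uN) :
    aSD P ε N Cstar v v =
      ε * (∫ p in Omega, (pdx uI p - pdx u p) * pdx v p)
      + ε * (∫ p in Omega, (pdy uI p - pdy u p) * pdy v p)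
      - (∫ p in Omega, (uI - u) p * P.conv v p)
      + (∫ p in Omega, ((P.c p - (pdx P.b₁ p + pdy P.b₂ p)) * (uI - u) p) * v p)
      + Cstar * (N : ℝ)⁻¹ * ∫ p in Omega, chi P ε N p * (residual P ε u uI p * P.conv v p) := by
  have hM := h.mesh
  have hX := hM.gridX hP
  have hY := hM.gridY hP
  have pu := h.pc1_u hP
  have pI := h.pc1_uI hP
  have pv := h.pc1_v hP
  have pη := pI.sub hX hY pu
  have bc := bd_c hP
  have bχ := bd_chi (P := P) (ε := ε) (N := N)
  have bl := bd_lap h.contDiffOn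
  have bf := bd_of_continuousOn hf
  have hb1 := pc1_of_contDiffOn hX hY hP.smooth_b₁
  have hb2 := pc1_of_contDiffOn hX hY hP.smooth_b₂
  have s1 : aSD P ε N Cstar v v = aSD P ε N Cstar uI v - aSD P ε N Cstar uN v := by
    conv_lhs => rw [show aSD P ε N Cstar v v = aSD P ε N Cstar (uI - uN) v by rw [← hv]]
    exact aSD_sub hM hP h.interp hN.mem.isPL h.test
  have s2 := hN.eqn v hmem
  rw [rhs_eq hM hP Cstar hf h.test] at s2
  have s3 := integral_lap_mul hX hY h.contDiffOn pv h.boundary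
  have s4 := integral_conv_mul hP hX hY pη pv h.boundary
  -- Consistency: `f` is replaced by the differential operator applied to `u`, which holds at every
  -- point of the open square.
  have q1 : ∫ p in Omega, f p * v p = -ε * (∫ p in Omega, lap u p * v p) +
      ∫ p in Omega, (P.conv u p + P.c p * u p) * v p := by
    rw [← integral_const_mul, ← integral_add ((bl.mul pv.bd).const_mul _).integrable
      (((bd_conv hP pu).add (bc.mul pu.bd)).mul pv.bd).integrable]
    refine integral_congr_ae ?_
    filter_upwards [ae_mem_Omega] with p hp
    rw [← hu.eqn p hp]
    ring
  have x1 : ∫ p in Omega, (pdx uI p * pdx v p + pdy uI p * pdy v p) =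
      (∫ p in Omega, (pdx u p * pdx v p + pdy u p * pdy v p)) +
      (∫ p in Omega, (pdx uI p - pdx u p) * pdx v p) +
      ∫ p in Omega, (pdy uI p - pdy u p) * pdy v p := by
    have j1 := (pu.bdx.mul pv.bdx).add (pu.bdy.mul pv.bdy)
    have j2 := (pI.bdx.sub pu.bdx).mul pv.bdx
    have j3 := (pI.bdy.sub pu.bdy).mul pv.bdy
    rw [← integral_add j1.integrable j2.integrable,
      ← integral_add (j1.add j2).integrable j3.integrable]
    refine integral_congr_ae (Filter.Eventually.of_forall fun p => ?_)
    simp only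
    ring
  have x2 : ∫ p in Omega, (P.conv uI p + P.c p * uI p) * v p =
      (∫ p in Omega, (P.conv u p + P.c p * u p) * v p) +
      (∫ p in Omega, P.conv (uI - u) p * v p) +
      ∫ p in Omega, (P.c p * (uI - u) p) * v p := by
    have j1 := ((bd_conv hP pu).add (bc.mul pu.bd)).mul pv.bd
    have j2 := (bd_conv hP pη).mul pv.bd
    have j3 := (bc.mul pη.bd).mul pv.bd
    rw [← integral_add j1.integrable j2.integrable,
      ← integral_add (j1.add j2).integrable j3.integrable]
    refine integral_congr_ae (ae_of_otri hX hY fun k hk p hp => ?_)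
    simp only [Coeffs.conv, Pi.sub_apply]
    rw [pI.pdx_sub hX hY pu hk hp, pI.pdy_sub hX hY pu hk hp]
    ring
  -- The divergence of `b` is split off so that it cancels against the term produced by integrating
  -- the convection by parts.
  have x3 : ∫ p in Omega, (P.c p * (uI - u) p) * v p =
      (∫ p in Omega, ((P.c p - (pdx P.b₁ p + pdy P.b₂ p)) * (uI - u) p) * v p) +
      ∫ p in Omega, (pdx P.b₁ p + pdy P.b₂ p) * ((uI - u) p * v p) := by
    have bd := hb1.bdx.add hb2.bdy
    have j1 := ((bc.sub bd).mul pη.bd).mul pv.bd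
    have j2 := bd.mul (pη.bd.mul pv.bd)
    rw [← integral_add j1.integrable j2.integrable]
    refine integral_congr_ae (Filter.Eventually.of_forall fun p => ?_)
    simp only
    ring
  -- By the differential equation, `f` plus the residual is b·∇uI + c·uI; the Laplacian of `uI` is
  -- absent because it vanishes on each triangle.
  have x4 : ∫ p in Omega, chi P ε N p * ((P.conv uI p + P.c p * uI p) * P.conv v p) =
      (∫ p in Omega, chi P ε N p * (f p * P.conv v p)) +
      ∫ p in Omega, chi P ε N p * (residual P ε u uI p * P.conv v p) := by
    have j1 := bχ.mul (bf.mul (bd_conv hP pv))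
    have j2 := bχ.mul ((((bl.const_mul ε).add (bd_conv hP pη)).add (bc.mul pη.bd)).mul
      (bd_conv hP pv))
    have j2' : Bd fun p => chi P ε N p * (residual P ε u uI p * P.conv v p) := j2
    rw [← integral_add j1.integrable j2'.integrable]
    refine integral_congr_ae (ae_of_otri hX hY fun k hk p hp => ?_)
    simp only
    rw [← hu.eqn p (otri_subset_Omega hX hY hk hp), residual]
    simp only [Coeffs.conv, Pi.sub_apply]
    rw [pI.pdx_sub hX hY pu hk hp, pI.pdy_sub hX hY pu hk hp]
    ring
  rw [s1, s2, aSD_eq hM hP Cstar h.interp h.test, x1, x2, x3, x4, q1, s3, s4]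
  ring

end identity

end SDFEM

/-! ### Conclusion -/

namespace SDFEM

section final

variable {P : Coeffs} {ε A Cstar : ℝ} {N : ℕ} {f u uI uN : ℝ × ℝ → ℝ}

theorem rate_eq_rpow (hM : MeshAssumption P ε N) : rate ε N =
    (ε ^ ((1 : ℝ) / 2) * (N : ℝ)⁻¹ + (N : ℝ) ^ (-(3 : ℝ) / 2)) * Real.log N ^ ((3 : ℝ) / 2) := by
  have hN := hM.cast_pos
  have hl := zero_lt_one.trans_le hM.one_le_log
  have e1 : Real.log N ^ ((3 : ℝ) / 2) = Real.sqrt (Real.log N) ^ 3 := by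
    rw [Real.sqrt_eq_rpow, ← Real.rpow_natCast, ← Real.rpow_mul hl.le]
    norm_num
  have e2 : (N : ℝ) ^ (-(3 : ℝ) / 2) = 1 / (N * Real.sqrt N) := by
    rw [neg_div, Real.rpow_neg hN.le, Real.sqrt_eq_rpow, one_div, inv_inj,
      show (3 : ℝ) / 2 = 1 + 1 / 2 by norm_num, Real.rpow_add hN, Real.rpow_one]
  rw [rate, e1, e2, ← Real.sqrt_eq_rpow, div_eq_mul_inv (Real.sqrt ε)]

/-- The interpolant inherits the zero values of `u` at the boundary nodes, hence vanishes on the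
whole boundary. This makes the difference admissible both in the coercivity bound and as a test
function. -/
theorem memVN_interp_sub (hM : MeshAssumption P ε N) (hP : P.Admissible) (hu : IsSolution P ε f u)
    (hI : IsNodalInterpolant P ε N u uI) (hN : MemVN P ε N uN) : MemVN P ε N (uI - uN) where
  continuousOn := hI.continuousOn.sub hN.continuousOn
  affine k hk := by
    have := (hI.toIsPiecewiseLinear.isPL.sub hN.isPL).affine k hk
    rwa [← tri_eq_ctri] at this
  boundary p hp := by
    have h4 := hM.four_le
    have := hI.toIsPiecewiseLinear.isPL.eq_zero_of_mem_frontier (hM.gridX hP) (hM.gridY hP)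
      (by omega) (fun i j hi hj hm => (hI.interp i j hi hj).trans (hu.boundary _ hm)) hp
    rw [Pi.sub_apply, this, hN.boundary p hp, sub_zero]

/-- The supercloseness bound. -/
theorem exists_sdNorm_le (hP : P.Admissible) (hC : 0 < Cstar) (A : ℝ) : ∃ C : ℝ, 0 < C ∧
    ∀ (ε : ℝ) (N : ℕ), MeshAssumption P ε N → Coercive P ε N Cstar →
      ∀ f u uI uN : ℝ × ℝ → ℝ, ContinuousOn f OmegaBar → IsSolution P ε f u →
        HasLayerDecomposition P ε A u → IsNodalInterpolant P ε N u uI →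
        IsSDFEMSolution P ε N Cstar f uN → sdNorm P ε N Cstar (uI - uN) ≤ C * rate ε N := by
  obtain ⟨K₁, hK₁, h₁⟩ := exists_stiffness_bound_pdx hP A
  obtain ⟨K₂, hK₂, h₂⟩ := exists_stiffness_bound_pdy hP A
  obtain ⟨B, hB, hb⟩ := exists_coeff_bound hP
  have hsm := Real.sqrt_pos.2 hP.μ₀_pos
  set K₃ := 22 * A / Real.sqrt Cstar + 4 * ((22 * A + layerConst P A) * widthConst P * B) with hK₃
  set K₄ := B * (22 * A + 2 * (layerConst P A * widthConst P)) / Real.sqrt P.μ₀ with hK₄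
  set K₅ := residualConst P A B * Real.sqrt Cstar +
    (2 * A + B * (2 * A)) * (46 * B) * (1 / P.β₁ + 1 / P.β₂) * Cstar / Real.sqrt P.μ₀ with hK₅
  -- The 2 undoes the coercivity constant ½; the absolute value and the 1 make the constant positive
  -- without using the sign of `A`.
  refine ⟨2 * |K₁ + K₂ + K₃ + K₄ + K₅| + 1, by positivity, ?_⟩
  intro ε N hM hco f u uI uN hf hu hd hI hN
  have hmem := memVN_interp_sub hM hP hu hI hN.mem
  have h : ErrorSetting P ε A N u uI (uI - uN) :=
    ⟨hM, hd, hI.toIsPiecewiseLinear.isPL, hI.interp, hmem.isPL, hmem.boundary⟩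
  have hX := hM.gridX hP
  have hY := hM.gridY hP
  have heq := h.aSD_error hP hf hu hN hmem rfl
  have hc := hco _ hmem
  obtain ⟨g1, g2, g3, -⟩ := sqrt_mul_nrm_le_sdNorm hM hP hC h.test
  have hnv := sdNorm_nonneg (P := P) (ε := ε) (N := N) (Cstar := Cstar) (v := uI - uN)
  have hR := rate_pos hM
  have hse := Real.sqrt_nonneg ε
  have hee : Real.sqrt ε * Real.sqrt ε = ε := Real.mul_self_sqrt hM.ε_pos.le
  have t1 := h₁ ε N u uI _ h
  have t2 := h₂ ε N u uI _ h
  have t3 := h.abs_integral_err_mul_conv_le hP hC hB fun p hp => ⟨(hb p hp).1, (hb p hp).2.1⟩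
  have t5 := h.stabilization_le hP hC hB fun p hp =>
    ⟨(hb p hp).1, (hb p hp).2.1, (hb p hp).2.2.1⟩
  have hb1 := pc1_of_contDiffOn hX hY hP.smooth_b₁
  have hb2 := pc1_of_contDiffOn hX hY hP.smooth_b₂
  have t4 : |∫ p in Omega, ((P.c p - (pdx P.b₁ p + pdy P.b₂ p)) * (uI - u) p) * (uI - uN) p| ≤
      K₄ * rate ε N * sdNorm P ε N Cstar (uI - uN) := by
    have bη := h.bd_err hP
    have bg := ((bd_c hP).sub (hb1.bdx.add hb2.bdy)).mul bη
    refine (abs_integral_mul_le bg (h.pc1_v hP).bd).trans ?_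
    have n1 : nrm (fun p => (P.c p - (pdx P.b₁ p + pdy P.b₂ p)) * (uI - u) p) ≤
        B * nrm (uI - u) := by
      refine (nrm_mono (bη.abs.const_mul B) ?_).trans ?_
      · filter_upwards [ae_mem_Omega] with p hp
        rw [abs_mul]
        exact mul_le_mul_of_nonneg_right (hb p (Omega_subset_OmegaBar hp)).2.2.2 (abs_nonneg _)
      · rw [nrm_const_mul, nrm_abs, abs_of_nonneg hB]
    have n2 := h.nrm_err_le hP
    calc _ ≤ B * ((22 * A + 2 * (layerConst P A * widthConst P)) * rate ε N) *
          (sdNorm P ε N Cstar (uI - uN) / Real.sqrt P.μ₀) :=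
          mul_le_mul (n1.trans (mul_le_mul_of_nonneg_left n2 hB)) g3 (nrm_nonneg _)
            (mul_nonneg hB ((nrm_nonneg _).trans n2))
      _ = _ := by rw [hK₄]; ring
  set nv := sdNorm P ε N Cstar (uI - uN)
  -- The factor ε is split into two square roots, one for the stiffness bound and one to bring the
  -- derivative of `v` into the norm.
  have r : ∀ {K I n : ℝ}, 0 ≤ K → Real.sqrt ε * |I| ≤ K * rate ε N * n → Real.sqrt ε * n ≤ nv →
      |ε * I| ≤ K * rate ε N * nv := by
    intro K I n hK h1 h2
    rw [abs_mul, abs_of_pos hM.ε_pos]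
    calc ε * |I| = Real.sqrt ε * (Real.sqrt ε * |I|) := by rw [← mul_assoc, hee]
      _ ≤ Real.sqrt ε * (K * rate ε N * n) := mul_le_mul_of_nonneg_left h1 hse
      _ = K * rate ε N * (Real.sqrt ε * n) := by ring
      _ ≤ _ := mul_le_mul_of_nonneg_left h2 (mul_nonneg hK hR.le)
  have s1 := r hK₁ t1 g1
  have s2 := r hK₂ t2 g2
  rw [abs_le] at s1 s2 t3 t4 t5
  have hfin : (1 / 2) * nv ^ 2 ≤ |K₁ + K₂ + K₃ + K₄ + K₅| * rate ε N * nv := by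
    refine hc.trans (le_trans ?_ (mul_le_mul_of_nonneg_right
      (mul_le_mul_of_nonneg_right (le_abs_self _) hR.le) hnv))
    rw [heq]
    linarith [s1.2, s2.2, t3.1, t4.2, t5.2]
  -- One factor of the norm is cancelled, which requires it to be nonzero.
  rcases hnv.eq_or_lt with h0 | h0
  · rw [← h0]
    positivity
  · have : nv ≤ 2 * |K₁ + K₂ + K₃ + K₄ + K₅| * rate ε N := by
      refine le_of_mul_le_mul_right ?_ h0
      linarith [pow_two nv]
    linarith

end final

end SDFEM

theorem mainTheorem1 (P : SDFEM.Coeffs) (hP : P.Admissible) :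
    (∃ C₀ : ℝ, 0 < C₀ ∧ ∀ Cstar : ℝ, 0 < Cstar → Cstar ≤ C₀ →
      ∀ (ε : ℝ) (N : ℕ), SDFEM.MeshAssumption P ε N → SDFEM.Coercive P ε N Cstar) ∧
    (∀ Cstar A : ℝ, 0 < Cstar → 0 < A → ∃ C : ℝ, 0 < C ∧
      ∀ (ε : ℝ) (N : ℕ), SDFEM.MeshAssumption P ε N → SDFEM.Coercive P ε N Cstar →
      ∀ f u uI uN : ℝ × ℝ → ℝ, ContinuousOn f SDFEM.OmegaBar →
        SDFEM.IsSolution P ε f u →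
        SDFEM.HasLayerDecomposition P ε A u →
        SDFEM.IsNodalInterpolant P ε N u uI →
        SDFEM.IsSDFEMSolution P ε N Cstar f uN →
        SDFEM.energyNorm P ε (uI - uN) ≤ SDFEM.sdNorm P ε N Cstar (uI - uN) ∧
        SDFEM.sdNorm P ε N Cstar (uI - uN) ≤
          C * (ε ^ ((1 : ℝ) / 2) * (N : ℝ)⁻¹ + (N : ℝ) ^ (-(3 : ℝ) / 2))
            * Real.log N ^ ((3 : ℝ) / 2)) := by
  refine ⟨SDFEM.exists_coercive hP, fun Cstar A hC _ => ?_⟩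
  obtain ⟨C, hC0, h⟩ := SDFEM.exists_sdNorm_le hP hC A
  refine ⟨C, hC0, fun ε N hM hco f u uI uN hf hu hd hI hN => ⟨?_, ?_⟩⟩
  · exact SDFEM.energyNorm_le_sdNorm hM hP hC.le
      (hI.toIsPiecewiseLinear.isPL.sub hN.mem.isPL)
  · rw [mul_assoc, ← SDFEM.rate_eq_rpow hM]
    exact h ε N hM hco f u uI uN hf hu hd hI hN
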